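/- Let $(\zeta_e)_{e\in\mathbb B}$ be a countable family of independent standard Gaussian random variables on a probability space $(\Omega,\mathbb P)$, with expectation $\langle\cdot\rangle$, and let $L^2(\zeta)$ denote the space of square-integrable random variables that are ($\mathbb P$-almost surely equal to) $\sigma(\zeta_e : e\in\mathbb B)$-measurable functions. For $G\in L^2(\zeta)$ and $e \in \mathbb B$, a random variable $U=\partial_eG\in L^2(\zeta)$ is called the weak derivative of $G$ with respect to $\zeta_e$ if for every finite set $\Lambda\subset\mathbb B$ and every smooth, compactly supported $\eta:\mathbb R^{\Lambda}\to\mathbb R$, writing $\eta(\zeta)=\eta((\zeta_{e'})_{e'\in\Lambda})$, $$\langle U\,\eta(\zeta)\rangle=\langle G\,\zeta_e\,\eta(\zeta)\rangle-\Big\langle G\,\frac{\partial\eta}{\partial\zeta_e}(\zeta)\Big\rangle ,$$ where $\partial\eta/\partial\zeta_e=0$ if $e\notin\Lambda$. Let $F\in L^2(\zeta)$ satisfy $\langle F\rangle=0$ and $\langle F^2\rangle=1$. Assume that the weak derivatives $\partial_eF$ and $\partial_{e'}\partial_eF=\partial_{e'}(\partial_e F)$ exist for all $e,e'\in\mathbb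 B$, that $\sum_{e}\langle|\partial_eF|^4\rangle^{1/2}<\infty$, and that $\langle|\partial_{e'}\partial_eF|^4\rangle<\infty$ for all $e,e'\in\mathbb B$. Let $Y$ be a standard Gaussian random variable. Then $$\sup_{h}\ \big(\langle h(F)\rangle-\langle h(Y)\rangle\big)\ \le\ \sqrt{\frac5\pi}\,\Bigg(\sum_{e'\in\mathbb B}\Big(\sum_{e\in\mathbb B}\langle|\partial_eF|^4\rangle^{1/4}\,\langle|\partial_{e'}\partial_eF|^4\rangle^{1/4}\Big)^2\Bigg)^{1/2},$$ where the supremum is over all Lipschitz functions $h:\mathbb R\to\mathbb R$ with $\|h'\|_\infty\le1$ (that is, all $1$-Lipschitz functions), and the right-hand side is allowed to be $+\infty$. -/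

import Mathlib

open MeasureTheory ProbabilityTheory
open scoped ENNReal

namespace GaussFunctional

variable {ι Ω : Type*}

/-- The σ-algebra on `Ω` generated by the family of real random variables `ζ`. -/
abbrev sigma (ζ : ι → Ω → ℝ) : MeasurableSpace Ω :=
  ⨆ e, MeasurableSpace.comap (ζ e) inferInstance

/-- `F` is a square-integrable functional of the family `ζ`: it agrees almost surely with a
`σ(ζ)`-measurable function and has a finite second moment. -/
def IsL2Functional [MeasurableSpace Ω] (P : Measure Ω) (ζ : ι → Ω → ℝ) (F : Ω → ℝ) : Prop :=
  AEStronglyMeasurable[sigma ζ] F P ∧ MemLp F 2 P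

/-- The vector `(ζ_{e'}(ω))_{e' ∈ Λ}`. -/
def coords (ζ : ι → Ω → ℝ) (Λ : Finset ι) (ω : Ω) : Λ → ℝ := fun e' => ζ e' ω

open Classical in
/-- The partial derivative of `η : ℝ^Λ → ℝ` in the coordinate `e`; it is `0` when `e ∉ Λ`,
since then `η` does not depend on that coordinate. -/
noncomputable def partialDeriv (Λ : Finset ι) (η : (Λ → ℝ) → ℝ) (e : ι) (x : Λ → ℝ) : ℝ :=
  fderiv ℝ η x (fun e' => if (e' : ι) = e then 1 else 0)

/-- `U ∈ L²` is the weak derivative of `F` with respect to `ζ_e`: for every finite set `Λ` of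
indices and every smooth compactly supported `η : ℝ^Λ → ℝ`,
`⟨U η(ζ)⟩ = ⟨F ζ_e η(ζ)⟩ - ⟨F (∂η/∂ζ_e)(ζ)⟩`. -/
def IsWeakDeriv [MeasurableSpace Ω] (P : Measure Ω) (ζ : ι → Ω → ℝ) (e : ι)
    (F U : Ω → ℝ) : Prop :=
  IsL2Functional P ζ U ∧
    ∀ (Λ : Finset ι) (η : (Λ → ℝ) → ℝ), ContDiff ℝ (⊤ : ℕ∞) η → HasCompactSupport η →
      ∫ ω, U ω * η (coords ζ Λ ω) ∂P =
        ∫ ω, F ω * ζ e ω * η (coords ζ Λ ω) ∂P -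
          ∫ ω, F ω * partialDeriv Λ η e (coords ζ Λ ω) ∂P

/-- `sup { ⟨h(X)⟩ - ⟨h(W)⟩ : ‖h'‖_∞ ≤ 1 }`, the supremum being over all functions `h : ℝ → ℝ`
that are Lipschitz with constant `1` (the absolutely continuous functions with `|h'| ≤ 1` almost
everywhere). -/
noncomputable def kantorovich {Ω' : Type*} [MeasurableSpace Ω] [MeasurableSpace Ω']
    (P : Measure Ω) (X : Ω → ℝ) (Q : Measure Ω') (W : Ω' → ℝ) : EReal :=
  ⨆ h : {h : ℝ → ℝ // LipschitzWith 1 h},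
    ((∫ ω, h.1 (X ω) ∂P - ∫ ω, h.1 (W ω) ∂Q : ℝ) : EReal)

end GaussFunctional

/-!
A normalized square integrable functional `F` of independent standard Gaussians is close to a
Gaussian as soon as its second order derivatives are small: the argument combines Stein's method
with the Ornstein–Uhlenbeck semigroup.

Only the law of the vector `(ζ e)` matters, so everything takes place on `ι → ℝ` with the measure
`μ` under which all finite linear forms are centred Gaussian (`StdGaussian`). Weak derivatives are
tested against the waves `cos (l ⬝ x + a)` instead of compactly supported functions
(`HasWeakDeriv`, `IsWeakDeriv.hasWeakDeriv`). Waves determine measures, their span `trig` is dense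
in Sobolev spaces (`StdGaussian.exists_trig_approx`), and the semigroup `mehler c`, `c = exp (-t)`,
multiplies each frequency-`l` wave by a scalar and contracts its frequency to `c • l`.

For a single wave, differentiating `c ↦ ⟨H, mehler c G⟩` and integrating by parts gives the
covariance formula (`StdGaussian.covariance`)
`⟨H G⟩ - ⟨H⟩ ⟨G⟩ = ∫ c in 0..1, ∑ e, ⟨∂_e H, mehler c (∂_e G)⟩`, which extends to Sobolev functions
by density. Taking `H = G` yields the Poincaré inequality (`StdGaussian.poincare`).

Let `f` solve Stein's equation `f' x - x f x = h x - ⟨h(Y)⟩` with `|f'| ≤ √(2/π)`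
(`exists_stein_solution`), so that `⟨h(F)⟩ - ⟨h(Y)⟩ = ⟨f'(F)⟩ - ⟨F f(F)⟩`. With the smoothed squared
gradient `T c = ∑ e, ∂_e F * mehler c (∂_e F)`, the covariance formula for `(f(F), F)` reads
`⟨F f(F)⟩ = ∫ c in 0..1, ⟨f'(F) T c⟩`, and for `(F, F)` it reads `1 = ∫ c in 0..1, ⟨T c⟩`. Hence the
discrepancy is at most `√(2/π)` times the integral of the standard deviation of `T c`. The product
rule, Hölder's inequality, the contractivity of `mehler c` on `L⁴` and the relation
`∂_e' (mehler c G) = c * mehler c (∂_e' G)` bound `‖∂_e' (T c)‖₂` by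
`(1 + c) ∑ e, ‖∂_e F‖₄ ‖∂_e' ∂_e F‖₄`, so the Poincaré inequality controls the variance of `T c`
(`StdGaussian.integral_sq_sub_mean_le`, `StdGaussian.abs_stein_le`). Since `∫ c in 0..1, (1 + c)` is
`3/2`, the resulting constant is `3/2 * √(2/π) = √(9/(2π)) ≤ √(5/π)`.
-/

namespace GaussFunctional

variable {ι : Type*}

/-! ### Linear forms and their cosines -/

/-- The linear form `x ↦ ∑ e, l e * x e` on `ℝ^ι` with finitely supported coefficients `l`. -/
def lin (l : ι →₀ ℝ) (x : ι → ℝ) : ℝ := l.sum fun e r => r * x e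

/-- The squared Euclidean norm of the coefficient vector `l`. -/
def normSq (l : ι →₀ ℝ) : ℝ := lin l l

theorem lin_add_left (l k : ι →₀ ℝ) (x : ι → ℝ) : lin (l + k) x = lin l x + lin k x :=
  Finsupp.sum_add_index' (by simp) (by intros; ring)

theorem lin_smul_left (c : ℝ) (l : ι →₀ ℝ) (x : ι → ℝ) : lin (c • l) x = c * lin l x := by
  rw [lin, Finsupp.sum_smul_index' (by simp), lin, Finsupp.mul_sum]
  simp [mul_assoc]

theorem lin_add_right (l : ι →₀ ℝ) (x y : ι → ℝ) : lin l (x + y) = lin l x + lin l y := by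
  simp [lin, mul_add, Finsupp.sum_add]

theorem lin_smul_right (c : ℝ) (l : ι →₀ ℝ) (x : ι → ℝ) : lin l (c • x) = c * lin l x := by
  rw [lin, lin, Finsupp.mul_sum]
  simp only [Pi.smul_apply, smul_eq_mul]
  exact Finsupp.sum_congr fun e _ => by ring

theorem lin_neg_left (l : ι →₀ ℝ) (x : ι → ℝ) : lin (-l) x = -lin l x := by
  simpa using lin_smul_left (-1) l x

theorem lin_sub_left (l k : ι →₀ ℝ) (x : ι → ℝ) : lin (l - k) x = lin l x - lin k x := by
  rw [sub_eq_add_neg, lin_add_left, lin_neg_left, sub_eq_add_neg]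

theorem lin_zero_left (x : ι → ℝ) : lin (0 : ι →₀ ℝ) x = 0 := by simp [lin]

theorem lin_single (e : ι) (r : ℝ) (x : ι → ℝ) : lin (Finsupp.single e r) x = r * x e := by
  simp [lin]

theorem lin_eq_sum {l : ι →₀ ℝ} {s : Finset ι} (h : l.support ⊆ s) (x : ι → ℝ) :
    lin l x = ∑ e ∈ s, l e * x e :=
  Finsupp.sum_of_support_subset _ h _ (by simp)

theorem lin_comm (l k : ι →₀ ℝ) : lin l k = lin k l := by
  classical
  rw [lin_eq_sum (s := l.support ∪ k.support) Finset.subset_union_left,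
    lin_eq_sum (s := l.support ∪ k.support) Finset.subset_union_right]
  exact Finset.sum_congr rfl fun e _ => mul_comm _ _

theorem measurable_lin (l : ι →₀ ℝ) : Measurable (lin l) := by
  unfold lin Finsupp.sum
  fun_prop

theorem normSq_nonneg (l : ι →₀ ℝ) : 0 ≤ normSq l :=
  Finset.sum_nonneg fun e _ => mul_self_nonneg (l e)

theorem normSq_smul (c : ℝ) (l : ι →₀ ℝ) : normSq (c • l) = c ^ 2 * normSq l := by
  rw [normSq, lin_smul_left, Finsupp.coe_smul, lin_smul_right, normSq]; ring

/-- Rotating a pair of coefficient vectors preserves the sum of the squared norms. -/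
theorem normSq_rotate {c s : ℝ} (h : c ^ 2 + s ^ 2 = 1) (l k : ι →₀ ℝ) :
    normSq (c • l + s • k) + normSq (s • l - c • k) = normSq l + normSq k := by
  have hc := lin_comm l k
  simp only [normSq, sub_eq_add_neg, lin_add_left, lin_neg_left, lin_smul_left, Finsupp.coe_add,
    lin_add_right, Finsupp.coe_smul, lin_smul_right]
  rw [show (⇑(-(c • k)) : ι → ℝ) = (-c) • ⇑k by ext; simp]
  simp only [lin_smul_right]
  linear_combination (lin l l + lin k k) * h

/-- The wave `x ↦ cos (l ⬝ x + a)`; the phases make real parts of characters suffice. -/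
noncomputable def wave (l : ι →₀ ℝ) (a : ℝ) (x : ι → ℝ) : ℝ := Real.cos (lin l x + a)

/-- The wave `x ↦ sin (l ⬝ x + a)`, a phase shift of `wave`. -/
noncomputable def swave (l : ι →₀ ℝ) (a : ℝ) (x : ι → ℝ) : ℝ := Real.sin (lin l x + a)

theorem wave_add_pi_div_two (l : ι →₀ ℝ) (a : ℝ) (x : ι → ℝ) :
    wave l (a + Real.pi / 2) x = -swave l a x := by
  rw [wave, ← add_assoc, Real.cos_add_pi_div_two, swave]

theorem swave_add_pi_div_two (l : ι →₀ ℝ) (a : ℝ) (x : ι → ℝ) :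
    swave l (a + Real.pi / 2) x = wave l a x := by
  rw [swave, ← add_assoc, Real.sin_add_pi_div_two, wave]

theorem measurable_wave (l : ι →₀ ℝ) (a : ℝ) : Measurable (wave l a) :=
  Real.measurable_cos.comp ((measurable_lin l).add_const a)

theorem measurable_swave (l : ι →₀ ℝ) (a : ℝ) : Measurable (swave l a) :=
  Real.measurable_sin.comp ((measurable_lin l).add_const a)

theorem abs_wave_le (l : ι →₀ ℝ) (a : ℝ) (x : ι → ℝ) : |wave l a x| ≤ 1 := Real.abs_cos_le_one _

theorem abs_swave_le (l : ι →₀ ℝ) (a : ℝ) (x : ι → ℝ) : |swave l a x| ≤ 1 := Real.abs_sin_le_one _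

/-! ### Waves determine measures -/

/-- A finite measure on `ℝ^ι` is determined by its integrals of waves. -/
theorem ext_of_integral_wave {m n : Measure (ι → ℝ)} [IsFiniteMeasure m] [IsFiniteMeasure n]
    (h : ∀ l a, ∫ x, wave l a x ∂m = ∫ x, wave l a x ∂n) : m = n := by
  classical
  have key : ∀ I : Finset ι, m.map I.restrict = n.map I.restrict := by
    intro I
    have hr : Measurable (I.restrict : (ι → ℝ) → (I → ℝ)) := Finset.measurable_restrict I
    refine Measure.ext_of_charFunDual (funext fun L => ?_)
    set l : ι →₀ ℝ := ∑ i : I, Finsupp.single (i : ι) (L (Pi.single i 1)) with hl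
    have hL : ∀ x : ι → ℝ, L (I.restrict x) = lin l x := by
      intro x
      have h1 : I.restrict x = ∑ i : I, x i • (Pi.single i 1 : I → ℝ) := by
        ext j; simp [Finset.sum_apply, Pi.single_apply]
      have h2 : ∀ s : Finset I, lin (∑ i ∈ s, Finsupp.single (i : ι) (L (Pi.single i 1))) x
          = ∑ i ∈ s, L (Pi.single i 1) * x i := by
        intro s
        induction s using Finset.induction_on with
        | empty => simp [lin_zero_left]
        | insert a s ha ih => rw [Finset.sum_insert ha, lin_add_left, lin_single, ih,
            Finset.sum_insert ha]
      rw [h1, map_sum, hl, h2]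
      simp [mul_comm]
    have key2 : ∀ q : Measure (ι → ℝ), IsFiniteMeasure q → charFunDual (q.map I.restrict) L
        = ((∫ x, wave l 0 x ∂q : ℝ) : ℂ) + ((∫ x, wave l (-(Real.pi / 2)) x ∂q : ℝ) : ℂ)
          * Complex.I := by
      intro q hq
      have hi : ∀ a, Integrable (wave l a) q := fun a =>
        Integrable.of_bound (measurable_wave l a).aestronglyMeasurable 1
          (Filter.Eventually.of_forall fun x => abs_wave_le l a x)
      rw [charFunDual_apply, integral_map hr.aemeasurable (by fun_prop),
        ← integral_complex_ofReal, ← integral_complex_ofReal, ← integral_mul_const,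
        ← integral_add]
      · refine integral_congr_ae (Filter.Eventually.of_forall fun x => ?_)
        simp only [hL, wave, add_zero, ← sub_eq_add_neg, Real.cos_sub_pi_div_two,
          Complex.exp_mul_I, Complex.ofReal_cos, Complex.ofReal_sin]
      · exact (hi 0).ofReal
      · exact (hi _).ofReal.mul_const _
    rw [key2 m inferInstance, key2 n inferInstance, h, h]
  refine IsProjectiveLimit.unique (P := fun I => m.map I.restrict) (fun I => rfl)
    (fun I => (key I).symm)

/-- Waves are total in `L¹`: an integrable function orthogonal to all waves vanishes. -/
theorem ae_eq_zero_of_integral_wave {μ : Measure (ι → ℝ)} {G : (ι → ℝ) → ℝ}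
    (hG : Integrable G μ) (h : ∀ l a, ∫ x, G x * wave l a x ∂μ = 0) : G =ᵐ[μ] 0 := by
  have hfin1 : IsFiniteMeasure (μ.withDensity fun x => ENNReal.ofReal (G x)) :=
    isFiniteMeasure_withDensity_ofReal hG.2
  have hfin2 : IsFiniteMeasure (μ.withDensity fun x => ENNReal.ofReal (-G x)) :=
    isFiniteMeasure_withDensity_ofReal hG.neg.2
  have e1 : ∀ (H : (ι → ℝ) → ℝ), Integrable H μ → ∀ w : (ι → ℝ) → ℝ,
      ∫ x, w x ∂(μ.withDensity fun x => ENNReal.ofReal (H x)) = ∫ x, max (H x) 0 * w x ∂μ := by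
    intro H hH w
    rw [integral_withDensity_eq_integral_toReal_smul₀ hH.1.aemeasurable.ennreal_ofReal
      (Filter.Eventually.of_forall fun x => ENNReal.ofReal_lt_top)]
    simp only [ENNReal.toReal_ofReal', smul_eq_mul]
  have heq : (μ.withDensity fun x => ENNReal.ofReal (G x))
      = μ.withDensity fun x => ENNReal.ofReal (-G x) := by
    refine ext_of_integral_wave fun l a => ?_
    rw [e1 G hG, e1 (fun x => -G x) hG.neg, ← sub_eq_zero, ← integral_sub]
    · refine (integral_congr_ae (Filter.Eventually.of_forall fun x => ?_)).trans (h l a)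
      simp only [← sub_mul]
      congr 1
      exact max_zero_sub_eq_self (G x)
    · exact (hG.pos_part).mul_bdd (c := 1) (measurable_wave l a).aestronglyMeasurable
        (Filter.Eventually.of_forall fun x => abs_wave_le l a x)
    · exact (hG.neg.pos_part).mul_bdd (c := 1) (measurable_wave l a).aestronglyMeasurable
        (Filter.Eventually.of_forall fun x => abs_wave_le l a x)
  have h3 := (withDensity_eq_iff hG.1.aemeasurable.ennreal_ofReal
    hG.neg.1.aemeasurable.ennreal_ofReal (by
      rw [← lt_top_iff_ne_top]; exact (hG.lintegral_lt_top))).1 heq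
  filter_upwards [h3] with x hx
  have h4 := congrArg ENNReal.toReal hx
  simp only [ENNReal.toReal_ofReal', Pi.neg_apply] at h4
  rw [Pi.zero_apply, ← max_zero_sub_eq_self (G x), h4, sub_self]

/-! ### Standard Gaussian measures on `ℝ^ι` -/

/-- `μ` is the law of a family of independent standard Gaussian variables: every linear form `l`
is a centred Gaussian variable of variance `normSq l`. -/
structure StdGaussian (μ : Measure (ι → ℝ)) : Prop where
  map_lin : ∀ l, μ.map (lin l) = gaussianReal 0 (normSq l).toNNReal

theorem integral_cos_gaussianReal (v : NNReal) (t a : ℝ) :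
    ∫ s, Real.cos (t * s + a) ∂gaussianReal 0 v = Real.exp (-(v * t ^ 2) / 2) * Real.cos a := by
  have h1 := charFun_gaussianReal (μ := 0) (v := v) t
  rw [charFun_apply_real] at h1
  have hint : Integrable (fun s : ℝ => Complex.exp (t * s * Complex.I)) (gaussianReal 0 v) := by
    refine Integrable.of_bound (by fun_prop) 1 (Filter.Eventually.of_forall fun s => ?_)
    simpa using (Complex.norm_exp_ofReal_mul_I (t * s)).le
  have h3 : ∀ s : ℝ, Real.cos (t * s + a)
      = (Complex.exp (t * s * Complex.I) * Complex.exp (a * Complex.I)).re := by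
    intro s
    rw [← Complex.exp_add, ← Complex.exp_ofReal_mul_I_re]
    congr 2
    push_cast; ring
  simp_rw [h3]
  have h4 := integral_re (hint.mul_const (Complex.exp (a * Complex.I)))
  simp only [RCLike.re_to_complex] at h4
  rw [h4, integral_mul_const, h1, ← Complex.exp_add,
    show (t * (0 : ℝ) * Complex.I - (v : ℝ) * t ^ 2 / 2 + a * Complex.I : ℂ)
      = ((-((v : ℝ) * t ^ 2) / 2 : ℝ) : ℂ) + (a : ℝ) * Complex.I by push_cast; ring,
    Complex.exp_add, ← Complex.ofReal_exp, Complex.re_ofReal_mul, Complex.exp_ofReal_mul_I_re]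

/-- The law of a family of independent standard Gaussian variables is a standard Gaussian
measure. -/
theorem stdGaussian_map {Ω : Type*} [MeasurableSpace Ω] {P : Measure Ω} [IsProbabilityMeasure P]
    {ζ : ι → Ω → ℝ} (hζm : ∀ e, Measurable (ζ e)) (hζi : iIndepFun ζ P)
    (hζ : ∀ e, P.map (ζ e) = gaussianReal 0 1) : StdGaussian (P.map fun ω e => ζ e ω) := by
  classical
  have hZ : Measurable fun ω e => ζ e ω := measurable_pi_lambda _ hζm
  refine ⟨fun l => ?_⟩
  have hi : iIndepFun (fun e ω => l e * ζ e ω) P :=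
    hζi.comp (fun e s => l e * s) fun e => measurable_const_mul _
  have hg : ∀ e, P.map (fun ω => l e * ζ e ω) = gaussianReal 0 (l e ^ 2).toNNReal := by
    intro e
    have := gaussianReal_map_const_mul (μ := 0) (v := 1) (l e)
    rw [← hζ e, Measure.map_map (measurable_const_mul _) (hζm e)] at this
    rw [show (fun ω => l e * ζ e ω) = (fun s => l e * s) ∘ ζ e from rfl, this]
    congr 1
    · simp
    · ext; simp [Real.coe_toNNReal _ (sq_nonneg (l e))]
  have hsum : ∀ s : Finset ι, P.map (∑ e ∈ s, fun ω => l e * ζ e ω)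
      = gaussianReal 0 (∑ e ∈ s, l e ^ 2).toNNReal := by
    intro s
    induction s using Finset.induction_on with
    | empty =>
      simp only [Finset.sum_empty, Real.toNNReal_zero, gaussianReal_zero_var]
      exact (Measure.map_const P (0 : ℝ)).trans (by simp)
    | insert a s ha ih =>
      rw [Finset.sum_insert ha, Finset.sum_insert ha,
        gaussianReal_add_gaussianReal_of_indepFun _ (hg a) ih, add_zero,
        Real.toNNReal_add (sq_nonneg _) (Finset.sum_nonneg fun _ _ => sq_nonneg _)]
      exact (hi.indepFun_finsetSum_of_notMem (fun e => (hζm e).const_mul _) ha).symm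
  rw [Measure.map_map (measurable_lin l) hZ]
  convert hsum l.support using 2
  · ext ω
    simp [lin, Finsupp.sum]
  · simp [normSq, lin, Finsupp.sum, pow_two]

namespace StdGaussian

variable {μ : Measure (ι → ℝ)}

theorem isProbabilityMeasure (hμ : StdGaussian μ) : IsProbabilityMeasure μ := by
  have h : IsProbabilityMeasure (μ.map (lin (0 : ι →₀ ℝ))) := by
    rw [hμ.map_lin]; infer_instance
  exact (Measure.isProbabilityMeasure_map_iff (measurable_lin _).aemeasurable).1 h

theorem integral_wave (hμ : StdGaussian μ) (l : ι →₀ ℝ) (a : ℝ) :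
    ∫ x, wave l a x ∂μ = Real.exp (-normSq l / 2) * Real.cos a := by
  have h := integral_cos_gaussianReal (normSq l).toNNReal 1 a
  rw [← hμ.map_lin l, integral_map (measurable_lin l).aemeasurable (by fun_prop)] at h
  simpa [wave, Real.coe_toNNReal _ (normSq_nonneg l)] using h

theorem memLp_eval (hμ : StdGaussian μ) (e : ι) {p : ℝ≥0∞} (hp : p ≠ ∞) :
    MemLp (fun x => x e) p μ := by
  have h := hμ.map_lin (Finsupp.single e 1)
  have h2 : lin (Finsupp.single e (1 : ℝ)) = fun x => x e := by ext x; simp [lin_single]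
  rw [h2] at h
  have h3 := memLp_id_gaussianReal' (μ := 0) (v := (normSq (Finsupp.single e (1 : ℝ))).toNNReal)
    p hp
  rw [← h] at h3
  exact (memLp_map_measure_iff aestronglyMeasurable_id (measurable_pi_apply e).aemeasurable).1 h3

theorem memLp_lin (hμ : StdGaussian μ) (l : ι →₀ ℝ) {p : ℝ≥0∞} (hp : p ≠ ∞) :
    MemLp (lin l) p μ := by
  have h3 := memLp_id_gaussianReal' (μ := 0) (v := (normSq l).toNNReal) p hp
  rw [← hμ.map_lin l] at h3
  exact (memLp_map_measure_iff (by fun_prop) (measurable_lin l).aemeasurable).1 h3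

/-- The rotation `(x, y) ↦ (c x + s y, s x - c y)`, an involution, preserves `μ × μ`. -/
theorem measurePreserving_rotate (hμ : StdGaussian μ) {c s : ℝ} (h : c ^ 2 + s ^ 2 = 1) :
    MeasurePreserving (fun p : (ι → ℝ) × (ι → ℝ) => (c • p.1 + s • p.2, s • p.1 - c • p.2))
      (μ.prod μ) (μ.prod μ) := by
  have := hμ.isProbabilityMeasure
  have hm : Measurable
      (fun p : (ι → ℝ) × (ι → ℝ) => (c • p.1 + s • p.2, s • p.1 - c • p.2)) := by fun_prop
  refine ⟨hm, ?_⟩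
  -- Identify `ℝ^ι × ℝ^ι` with `ℝ^(ι ⊕ ι)`, where measures are determined by waves.
  set E := (MeasurableEquiv.sumPiEquivProdPi (fun _ : ι ⊕ ι => ℝ)).symm with hE
  have hEapp : ∀ p : (ι → ℝ) × (ι → ℝ), E p = Sum.elim p.1 p.2 := by
    intro p; ext i; cases i <;> rfl
  have hlin : ∀ l : (ι ⊕ ι) →₀ ℝ, ∃ l1 l2 : ι →₀ ℝ, ∀ x y, lin l (Sum.elim x y)
      = lin l1 x + lin l2 y := by
    intro l
    induction l using Finsupp.induction_linear with
    | zero => exact ⟨0, 0, by simp [lin_zero_left]⟩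
    | add f g hf hg =>
      obtain ⟨f1, f2, hf⟩ := hf
      obtain ⟨g1, g2, hg⟩ := hg
      exact ⟨f1 + g1, f2 + g2, fun x y => by simp only [lin_add_left, hf, hg]; ring⟩
    | single i r =>
      cases i with
      | inl i => exact ⟨Finsupp.single i r, 0, by simp [lin_single, lin_zero_left]⟩
      | inr i => exact ⟨0, Finsupp.single i r, by simp [lin_single, lin_zero_left]⟩
  have hint : ∀ (k1 k2 : ι →₀ ℝ) (a : ℝ), ∫ p : (ι → ℝ) × (ι → ℝ),
      Real.cos (lin k1 p.1 + lin k2 p.2 + a) ∂(μ.prod μ)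
      = Real.exp (-(normSq k1 + normSq k2) / 2) * Real.cos a := by
    intro k1 k2 a
    have h1 := measurable_lin k1
    have h2 := measurable_lin k2
    rw [integral_prod _ (Integrable.of_bound (C := 1)
      (Measurable.aestronglyMeasurable (by fun_prop))
      (Filter.Eventually.of_forall fun x => Real.abs_cos_le_one _))]
    have h3 : ∀ x, ∫ y, Real.cos (lin k1 x + lin k2 y + a) ∂μ
        = Real.exp (-normSq k2 / 2) * wave k1 a x := by
      intro x
      rw [wave, ← hμ.integral_wave k2 (lin k1 x + a)]
      simp only [wave]
      congr 1 with y
      congr 1; ring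
    simp_rw [h3]
    rw [integral_const_mul, hμ.integral_wave, ← mul_assoc, ← Real.exp_add]
    congr 2; ring
  have hmain : ((μ.prod μ).map
      (fun p : (ι → ℝ) × (ι → ℝ) => (c • p.1 + s • p.2, s • p.1 - c • p.2))).map E
      = (μ.prod μ).map E := by
    have := Measure.isProbabilityMeasure_map (μ := μ.prod μ) hm.aemeasurable
    refine ext_of_integral_wave fun l a => ?_
    obtain ⟨l1, l2, hl⟩ := hlin l
    have hmE : Measurable fun p => wave l a (E p) := (measurable_wave l a).comp E.measurable
    rw [integral_map_equiv, integral_map_equiv, integral_map hm.aemeasurable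
      hmE.aestronglyMeasurable]
    simp only [wave, hEapp, hl]
    rw [hint, ← normSq_rotate h, ← hint]
    congr 1 with p
    simp only [sub_eq_add_neg, lin_add_left, lin_neg_left, lin_smul_left, lin_add_right,
      lin_smul_right]
    rw [show -(c • p.2) = (-c) • p.2 by simp, lin_smul_right]
    congr 1; ring
  simpa [Measure.map_map E.symm.measurable E.measurable] using
    congrArg (fun q => Measure.map E.symm q) hmain

/-- Replacing one coordinate by an independent standard Gaussian does not change the law. -/
theorem map_update [DecidableEq ι] (hμ : StdGaussian μ) (e : ι) :
    MeasurePreserving (fun p : (ι → ℝ) × ℝ => Function.update p.1 e p.2)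
      (μ.prod (gaussianReal 0 1)) μ := by
  have := hμ.isProbabilityMeasure
  have hm : Measurable (fun p : (ι → ℝ) × ℝ => Function.update p.1 e p.2) := by
    refine measurable_pi_lambda _ fun i => ?_
    by_cases hi : i = e
    · subst hi; simpa using measurable_snd
    · simp only [Function.update_of_ne hi]; fun_prop
  refine ⟨hm, ?_⟩
  have := Measure.isProbabilityMeasure_map (μ := μ.prod (gaussianReal 0 1)) hm.aemeasurable
  refine ext_of_integral_wave fun l a => ?_
  have hl : ∀ x s, lin l (Function.update x e s) = lin (l.erase e) x + l e * s := by
    intro x s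
    have h0 : (l.erase e).support ⊆ l.support := by
      rw [Finsupp.support_erase]; exact Finset.erase_subset _ _
    rw [← Finsupp.erase_add_single e l, lin_add_left, lin_single, Function.update_self]
    simp only [Finsupp.erase_add_single]
    congr 1
    refine Finsupp.sum_congr fun i hi => ?_
    rw [Function.update_of_ne]
    rintro rfl
    simp at hi
  have hn : normSq l = normSq (l.erase e) + l e ^ 2 := by
    have h1 := hl l (l e)
    rw [Function.update_eq_self] at h1
    have h2 : lin (l.erase e) l = normSq (l.erase e) := by
      refine Finsupp.sum_congr fun i hi => ?_
      rw [Finsupp.erase_ne]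
      rintro rfl
      simp at hi
    rw [normSq, h1, h2, pow_two]
  have hmw : Measurable fun p : (ι → ℝ) × ℝ => wave l a (Function.update p.1 e p.2) :=
    (measurable_wave l a).comp hm
  rw [integral_map hm.aemeasurable (measurable_wave l a).aestronglyMeasurable,
    integral_prod _ (Integrable.of_bound (C := 1) hmw.aestronglyMeasurable
      (Filter.Eventually.of_forall fun x => abs_wave_le _ _ _)), hμ.integral_wave]
  have h3 : ∀ x, ∫ s, wave l a (Function.update x e s) ∂gaussianReal 0 1
      = Real.exp (-(l e ^ 2) / 2) * wave (l.erase e) a x := by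
    intro x
    have h4 := integral_cos_gaussianReal 1 (l e) (lin (l.erase e) x + a)
    rw [NNReal.coe_one, one_mul] at h4
    rw [wave, ← h4]
    congr 1 with s
    rw [wave, hl]
    congr 1; ring
  simp_rw [h3]
  rw [integral_const_mul, hμ.integral_wave, ← mul_assoc, ← Real.exp_add, hn]
  congr 2; ring

end StdGaussian

/-! ### One-dimensional Gaussian integration by parts -/

theorem hasDerivAt_gaussianPDFReal (x : ℝ) :
    HasDerivAt (gaussianPDFReal 0 1) (-(x * gaussianPDFReal 0 1 x)) x := by
  have hf : gaussianPDFReal 0 1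
      = fun x : ℝ => (√(2 * Real.pi * 1))⁻¹ * Real.exp (-(x - 0) ^ 2 / (2 * 1)) := by
    ext x; simp [gaussianPDFReal]
  have h1 : HasDerivAt (fun x : ℝ => (x - 0) ^ 2) (2 * x) x := by
    simpa using ((hasDerivAt_id' x).sub_const 0).fun_pow 2
  rw [hf]
  refine ((((h1.fun_neg.div_const _).exp).const_mul _).congr_deriv ?_)
  ring

theorem integrable_gaussianReal_iff {f : ℝ → ℝ} :
    Integrable f (gaussianReal 0 1) ↔ Integrable fun x => gaussianPDFReal 0 1 x * f x := by
  rw [gaussianReal_of_var_ne_zero _ one_ne_zero,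
    integrable_withDensity_iff_integrable_smul' (measurable_gaussianPDF _ _)
      (Filter.Eventually.of_forall fun _ => gaussianPDF_lt_top)]
  simp

theorem integrable_abs_gaussianReal : Integrable (fun x : ℝ => |x|) (gaussianReal 0 1) :=
  ((memLp_id_gaussianReal (μ := 0) (v := 1) 1).integrable le_rfl).abs

theorem abs_le_of_hasDerivAt {u u' : ℝ → ℝ} {M : ℝ} (hu : ∀ x, HasDerivAt u (u' x) x)
    (hb : ∀ x, |u' x| ≤ M) (x : ℝ) : |u x| ≤ |u 0| + M * |x| := by
  have h := Convex.norm_image_sub_le_of_norm_hasDerivWithin_le (s := Set.univ)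
    (fun y _ => (hu y).hasDerivWithinAt) (fun y _ => hb y) convex_univ (Set.mem_univ 0)
    (Set.mem_univ x)
  simp only [Real.norm_eq_abs, sub_zero] at h
  calc |u x| = |u 0 + (u x - u 0)| := by ring_nf
    _ ≤ |u 0| + |u x - u 0| := abs_add_le _ _
    _ ≤ _ := by gcongr

theorem integrable_of_hasDerivAt {u u' : ℝ → ℝ} {M : ℝ} (hu : ∀ x, HasDerivAt u (u' x) x)
    (hb : ∀ x, |u' x| ≤ M) : Integrable u (gaussianReal 0 1) := by
  have hc : Continuous u := continuous_iff_continuousAt.2 fun x => (hu x).continuousAt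
  refine Integrable.mono' ((integrable_const |u 0|).add
    (integrable_abs_gaussianReal.const_mul M)) hc.aestronglyMeasurable
    (Filter.Eventually.of_forall fun x => abs_le_of_hasDerivAt hu hb x)

/-- Gaussian integration by parts for a function with bounded derivative. -/
theorem integral_mul_gaussianReal {u u' : ℝ → ℝ} {M : ℝ} (hu : ∀ x, HasDerivAt u (u' x) x)
    (hb : ∀ x, |u' x| ≤ M) :
    ∫ x, x * u x ∂gaussianReal 0 1 = ∫ x, u' x ∂gaussianReal 0 1 := by
  have hc : Continuous u := continuous_iff_continuousAt.2 fun x => (hu x).continuousAt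
  have hm : Measurable u' := by
    have : u' = deriv u := funext fun x => (hu x).deriv.symm
    rw [this]; exact measurable_deriv u
  have h2 : Integrable (fun x : ℝ => x ^ 2) (gaussianReal 0 1) :=
    (memLp_id_gaussianReal (μ := 0) (v := 1) 2).integrable_sq
  have i1 : Integrable (fun x => x * u x) (gaussianReal 0 1) := by
    refine Integrable.mono' ((integrable_abs_gaussianReal.const_mul |u 0|).add
      (h2.const_mul M)) (by fun_prop) (Filter.Eventually.of_forall fun x => ?_)
    have := abs_le_of_hasDerivAt hu hb x
    simp only [Real.norm_eq_abs, abs_mul, Pi.add_apply]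
    calc |x| * |u x| ≤ |x| * (|u 0| + M * |x|) := by gcongr
      _ = |u 0| * |x| + M * (|x| * |x|) := by ring
      _ = _ := by rw [abs_mul_abs_self, pow_two]
  have i2 : Integrable u' (gaussianReal 0 1) :=
    Integrable.of_bound hm.aestronglyMeasurable M (Filter.Eventually.of_forall hb)
  have i3 := integrable_of_hasDerivAt hu hb
  rw [integrable_gaussianReal_iff] at i1 i2 i3
  rw [integral_gaussianReal_eq_integral_smul one_ne_zero,
    integral_gaussianReal_eq_integral_smul one_ne_zero]
  have key := integral_mul_deriv_eq_deriv_mul_of_integrable (u := u) (u' := u')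
    (v := gaussianPDFReal 0 1) (v' := fun x => -(x * gaussianPDFReal 0 1 x))
    (fun x _ => hu x) (fun x _ => hasDerivAt_gaussianPDFReal x)
    (i1.neg.congr (Filter.Eventually.of_forall fun x => by simp; ring))
    (i2.congr (Filter.Eventually.of_forall fun x => by simp; ring))
    (i3.congr (Filter.Eventually.of_forall fun x => by simp; ring))
  rw [← neg_inj]
  calc -∫ x, gaussianPDFReal 0 1 x • (x * u x)
      = ∫ x, u x * -(x * gaussianPDFReal 0 1 x) := by
        rw [← integral_neg]; congr 1 with x; simp; ring
    _ = -∫ x, u' x * gaussianPDFReal 0 1 x := key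
    _ = _ := by congr 2 with x; simp [mul_comm]

theorem integral_abs_gaussianReal : ∫ x, |x| ∂gaussianReal 0 1 = √(2 / Real.pi) := by
  rw [integral_gaussianReal_eq_integral_smul one_ne_zero]
  have h1 : ∀ x : ℝ, gaussianPDFReal 0 1 x • |x| = (fun y => gaussianPDFReal 0 1 y * y) |x| := by
    intro x
    simp [gaussianPDFReal]
  simp_rw [h1]
  rw [integral_comp_abs (f := fun y => gaussianPDFReal 0 1 y * y)]
  have i1 : Integrable fun x : ℝ => gaussianPDFReal 0 1 x * x :=
    integrable_gaussianReal_iff.1 ((memLp_id_gaussianReal (μ := 0) (v := 1) 1).integrable le_rfl)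
  have h2 : ∫ x in Set.Ioi (0 : ℝ), gaussianPDFReal 0 1 x * x
      = 0 - -gaussianPDFReal 0 1 0 := by
    refine integral_Ioi_of_hasDerivAt_of_tendsto' (f := fun x => -gaussianPDFReal 0 1 x)
      (fun x _ => ?_) i1.integrableOn ?_
    · exact (hasDerivAt_gaussianPDFReal x).fun_neg.congr_deriv (by ring)
    · rw [show (0 : ℝ) = -0 by simp]
      refine Filter.Tendsto.neg ?_
      rw [neg_zero]
      refine tendsto_zero_of_hasDerivAt_of_integrableOn_Ioi (a := 0)
        (fun x _ => hasDerivAt_gaussianPDFReal x) ?_ (integrable_gaussianPDFReal 0 1).integrableOn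
      exact (i1.neg.congr (Filter.Eventually.of_forall fun x => by simp; ring)).integrableOn
  rw [h2]
  simp only [gaussianPDFReal, NNReal.coe_one]
  simp only [sub_zero, mul_one, ne_eq, OfNat.ofNat_ne_zero, not_false_eq_true, zero_pow, neg_zero,
    zero_div, Real.exp_zero, zero_sub, neg_neg]
  rw [eq_comm, Real.sqrt_eq_iff_mul_self_eq (by positivity) (by positivity)]
  have h3 := Real.mul_self_sqrt (show 0 ≤ 2 * Real.pi by positivity)
  have h4 : √(2 * Real.pi) ≠ 0 := by positivity
  field_simp
  nlinarith [Real.pi_pos]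

/-! ### Stein's equation -/

/-- Stein's equation `f' x - x f x = h x - E[h(Y)]` has a solution whose derivative is bounded by
`E|Y| = √(2/π)`. The solution is `f x = -∫₀^{π/2} E[h(x cos θ + Y sin θ) Y] dθ`. -/
theorem exists_stein_solution {h h' : ℝ → ℝ} (hh : ∀ x, HasDerivAt h (h' x) x)
    (hc : Continuous h') (hb : ∀ x, |h' x| ≤ 1) :
    ∃ f f' : ℝ → ℝ, (∀ x, HasDerivAt f (f' x) x) ∧ Continuous f' ∧ (∀ x, |f' x| ≤ √(2 / Real.pi)) ∧
      ∀ x, f' x - x * f x = h x - ∫ y, h y ∂gaussianReal 0 1 := by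
  set γ := gaussianReal 0 1 with hγ
  set τ : Measure ℝ := volume.restrict (Set.Ioc 0 (Real.pi / 2)) with hτ
  have hch : Continuous h := continuous_iff_continuousAt.2 fun x => (hh x).continuousAt
  have hpi : (0 : ℝ) ≤ Real.pi / 2 := by positivity
  have iy : Integrable (fun p : ℝ × ℝ => |p.2|) (τ.prod γ) :=
    integrable_abs_gaussianReal.comp_snd τ
  have hsq : Integrable (fun p : ℝ × ℝ => p.2 ^ 2) (τ.prod γ) :=
    ((memLp_id_gaussianReal (μ := 0) (v := 1) 2).integrable_sq).comp_snd τ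
  have habs : ∀ x (p : ℝ × ℝ), |h (Real.cos p.1 * x + Real.sin p.1 * p.2)|
      ≤ |h 0| + |x| + |p.2| := by
    intro x p
    have h1 := abs_le_of_hasDerivAt hh hb (Real.cos p.1 * x + Real.sin p.1 * p.2)
    have h2 : |Real.cos p.1 * x + Real.sin p.1 * p.2| ≤ 1 * |x| + 1 * |p.2| := by
      refine (abs_add_le _ _).trans ?_
      rw [abs_mul, abs_mul]
      gcongr
      · exact Real.abs_cos_le_one _
      · exact Real.abs_sin_le_one _
    linarith
  have i1 : ∀ x, Integrable (fun p : ℝ × ℝ => h (Real.cos p.1 * x + Real.sin p.1 * p.2) * p.2)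
      (τ.prod γ) := by
    intro x
    refine Integrable.mono' ((iy.const_mul (|h 0| + |x|)).add hsq) (by fun_prop)
      (Filter.Eventually.of_forall fun p => ?_)
    simp only [Real.norm_eq_abs, abs_mul, Pi.add_apply]
    calc _ ≤ (|h 0| + |x| + |p.2|) * |p.2| := by gcongr; exact habs x p
      _ = (|h 0| + |x|) * |p.2| + |p.2| * |p.2| := by ring
      _ = _ := by rw [abs_mul_abs_self, pow_two]
  have hbd : ∀ x (p : ℝ × ℝ), |h' (Real.cos p.1 * x + Real.sin p.1 * p.2)
      * (Real.cos p.1 * p.2)| ≤ |Real.cos p.1| * |p.2| := by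
    intro x p
    rw [abs_mul, abs_mul]
    exact mul_le_of_le_one_left (by positivity) (hb _)
  have i2 : ∀ x, Integrable (fun p : ℝ × ℝ => h' (Real.cos p.1 * x + Real.sin p.1 * p.2)
      * (Real.cos p.1 * p.2)) (τ.prod γ) := by
    intro x
    refine Integrable.mono' iy (by fun_prop) (Filter.Eventually.of_forall fun p => ?_)
    exact (hbd x p).trans (mul_le_of_le_one_left (abs_nonneg _) (Real.abs_cos_le_one _))
  set f : ℝ → ℝ := fun x =>
    -∫ p, h (Real.cos p.1 * x + Real.sin p.1 * p.2) * p.2 ∂(τ.prod γ) with hf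
  set f' : ℝ → ℝ := fun x => -∫ p, h' (Real.cos p.1 * x + Real.sin p.1 * p.2)
      * (Real.cos p.1 * p.2) ∂(τ.prod γ) with hf'
  have hder : ∀ x, HasDerivAt f (f' x) x := by
    intro x
    refine HasDerivAt.neg ?_
    refine (hasDerivAt_integral_of_dominated_loc_of_deriv_le (bound := fun p => |p.2|)
      (F' := fun x p => h' (Real.cos p.1 * x + Real.sin p.1 * p.2) * (Real.cos p.1 * p.2))
      Filter.univ_mem (Filter.Eventually.of_forall fun y => (i1 y).1) (i1 x) (i2 x).1
      (Filter.Eventually.of_forall fun p y _ => ?_) iy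
      (Filter.Eventually.of_forall fun p y _ => ?_)).2
    · exact (hbd y p).trans (mul_le_of_le_one_left (abs_nonneg _) (Real.abs_cos_le_one _))
    · have h1 : HasDerivAt (fun y => Real.cos p.1 * y + Real.sin p.1 * p.2) (Real.cos p.1) y := by
        simpa using ((hasDerivAt_id y).const_mul (Real.cos p.1)).add_const (Real.sin p.1 * p.2)
      exact (((hh _).comp y h1).mul_const p.2).congr_deriv (by ring)
  have hode : ∀ x, f' x - x * f x = h x - ∫ y, h y ∂γ := by
    intro x
    -- For fixed `θ`, both terms combine to the `θ`-derivative of `E[h(x cos θ + Y sin θ)]`.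
    have i3 : Integrable (fun p : ℝ × ℝ => h' (Real.cos p.1 * x + Real.sin p.1 * p.2)
        * (-Real.sin p.1 * x + Real.cos p.1 * p.2)) (τ.prod γ) := by
      refine Integrable.mono' ((integrable_const |x|).add iy) (by fun_prop)
        (Filter.Eventually.of_forall fun p => ?_)
      rw [Real.norm_eq_abs, abs_mul]
      refine (mul_le_of_le_one_left (abs_nonneg _) (hb _)).trans ((abs_add_le _ _).trans ?_)
      rw [abs_mul, abs_mul, abs_neg]
      exact add_le_add (mul_le_of_le_one_left (abs_nonneg _) (Real.abs_sin_le_one _))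
        (mul_le_of_le_one_left (abs_nonneg _) (Real.abs_cos_le_one _))
    have hi : ∀ θ : ℝ, Integrable (fun y => h (Real.cos θ * x + Real.sin θ * y)) γ := by
      intro θ
      refine Integrable.mono' ((integrable_const (|h 0| + |x|)).add integrable_abs_gaussianReal)
        (by fun_prop) (Filter.Eventually.of_forall fun y => habs x (θ, y))
    have hd : ∀ θ : ℝ, HasDerivAt (fun θ => ∫ y, h (Real.cos θ * x + Real.sin θ * y) ∂γ)
        (∫ y, h' (Real.cos θ * x + Real.sin θ * y) * (-Real.sin θ * x + Real.cos θ * y) ∂γ) θ := by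
      intro θ
      refine (hasDerivAt_integral_of_dominated_loc_of_deriv_le (bound := fun y => |x| + |y|)
        (F' := fun θ y => h' (Real.cos θ * x + Real.sin θ * y)
          * (-Real.sin θ * x + Real.cos θ * y))
        Filter.univ_mem (Filter.Eventually.of_forall fun t => (hi t).1) (hi θ)
        (by fun_prop) (Filter.Eventually.of_forall fun y t _ => ?_)
        ((integrable_const |x|).add integrable_abs_gaussianReal)
        (Filter.Eventually.of_forall fun y t _ => ?_)).2
      · rw [Real.norm_eq_abs, abs_mul]
        refine (mul_le_of_le_one_left (abs_nonneg _) (hb _)).trans ((abs_add_le _ _).trans ?_)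
        rw [abs_mul, abs_mul, abs_neg]
        exact add_le_add (mul_le_of_le_one_left (abs_nonneg _) (Real.abs_sin_le_one _))
          (mul_le_of_le_one_left (abs_nonneg _) (Real.abs_cos_le_one _))
      · exact (hh _).comp t (((Real.hasDerivAt_cos t).mul_const x).add
          ((Real.hasDerivAt_sin t).mul_const y))
    have hib : ∀ θ : ℝ, ∫ y, h (Real.cos θ * x + Real.sin θ * y) * y ∂γ
        = ∫ y, h' (Real.cos θ * x + Real.sin θ * y) * Real.sin θ ∂γ := by
      intro θ
      rw [← integral_mul_gaussianReal (u := fun y => h (Real.cos θ * x + Real.sin θ * y))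
        (u' := fun y => h' (Real.cos θ * x + Real.sin θ * y) * Real.sin θ) (M := 1)]
      · congr 1 with y; ring
      · intro y
        have h1 : HasDerivAt (fun y => Real.cos θ * x + Real.sin θ * y) (Real.sin θ) y := by
          simpa using ((hasDerivAt_id y).const_mul (Real.sin θ)).const_add (Real.cos θ * x)
        exact (hh _).comp y h1
      · intro y
        rw [abs_mul]
        exact mul_le_one₀ (hb _) (abs_nonneg _) (Real.abs_sin_le_one _)
    have hftc := intervalIntegral.integral_eq_sub_of_hasDerivAt (a := 0) (b := Real.pi / 2)
      (fun θ _ => hd θ) (by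
        rw [intervalIntegrable_iff_integrableOn_Ioc_of_le hpi]
        exact i3.integral_prod_left)
    rw [intervalIntegral.integral_of_le hpi, ← integral_prod _ i3] at hftc
    simp only [Real.cos_pi_div_two, Real.sin_pi_div_two, zero_mul, one_mul, zero_add, Real.cos_zero,
      Real.sin_zero, add_zero, integral_const, probReal_univ, one_smul] at hftc
    have e1 : ∫ p, h (Real.cos p.1 * x + Real.sin p.1 * p.2) * p.2 ∂(τ.prod γ)
        = ∫ p, h' (Real.cos p.1 * x + Real.sin p.1 * p.2) * Real.sin p.1 ∂(τ.prod γ) := by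
      rw [integral_prod _ (i1 x), integral_prod _ (Integrable.of_bound (C := 1) (by fun_prop)
        (Filter.Eventually.of_forall fun p => by
          rw [Real.norm_eq_abs, abs_mul]
          exact mul_le_one₀ (hb _) (abs_nonneg _) (Real.abs_sin_le_one _)))]
      simp only [hib]
    have i4 : Integrable (fun p : ℝ × ℝ => h' (Real.cos p.1 * x + Real.sin p.1 * p.2)
        * Real.sin p.1) (τ.prod γ) :=
      Integrable.of_bound (C := 1) (by fun_prop) (Filter.Eventually.of_forall fun p => by
          rw [Real.norm_eq_abs, abs_mul]
          exact mul_le_one₀ (hb _) (abs_nonneg _) (Real.abs_sin_le_one _))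
    have e2 : f' x - x * f x = -∫ p, h' (Real.cos p.1 * x + Real.sin p.1 * p.2)
        * (-Real.sin p.1 * x + Real.cos p.1 * p.2) ∂(τ.prod γ) := by
      simp only [hf, hf', e1]
      rw [mul_neg, ← integral_const_mul, sub_neg_eq_add, neg_add_eq_sub,
        ← integral_sub (i4.const_mul x) (i2 x), ← integral_neg]
      congr 1 with p
      ring
    rw [e2, hftc, neg_sub]
  refine ⟨f, f', hder, ?_, fun x => ?_, hode⟩
  · have : f' = fun x => x * f x + (h x - ∫ y, h y ∂γ) := by
      ext x; rw [← hode x]; ring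
    rw [this]
    have hcf : Continuous f := continuous_iff_continuousAt.2 fun x => (hder x).continuousAt
    fun_prop
  · have i5 : Integrable (fun p : ℝ × ℝ => |Real.cos p.1| * |p.2|) (τ.prod γ) :=
      Integrable.mono' iy (by fun_prop) (Filter.Eventually.of_forall fun p => by
        rw [Real.norm_eq_abs, abs_mul, abs_abs, abs_abs]
        exact mul_le_of_le_one_left (abs_nonneg _) (Real.abs_cos_le_one _))
    calc |f' x| ≤ ∫ p, |Real.cos p.1| * |p.2| ∂(τ.prod γ) := by
          simp only [hf', abs_neg]
          rw [← Real.norm_eq_abs]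
          refine norm_integral_le_of_norm_le i5 (Filter.Eventually.of_forall fun p => ?_)
          exact hbd x p
      _ = (∫ θ, |Real.cos θ| ∂τ) * ∫ y, |y| ∂γ :=
          integral_prod_mul (fun θ => |Real.cos θ|) fun y => |y|
      _ = 1 * √(2 / Real.pi) := by
          rw [hγ, integral_abs_gaussianReal]
          congr 1
          rw [hτ, ← intervalIntegral.integral_of_le hpi]
          rw [intervalIntegral.integral_congr (g := Real.cos)]
          · rw [integral_cos]; simp
          · intro θ hθ
            rw [Set.uIcc_of_le hpi] at hθ
            exact abs_of_nonneg (Real.cos_nonneg_of_mem_Icc ⟨by linarith [hθ.1], hθ.2⟩)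
      _ = _ := one_mul _

/-- A `1`-Lipschitz function is a uniform limit of `C¹` functions with derivative at most `1`:
take its averages over short intervals. -/
theorem exists_smooth_approx {h : ℝ → ℝ} (hh : LipschitzWith 1 h) {ε : ℝ} (hε : 0 < ε) :
    ∃ g g' : ℝ → ℝ, (∀ x, HasDerivAt g (g' x) x) ∧ Continuous g' ∧ (∀ x, |g' x| ≤ 1) ∧
      ∀ x, |g x - h x| ≤ ε := by
  have hc := hh.continuous
  have hl : ∀ x y, |h x - h y| ≤ |x - y| := fun x y => by
    simpa [Real.dist_eq] using hh.dist_le_mul x y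
  have hH : ∀ x, HasDerivAt (fun x => ∫ t in (0 : ℝ)..x, h t) (h x) x := fun x =>
    intervalIntegral.integral_hasDerivAt_right (hc.intervalIntegrable _ _)
      (hc.stronglyMeasurableAtFilter _ _) hc.continuousAt
  refine ⟨fun x => ε⁻¹ * ((∫ t in (0 : ℝ)..(x + ε), h t) - ∫ t in (0 : ℝ)..x, h t),
    fun x => ε⁻¹ * (h (x + ε) - h x), fun x => ?_, by fun_prop, fun x => ?_, fun x => ?_⟩
  · exact ((HasDerivAt.comp_add_const x ε (hH (x + ε))).sub (hH x)).const_mul _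
  · rw [abs_mul, abs_of_pos (inv_pos.2 hε), inv_mul_le_iff₀ hε]
    simpa [abs_of_pos hε] using hl (x + ε) x
  · have e1 : (∫ t in (0 : ℝ)..(x + ε), h t) - ∫ t in (0 : ℝ)..x, h t
        = ∫ t in x..(x + ε), h t :=
      intervalIntegral.integral_interval_sub_left (hc.intervalIntegrable _ _)
        (hc.intervalIntegrable _ _)
    have e2 : ε⁻¹ * (∫ t in x..(x + ε), h t) - h x = ε⁻¹ * ∫ t in x..(x + ε), (h t - h x) := by
      rw [intervalIntegral.integral_sub (hc.intervalIntegrable _ _) (by simp)]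
      simp only [intervalIntegral.integral_const, smul_eq_mul, add_sub_cancel_left]
      field_simp
    simp only [e1]
    rw [e2, abs_mul, abs_of_pos (inv_pos.2 hε), inv_mul_le_iff₀ hε]
    have := intervalIntegral.norm_integral_le_of_norm_le_const (a := x) (b := x + ε) (C := ε)
      (f := fun t => h t - h x) (fun t ht => by
        rw [Set.uIoc_of_le (by linarith)] at ht
        refine (hl t x).trans ?_
        rw [abs_of_pos (by linarith [ht.1])]
        linarith [ht.2])
    simpa [abs_of_pos hε] using this

variable {μ : Measure (ι → ℝ)}

/-! ### The Cauchy–Schwarz inequality in `L²` -/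

section CauchySchwarz

variable {α : Type*} [MeasurableSpace α] {ν : Measure α} {f g : α → ℝ}

theorem integrable_mul_of_memLp_two (hf : MemLp f 2 ν) (hg : MemLp g 2 ν) :
    Integrable (fun x => f x * g x) ν :=
  hf.integrable_mul hg

theorem abs_integral_mul_le (hf : MemLp f 2 ν) (hg : MemLp g 2 ν) :
    |∫ x, f x * g x ∂ν| ≤ √(∫ x, f x ^ 2 ∂ν) * √(∫ x, g x ^ 2 ∂ν) := by
  have h := integral_mul_norm_le_Lp_mul_Lq (μ := ν) (f := f) (g := g)
    Real.HolderConjugate.two_two (by simpa using hf) (by simpa using hg)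
  simp only [Real.norm_eq_abs, Real.rpow_two, sq_abs, ← Real.sqrt_eq_rpow] at h
  refine le_trans ?_ h
  rw [← Real.norm_eq_abs]
  refine (norm_integral_le_integral_norm _).trans_eq ?_
  simp

end CauchySchwarz

/-! ### Weak derivatives tested against waves -/

/-- `U` is the weak derivative of `G ∈ L²(μ)` in direction `e`, tested against waves. On `ℝ^ι` the
waves replace compactly supported test functions: they are stable under products and under the
Mehler semigroup. -/
structure HasWeakDeriv (μ : Measure (ι → ℝ)) (e : ι) (G U : (ι → ℝ) → ℝ) : Prop where
  memLp : MemLp G 2 μ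
  memLp_deriv : MemLp U 2 μ
  integral_mul_wave : ∀ l a, ∫ x, U x * wave l a x ∂μ
    = ∫ x, G x * (x e * wave l a x + l e * swave l a x) ∂μ

/-- Trigonometric polynomials `p.1`, together with their partial derivatives `p.2`. -/
noncomputable def trig (ι : Type*) : Submodule ℝ (((ι → ℝ) → ℝ) × (ι → (ι → ℝ) → ℝ)) :=
  Submodule.span ℝ (Set.range fun k : (ι →₀ ℝ) × ℝ =>
    (wave k.1 k.2, fun e x => -(k.1 e * swave k.1 k.2 x)))

theorem wave_mem_trig (l : ι →₀ ℝ) (a : ℝ) :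
    (wave l a, fun e x => -(l e * swave l a x)) ∈ trig ι :=
  Submodule.subset_span ⟨(l, a), rfl⟩

theorem trig_induction {C : ((ι → ℝ) → ℝ) × (ι → (ι → ℝ) → ℝ) → Prop}
    (hw : ∀ l a, C (wave l a, fun e x => -(l e * swave l a x))) (h0 : C 0)
    (hadd : ∀ p q, p ∈ trig ι → q ∈ trig ι → C p → C q → C (p + q))
    (hsmul : ∀ (r : ℝ) p, p ∈ trig ι → C p → C (r • p)) {p} (hp : p ∈ trig ι) : C p := by
  induction hp using Submodule.span_induction with
  | mem x h => obtain ⟨k, rfl⟩ := h; exact hw k.1 k.2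
  | zero => exact h0
  | add x y hx hy h1 h2 => exact hadd x y hx hy h1 h2
  | smul r x hx h => exact hsmul r x hx h

theorem trig_measurable {p} (hp : p ∈ trig ι) :
    Measurable p.1 ∧ ∀ e, Measurable (p.2 e) := by
  refine trig_induction (C := fun p => Measurable p.1 ∧ ∀ e, Measurable (p.2 e)) ?_ ?_ ?_ ?_ hp
  · exact fun l a => ⟨measurable_wave l a, fun e => ((measurable_swave l a).const_mul _).neg⟩
  · exact ⟨measurable_const, fun e => measurable_const⟩
  · exact fun p q _ _ h1 h2 => ⟨h1.1.add h2.1, fun e => (h1.2 e).add (h2.2 e)⟩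
  · exact fun r p _ h => ⟨h.1.const_mul r, fun e => (h.2 e).const_mul r⟩

theorem trig_bounded {p} (hp : p ∈ trig ι) :
    (∃ M, ∀ x, |p.1 x| ≤ M) ∧ ∀ e, ∃ M, ∀ x, |p.2 e x| ≤ M := by
  refine trig_induction (C := fun p => (∃ M, ∀ x, |p.1 x| ≤ M) ∧ ∀ e, ∃ M, ∀ x, |p.2 e x| ≤ M)
    ?_ ?_ ?_ ?_ hp
  · refine fun l a => ⟨⟨1, abs_wave_le l a⟩, fun e => ⟨|l e| * 1, fun x => ?_⟩⟩
    rw [abs_neg, abs_mul]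
    gcongr
    exact abs_swave_le l a x
  · exact ⟨⟨0, by simp⟩, fun e => ⟨0, by simp⟩⟩
  · rintro p q _ _ ⟨⟨M, hM⟩, h1⟩ ⟨⟨N, hN⟩, h2⟩
    refine ⟨⟨M + N, fun x => (abs_add_le _ _).trans (add_le_add (hM x) (hN x))⟩, fun e => ?_⟩
    obtain ⟨M, hM⟩ := h1 e
    obtain ⟨N, hN⟩ := h2 e
    exact ⟨M + N, fun x => (abs_add_le _ _).trans (add_le_add (hM x) (hN x))⟩
  · rintro r p _ ⟨⟨M, hM⟩, h1⟩
    refine ⟨⟨|r| * M, fun x => (abs_mul _ _).trans_le (by gcongr; exact hM x)⟩, fun e => ?_⟩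
    obtain ⟨M, hM⟩ := h1 e
    exact ⟨|r| * M, fun x => (abs_mul _ _).trans_le (by gcongr; exact hM x)⟩

theorem trig_finite_support {p} (hp : p ∈ trig ι) : ∃ s : Finset ι, ∀ e ∉ s, p.2 e = 0 := by
  classical
  refine trig_induction (C := fun p => ∃ s : Finset ι, ∀ e ∉ s, p.2 e = 0) ?_ ?_ ?_ ?_ hp
  · refine fun l a => ⟨l.support, fun e he => ?_⟩
    ext x
    simp [Finsupp.notMem_support_iff.1 he]
  · exact ⟨∅, fun e _ => rfl⟩
  · rintro p q _ _ ⟨s, hs⟩ ⟨t, ht⟩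
    refine ⟨s ∪ t, fun e he => ?_⟩
    rw [Finset.mem_union, not_or] at he
    rw [Prod.snd_add, Pi.add_apply, hs e he.1, ht e he.2, add_zero]
  · rintro r p _ ⟨s, hs⟩
    exact ⟨s, fun e he => by rw [Prod.smul_snd, Pi.smul_apply, hs e he, smul_zero]⟩

theorem lin_update [DecidableEq ι] (l : ι →₀ ℝ) (x : ι → ℝ) (e : ι) (s : ℝ) :
    lin l (Function.update x e s) = lin l x + l e * (s - x e) := by
  have h : Function.update x e s = x + (s - x e) • Pi.single e 1 := by
    ext i
    by_cases hi : i = e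
    · subst hi; simp
    · simp [hi]
  have h2 : lin l (Pi.single e 1) = l e := by
    have h3 := lin_comm (Finsupp.single e (1 : ℝ)) l
    rw [lin_single, one_mul, Finsupp.single_eq_pi_single] at h3
    exact h3.symm
  rw [h, lin_add_right, lin_smul_right, h2, mul_comm]

theorem hasDerivAt_wave [DecidableEq ι] (l : ι →₀ ℝ) (a : ℝ) (e : ι) (x : ι → ℝ) (s : ℝ) :
    HasDerivAt (fun s => wave l a (Function.update x e s))
      (-(l e * swave l a (Function.update x e s))) s := by
  simp only [wave, swave, lin_update]
  have h1 : HasDerivAt (fun s => lin l x + l e * (s - x e) + a) (l e) s := by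
    simpa using ((((hasDerivAt_id' s).sub_const (x e)).const_mul (l e)).const_add
      (lin l x)).add_const a
  exact ((Real.hasDerivAt_cos _).comp s h1).congr_deriv (by ring)

theorem trig_hasDerivAt [DecidableEq ι] {p} (hp : p ∈ trig ι) (e : ι) (x : ι → ℝ) (s : ℝ) :
    HasDerivAt (fun s => p.1 (Function.update x e s)) (p.2 e (Function.update x e s)) s := by
  refine trig_induction (C := fun p => HasDerivAt (fun s => p.1 (Function.update x e s))
    (p.2 e (Function.update x e s)) s) ?_ ?_ ?_ ?_ hp
  · exact fun l a => hasDerivAt_wave l a e x s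
  · exact hasDerivAt_const s 0
  · exact fun p q _ _ h1 h2 => h1.add h2
  · exact fun r p _ h => h.const_mul r

namespace StdGaussian

/-- Gaussian integration by parts for a bounded function with bounded derivative along the
`e`-axis. -/
theorem integral_eval_mul [DecidableEq ι] (hμ : StdGaussian μ) (e : ι) {w w' : (ι → ℝ) → ℝ}
    {M N : ℝ} (hw : Measurable w) (hw' : Measurable w') (hM : ∀ x, |w x| ≤ M)
    (hN : ∀ x, |w' x| ≤ N)
    (hd : ∀ x s, HasDerivAt (fun s => w (Function.update x e s)) (w' (Function.update x e s)) s) :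
    ∫ x, x e * w x ∂μ = ∫ x, w' x ∂μ := by
  have := hμ.isProbabilityMeasure
  have hup := hμ.map_update e
  have i1 : Integrable (fun x => x e * w x) μ :=
    ((hμ.memLp_eval e (p := 1) (by simp)).integrable le_rfl).mul_bdd (c := M)
      hw.aestronglyMeasurable (Filter.Eventually.of_forall hM)
  have i2 : Integrable w' μ :=
    Integrable.of_bound hw'.aestronglyMeasurable N (Filter.Eventually.of_forall hN)
  have j1 := hup.integrable_comp_of_integrable i1
  have j2 := hup.integrable_comp_of_integrable i2
  rw [← hup.map_eq, integral_map hup.aemeasurable (by rw [hup.map_eq]; exact i1.1),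
    integral_map hup.aemeasurable (by rw [hup.map_eq]; exact i2.1)]
  refine (integral_prod _ j1).trans (Eq.trans ?_ (integral_prod _ j2).symm)
  congr 1 with x
  simp only [Function.comp_apply, Function.update_self]
  exact integral_mul_gaussianReal (hd x) fun s => hN _

theorem integrable_wave (hμ : StdGaussian μ) (l : ι →₀ ℝ) (a : ℝ) : Integrable (wave l a) μ :=
  have := hμ.isProbabilityMeasure
  Integrable.of_bound (measurable_wave l a).aestronglyMeasurable 1
    (Filter.Eventually.of_forall (abs_wave_le l a))

theorem integral_eval_mul_wave (hμ : StdGaussian μ) (e : ι) (l : ι →₀ ℝ) (a : ℝ) :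
    ∫ x, x e * wave l a x ∂μ = -(l e * ∫ x, swave l a x ∂μ) := by
  classical
  rw [hμ.integral_eval_mul e (measurable_wave l a)
    ((measurable_swave l a).const_mul (l e)).neg (abs_wave_le l a) (N := |l e| * 1) (fun x => ?_)
    (hasDerivAt_wave l a e), ← integral_const_mul, ← integral_neg]
  · rfl
  · rw [Pi.neg_apply, abs_neg, abs_mul]
    gcongr
    exact abs_swave_le l a x

theorem integral_swave (hμ : StdGaussian μ) (l : ι →₀ ℝ) (a : ℝ) :
    ∫ x, swave l a x ∂μ = Real.exp (-normSq l / 2) * Real.sin a := by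
  have h := hμ.integral_wave l (a - Real.pi / 2)
  rw [Real.cos_sub_pi_div_two] at h
  rw [← h]
  congr 1 with x
  rw [← swave_add_pi_div_two, sub_add_cancel]

/-- The test functions occurring in the definition of a weak derivative are square integrable. -/
theorem memLp_test (hμ : StdGaussian μ) (e : ι) (l : ι →₀ ℝ) (a : ℝ) {p : ℝ≥0∞} (hp : p ≠ ∞) :
    MemLp (fun x => x e * wave l a x + l e * swave l a x) p μ := by
  have := hμ.isProbabilityMeasure
  refine MemLp.add ?_ ?_
  · refine (hμ.memLp_eval e hp).of_le
      (((measurable_pi_apply e).mul (measurable_wave l a)).aestronglyMeasurable)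
      (Filter.Eventually.of_forall fun x => ?_)
    rw [norm_mul]
    exact mul_le_of_le_one_right (norm_nonneg _) (abs_wave_le l a x)
  · refine MemLp.const_mul ?_ _
    exact MemLp.of_bound (measurable_swave l a).aestronglyMeasurable 1
      (Filter.Eventually.of_forall (abs_swave_le l a))

theorem memLp_wave (hμ : StdGaussian μ) (l : ι →₀ ℝ) (a : ℝ) (p : ℝ≥0∞) :
    MemLp (wave l a) p μ :=
  have := hμ.isProbabilityMeasure
  MemLp.of_bound (measurable_wave l a).aestronglyMeasurable 1
    (Filter.Eventually.of_forall (abs_wave_le l a))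

theorem memLp_trig (hμ : StdGaussian μ) {p} (hp : p ∈ trig ι) (q : ℝ≥0∞) : MemLp p.1 q μ := by
  have := hμ.isProbabilityMeasure
  obtain ⟨M, hM⟩ := (trig_bounded hp).1
  exact MemLp.of_bound (trig_measurable hp).1.aestronglyMeasurable M
    (Filter.Eventually.of_forall hM)

theorem memLp_trig_deriv (hμ : StdGaussian μ) {p} (hp : p ∈ trig ι) (e : ι) (q : ℝ≥0∞) :
    MemLp (p.2 e) q μ := by
  have := hμ.isProbabilityMeasure
  obtain ⟨M, hM⟩ := (trig_bounded hp).2 e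
  exact MemLp.of_bound ((trig_measurable hp).2 e).aestronglyMeasurable M
    (Filter.Eventually.of_forall hM)

/-- The chain rule for a smooth function of a trigonometric polynomial. -/
theorem hasWeakDeriv_comp_trig (hμ : StdGaussian μ) {p} (hp : p ∈ trig ι) (e : ι) {f f' : ℝ → ℝ}
    {M : ℝ} (hf : ∀ x, HasDerivAt f (f' x) x) (hf' : Continuous f') (hM : ∀ x, |f' x| ≤ M) :
    HasWeakDeriv μ e (fun x => f (p.1 x)) (fun x => f' (p.1 x) * p.2 e x) := by
  classical
  have := hμ.isProbabilityMeasure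
  have hM0 : 0 ≤ M := (abs_nonneg _).trans (hM 0)
  have hc : Continuous f := continuous_iff_continuousAt.2 fun x => (hf x).continuousAt
  obtain ⟨⟨A, hA⟩, hB⟩ := trig_bounded hp
  obtain ⟨B, hB⟩ := hB e
  obtain ⟨mp, mp'⟩ := trig_measurable hp
  have mf : Measurable fun x => f (p.1 x) := hc.measurable.comp mp
  have mf' : Measurable fun x => f' (p.1 x) * p.2 e x := (hf'.measurable.comp mp).mul (mp' e)
  have bf : ∀ x, |f (p.1 x)| ≤ |f 0| + M * A := fun x =>
    (abs_le_of_hasDerivAt hf hM _).trans (by gcongr; exact hA x)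
  have bf' : ∀ x, |f' (p.1 x) * p.2 e x| ≤ M * B := fun x => by
    rw [abs_mul]; exact mul_le_mul (hM _) (hB x) (abs_nonneg _) hM0
  have l1 : MemLp (fun x => f (p.1 x)) 2 μ :=
    MemLp.of_bound mf.aestronglyMeasurable _ (Filter.Eventually.of_forall bf)
  have l2 : MemLp (fun x => f' (p.1 x) * p.2 e x) 2 μ :=
    MemLp.of_bound mf'.aestronglyMeasurable _ (Filter.Eventually.of_forall bf')
  refine ⟨l1, l2, fun l a => ?_⟩
  have h := hμ.integral_eval_mul e (w := fun x => f (p.1 x) * wave l a x)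
    (w' := fun x => f' (p.1 x) * p.2 e x * wave l a x + f (p.1 x) * -(l e * swave l a x))
    (M := (|f 0| + M * A) * 1) (N := M * B * 1 + (|f 0| + M * A) * (|l e| * 1))
    (mf.mul (measurable_wave l a)) ((mf'.mul (measurable_wave l a)).add
      (mf.mul ((measurable_swave l a).const_mul _).neg)) (fun x => ?_) (fun x => ?_) fun x s => ?_
  · have m1 : MemLp (fun x => x e * wave l a x) 2 μ := by
      refine (hμ.memLp_eval e (p := 2) (by simp)).of_le
        (((measurable_pi_apply e).mul (measurable_wave l a)).aestronglyMeasurable)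
        (Filter.Eventually.of_forall fun x => ?_)
      rw [norm_mul]
      exact mul_le_of_le_one_right (norm_nonneg _) (abs_wave_le l a x)
    have m2 : MemLp (fun x => l e * swave l a x) 2 μ := MemLp.const_mul
      (MemLp.of_bound (measurable_swave l a).aestronglyMeasurable 1
        (Filter.Eventually.of_forall (abs_swave_le l a))) _
    rw [integral_add (integrable_mul_of_memLp_two l2 (hμ.memLp_wave l a 2))
      (integrable_mul_of_memLp_two (g := fun x => -(l e * swave l a x)) l1 m2.neg)] at h
    have e1 : ∫ x, f (p.1 x) * -(l e * swave l a x) ∂μ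
        = -∫ x, f (p.1 x) * (l e * swave l a x) ∂μ := by
      rw [← integral_neg]; congr 1 with x; ring
    have e2 : ∫ x, f (p.1 x) * (x e * wave l a x + l e * swave l a x) ∂μ
        = ∫ x, x e * (f (p.1 x) * wave l a x) ∂μ + ∫ x, f (p.1 x) * (l e * swave l a x) ∂μ := by
      rw [← integral_add ((l1.integrable_mul m1).congr (Filter.Eventually.of_forall fun x => by
        simp only [Pi.mul_apply]; ring)) (integrable_mul_of_memLp_two l1 m2)]
      congr 1 with x; ring
    rw [e2, h, e1]; ring
  · rw [abs_mul]
    exact mul_le_mul (bf x) (abs_wave_le l a x) (abs_nonneg _) (by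
      have := (abs_nonneg _).trans (hA x); positivity)
  · refine (abs_add_le _ _).trans (add_le_add ?_ ?_)
    · rw [abs_mul]
      exact mul_le_mul (bf' x) (abs_wave_le l a x) (abs_nonneg _) ((abs_nonneg _).trans (bf' x))
    · rw [abs_mul, abs_neg, abs_mul]
      exact mul_le_mul (bf x) (by gcongr; exact abs_swave_le l a x) (by positivity)
        ((abs_nonneg _).trans (bf x))
  · exact ((hf _).comp s (trig_hasDerivAt hp e x s)).mul (hasDerivAt_wave l a e x s)

theorem hasWeakDeriv_trig (hμ : StdGaussian μ) {p} (hp : p ∈ trig ι) (e : ι) :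
    HasWeakDeriv μ e p.1 (p.2 e) := by
  simpa using hμ.hasWeakDeriv_comp_trig hp e (f := fun x => x) (f' := fun _ => 1) (M := 1)
    (fun x => hasDerivAt_id' x) continuous_const (by simp)

end StdGaussian

/-! ### The Mehler semigroup -/

/-- Mehler's formula for the Ornstein–Uhlenbeck semigroup at time `t`, where `c = exp (-t)`. Only
`c ∈ [0, 1]` is meaningful. -/
noncomputable def mehler (μ : Measure (ι → ℝ)) (c : ℝ) (U : (ι → ℝ) → ℝ) (x : ι → ℝ) : ℝ :=
  ∫ y, U (c • x + √(1 - c ^ 2) • y) ∂μ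

/-- The bilinear form `⟨W, mehler c U⟩`, written as an integral over two independent copies. -/
noncomputable def corr (μ : Measure (ι → ℝ)) (c : ℝ) (W U : (ι → ℝ) → ℝ) : ℝ :=
  ∫ p, W p.1 * U (c • p.1 + √(1 - c ^ 2) • p.2) ∂μ.prod μ

namespace StdGaussian

theorem sq_add_sqrt_sq {c : ℝ} (hc : c ∈ Set.Icc (0 : ℝ) 1) : c ^ 2 + √(1 - c ^ 2) ^ 2 = 1 := by
  rw [Real.sq_sqrt (by nlinarith [hc.1, hc.2])]; ring

theorem measurePreserving_mix (hμ : StdGaussian μ) {c : ℝ} (hc : c ∈ Set.Icc (0 : ℝ) 1) :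
    MeasurePreserving (fun p : (ι → ℝ) × (ι → ℝ) => c • p.1 + √(1 - c ^ 2) • p.2)
      (μ.prod μ) μ := by
  have := hμ.isProbabilityMeasure
  exact measurePreserving_fst.comp (hμ.measurePreserving_rotate (sq_add_sqrt_sq hc))

theorem memLp_mix (hμ : StdGaussian μ) {c : ℝ} (hc : c ∈ Set.Icc (0 : ℝ) 1) {q : ℝ≥0∞}
    {U : (ι → ℝ) → ℝ} (hU : MemLp U q μ) :
    MemLp (fun p : (ι → ℝ) × (ι → ℝ) => U (c • p.1 + √(1 - c ^ 2) • p.2)) q (μ.prod μ) :=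
  hU.comp_measurePreserving (hμ.measurePreserving_mix hc)

/-- The Mehler semigroup contracts every `Lᵖ` norm. -/
theorem eLpNorm_mehler_le (hμ : StdGaussian μ) {c : ℝ} (hc : c ∈ Set.Icc (0 : ℝ) 1) {q : ℝ≥0∞}
    (hq1 : 1 ≤ q) (hq : q ≠ ∞) {U : (ι → ℝ) → ℝ} (hU : AEStronglyMeasurable U μ) :
    eLpNorm (mehler μ c U) q μ ≤ eLpNorm U q μ := by
  have := hμ.isProbabilityMeasure
  have hq0 : q ≠ 0 := (zero_lt_one.trans_le hq1).ne'
  have hqr : 0 < q.toReal := ENNReal.toReal_pos hq0 hq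
  have hP := hμ.measurePreserving_mix hc
  have hm := hU.comp_measurePreserving hP
  rw [← eLpNorm_comp_measurePreserving hU hP, eLpNorm_eq_lintegral_rpow_enorm_toReal hq0 hq,
    eLpNorm_eq_lintegral_rpow_enorm_toReal hq0 hq]
  refine ENNReal.rpow_le_rpow ?_ (by positivity)
  rw [lintegral_prod _ (hm.enorm.pow_const _)]
  refine lintegral_mono_ae ?_
  filter_upwards [hm.prodMk_left] with x hx
  -- Jensen's inequality for the probability measure `μ` in the second variable
  have h1 := eLpNorm_le_eLpNorm_of_exponent_le hq1 hx
  rw [eLpNorm_one_eq_lintegral_enorm, eLpNorm_eq_lintegral_rpow_enorm_toReal hq0 hq] at h1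
  calc ‖mehler μ c U x‖ₑ ^ q.toReal
      ≤ (∫⁻ y, ‖U (c • x + √(1 - c ^ 2) • y)‖ₑ ∂μ) ^ q.toReal :=
        ENNReal.rpow_le_rpow (enorm_integral_le_lintegral_enorm _) hqr.le
    _ ≤ ((∫⁻ y, ‖U (c • x + √(1 - c ^ 2) • y)‖ₑ ^ q.toReal ∂μ) ^ (1 / q.toReal)) ^ q.toReal :=
        ENNReal.rpow_le_rpow h1 hqr.le
    _ = _ := by
        rw [← ENNReal.rpow_mul, one_div, inv_mul_cancel₀ hqr.ne', ENNReal.rpow_one]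
        rfl

theorem memLp_mehler (hμ : StdGaussian μ) {c : ℝ} (hc : c ∈ Set.Icc (0 : ℝ) 1) {q : ℝ≥0∞}
    (hq1 : 1 ≤ q) (hq : q ≠ ∞) {U : (ι → ℝ) → ℝ} (hU : MemLp U q μ) :
    MemLp (mehler μ c U) q μ := by
  have := hμ.isProbabilityMeasure
  refine ⟨?_, (hμ.eLpNorm_mehler_le hc hq1 hq hU.1).trans_lt hU.2⟩
  exact (hU.1.comp_measurePreserving (hμ.measurePreserving_mix hc)).integral_prod_right'

theorem integrable_corr (hμ : StdGaussian μ) {c : ℝ} (hc : c ∈ Set.Icc (0 : ℝ) 1)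
    {W U : (ι → ℝ) → ℝ} (hW : MemLp W 2 μ) (hU : MemLp U 2 μ) :
    Integrable (fun p : (ι → ℝ) × (ι → ℝ) => W p.1 * U (c • p.1 + √(1 - c ^ 2) • p.2))
      (μ.prod μ) :=
  have := hμ.isProbabilityMeasure
  integrable_mul_of_memLp_two (hW.comp_measurePreserving measurePreserving_fst)
    (hμ.memLp_mix hc hU)

theorem integral_mul_mehler (hμ : StdGaussian μ) {c : ℝ} (hc : c ∈ Set.Icc (0 : ℝ) 1)
    {W U : (ι → ℝ) → ℝ} (hW : MemLp W 2 μ) (hU : MemLp U 2 μ) :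
    ∫ x, W x * mehler μ c U x ∂μ = corr μ c W U := by
  have := hμ.isProbabilityMeasure
  rw [corr, integral_prod _ (hμ.integrable_corr hc hW hU)]
  congr 1 with x
  exact (integral_const_mul _ _).symm

/-- The Mehler semigroup is symmetric. -/
theorem corr_comm (hμ : StdGaussian μ) {c : ℝ} (hc : c ∈ Set.Icc (0 : ℝ) 1)
    {W U : (ι → ℝ) → ℝ} (hW : MemLp W 2 μ) (hU : MemLp U 2 μ) :
    corr μ c W U = corr μ c U W := by
  have := hμ.isProbabilityMeasure
  have hcs := sq_add_sqrt_sq hc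
  have hrot := hμ.measurePreserving_rotate hcs
  have hi := hμ.integrable_corr hc hU hW
  rw [corr, corr]
  conv_rhs => rw [← hrot.map_eq]
  rw [integral_map hrot.aemeasurable (by rw [hrot.map_eq]; exact hi.1)]
  congr 1 with p
  have h1 : c • (c • p.1 + √(1 - c ^ 2) • p.2) + √(1 - c ^ 2) • (√(1 - c ^ 2) • p.1 - c • p.2)
      = p.1 := by
    ext i
    simp only [Pi.add_apply, Pi.sub_apply, Pi.smul_apply, smul_eq_mul]
    linear_combination p.1 i * hcs
  simp only [h1]
  ring

theorem abs_corr_le (hμ : StdGaussian μ) {c : ℝ} (hc : c ∈ Set.Icc (0 : ℝ) 1)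
    {W U : (ι → ℝ) → ℝ} (hW : MemLp W 2 μ) (hU : MemLp U 2 μ) :
    |corr μ c W U| ≤ √(∫ x, W x ^ 2 ∂μ) * √(∫ x, U x ^ 2 ∂μ) := by
  have := hμ.isProbabilityMeasure
  have h := abs_integral_mul_le (hW.comp_measurePreserving
    (measurePreserving_fst (μ := μ) (ν := μ))) (hμ.memLp_mix hc hU)
  have hP := hμ.measurePreserving_mix hc
  have e1 : ∫ p, (W ∘ Prod.fst) p ^ 2 ∂(μ.prod μ) = ∫ x, W x ^ 2 ∂μ := by
    have h1 := integral_map (μ := μ.prod μ) (φ := Prod.fst) measurable_fst.aemeasurable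
      (f := fun x => W x ^ 2) (by rw [measurePreserving_fst.map_eq]; exact hW.integrable_sq.1)
    rw [measurePreserving_fst.map_eq] at h1
    exact h1.symm
  have e2 : ∫ p : (ι → ℝ) × (ι → ℝ), U (c • p.1 + √(1 - c ^ 2) • p.2) ^ 2 ∂(μ.prod μ)
      = ∫ x, U x ^ 2 ∂μ := by
    have h1 := integral_map hP.aemeasurable
      (f := fun x => U x ^ 2) (by rw [hP.map_eq]; exact hU.integrable_sq.1)
    rw [hP.map_eq] at h1
    exact h1.symm
  rw [e1, e2] at h
  exact h

theorem lin_mix (l : ι →₀ ℝ) (a c s : ℝ) (x y : ι → ℝ) :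
    lin l (c • x + s • y) + a = lin (s • l) y + (lin (c • l) x + a) := by
  rw [lin_add_right, lin_smul_right, lin_smul_right, lin_smul_left, lin_smul_left]; ring

theorem mehler_wave (hμ : StdGaussian μ) {c : ℝ} (hc : c ∈ Set.Icc (0 : ℝ) 1) (l : ι →₀ ℝ) (a : ℝ)
    (x : ι → ℝ) : mehler μ c (wave l a) x
      = Real.exp (-((1 - c ^ 2) * normSq l) / 2) * wave (c • l) a x := by
  have h := hμ.integral_wave (√(1 - c ^ 2) • l) (lin (c • l) x + a)
  rw [normSq_smul, Real.sq_sqrt (by nlinarith [hc.1, hc.2])] at h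
  rw [mehler, wave, ← h]
  simp only [wave, lin_mix]

/-- The semigroup maps the test functions of `HasWeakDeriv` to multiples of test functions with the
contracted frequency `c • l`. -/
theorem mehler_test (hμ : StdGaussian μ) {c : ℝ} (hc : c ∈ Set.Icc (0 : ℝ) 1) (e : ι)
    (l : ι →₀ ℝ) (a : ℝ) (x : ι → ℝ) :
    mehler μ c (fun x => x e * wave l a x + l e * swave l a x) x
      = Real.exp (-((1 - c ^ 2) * normSq l) / 2) *
        (c * (x e * wave (c • l) a x + (c • l) e * swave (c • l) a x)) := by
  have := hμ.isProbabilityMeasure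
  set s := √(1 - c ^ 2) with hs
  have hs2 : s ^ 2 = 1 - c ^ 2 := Real.sq_sqrt (by nlinarith [hc.1, hc.2])
  set b := lin (c • l) x + a with hb
  have h1 := hμ.integral_wave (s • l) b
  have h2 := hμ.integral_swave (s • l) b
  have h3 := hμ.integral_eval_mul_wave e (s • l) b
  rw [normSq_smul, hs2] at h1 h2
  have e1 : ∀ y : ι → ℝ, (c • x + s • y) e * wave l a (c • x + s • y)
      + l e * swave l a (c • x + s • y) = c * x e * wave (s • l) b y
        + (s * (y e * wave (s • l) b y) + l e * swave (s • l) b y) := by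
    intro y
    simp only [wave, swave, lin_mix, Pi.add_apply, Pi.smul_apply, smul_eq_mul, ← hb]
    ring
  have i1 := hμ.integrable_wave (s • l) b
  have i2 : Integrable (swave (s • l) b) μ :=
    Integrable.of_bound (measurable_swave _ _).aestronglyMeasurable 1
      (Filter.Eventually.of_forall (abs_swave_le _ _))
  have i3 : Integrable (fun y : ι → ℝ => y e * wave (s • l) b y) μ :=
    integrable_mul_of_memLp_two (hμ.memLp_eval e (by simp)) (hμ.memLp_wave _ _ 2)
  rw [mehler]
  simp only [← hs, e1]
  have i4 : Integrable (fun y : ι → ℝ => s * (y e * wave (s • l) b y) + l e * swave (s • l) b y)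
    μ := (i3.const_mul s).add (i2.const_mul (l e))
  rw [integral_add (i1.const_mul _) i4, integral_add (i3.const_mul s) (i2.const_mul (l e)),
    integral_const_mul, integral_const_mul,
    integral_const_mul, h3, h1, h2]
  simp only [wave, swave, ← hb, Finsupp.smul_apply, smul_eq_mul]
  linear_combination (-(l e * Real.exp (-((1 - c ^ 2) * normSq l) / 2) * Real.sin b)) * hs2

/-- The Mehler semigroup commutes with weak derivatives up to the factor `c`. -/
theorem hasWeakDeriv_mehler (hμ : StdGaussian μ) {c : ℝ} (hc : c ∈ Set.Icc (0 : ℝ) 1) {e : ι}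
    {G U : (ι → ℝ) → ℝ} (h : HasWeakDeriv μ e G U) :
    HasWeakDeriv μ e (mehler μ c G) (fun x => c * mehler μ c U x) := by
  have hG := hμ.memLp_mehler hc one_le_two (by simp) h.memLp
  have hU := hμ.memLp_mehler hc one_le_two (by simp) h.memLp_deriv
  refine ⟨hG, hU.const_mul c, fun l a => ?_⟩
  have ht := hμ.memLp_test e l a (p := 2) (by simp)
  have e1 : ∫ x, c * mehler μ c U x * wave l a x ∂μ = c * corr μ c U (wave l a) := by
    rw [hμ.corr_comm hc h.memLp_deriv (hμ.memLp_wave l a 2),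
      ← hμ.integral_mul_mehler hc (hμ.memLp_wave l a 2) h.memLp_deriv, ← integral_const_mul]
    congr 1 with x; ring
  have e2 : ∫ x, mehler μ c G x * (x e * wave l a x + l e * swave l a x) ∂μ
      = corr μ c G (fun x => x e * wave l a x + l e * swave l a x) := by
    rw [hμ.corr_comm hc h.memLp ht, ← hμ.integral_mul_mehler hc ht h.memLp]
    congr 1 with x; ring
  rw [e1, e2, ← hμ.integral_mul_mehler hc h.memLp ht,
    ← hμ.integral_mul_mehler hc h.memLp_deriv (hμ.memLp_wave l a 2)]
  simp only [hμ.mehler_wave hc, hμ.mehler_test hc]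
  have e3 := h.integral_mul_wave (c • l) a
  set E := Real.exp (-((1 - c ^ 2) * normSq l) / 2)
  calc c * ∫ x, U x * (E * wave (c • l) a x) ∂μ
      = c * (E * ∫ x, U x * wave (c • l) a x ∂μ) := by
        rw [← integral_const_mul E]; congr 2 with x; ring
    _ = _ := by
        rw [e3, ← integral_const_mul, ← integral_const_mul]; congr 1 with x; ring

end StdGaussian

/-! ### Density of trigonometric polynomials in Gaussian Sobolev spaces -/

theorem HasWeakDeriv.integral_mul_swave {e : ι} {G U : (ι → ℝ) → ℝ} (h : HasWeakDeriv μ e G U)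
    (l : ι →₀ ℝ) (a : ℝ) :
    ∫ x, U x * swave l a x ∂μ = ∫ x, G x * (x e * swave l a x - l e * wave l a x) ∂μ := by
  have h1 := h.integral_mul_wave l (a + Real.pi / 2)
  simp only [wave_add_pi_div_two, swave_add_pi_div_two] at h1
  rw [← neg_inj, ← integral_neg, ← integral_neg]
  calc _ = ∫ x, U x * -swave l a x ∂μ := by congr 1 with x; ring
    _ = _ := h1
    _ = _ := by congr 1 with x; ring

namespace StdGaussian

/-- A function that, together with its weak derivatives in the directions `J`, is orthogonal to
all waves vanishes: scaling the frequencies in the directions `J` by `r`, the orthogonality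
relation turns into a differential equation in `r` for its Fourier transform. -/
theorem integral_mul_wave_eq_zero (hμ : StdGaussian μ) {J : Set ι} {g : (ι → ℝ) → ℝ}
    {d : ι → (ι → ℝ) → ℝ} (hg : MemLp g 2 μ) (hd : ∀ e ∈ J, HasWeakDeriv μ e g (d e))
    (horth : ∀ l a, ∫ x, g x * wave l a x ∂μ = ∑' e : J, ∫ x, d e x * (l e * swave l a x) ∂μ)
    (l : ι →₀ ℝ) (a : ℝ) : ∫ x, g x * wave l a x ∂μ = 0 := by
  classical
  have := hμ.isProbabilityMeasure
  set l0 := l.filter (fun e => ¬ e ∈ J) with hl0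
  set l1 := l.filter (fun e => e ∈ J) with hl1
  set k : ℝ → ι →₀ ℝ := fun r => l0 + r • l1 with hk
  set q := normSq l1 with hq
  set φ : ℝ → ℝ := fun r => ∫ x, g x * wave (k r) a x ∂μ with hφ
  set φ' : ℝ → ℝ := fun r => -∫ x, g x * (lin l1 x * swave (k r) a x) ∂μ with hφ'
  have hgl : Integrable (fun x => g x * lin l1 x) μ :=
    integrable_mul_of_memLp_two hg (hμ.memLp_lin l1 (by simp))
  have hm2 : ∀ r, AEStronglyMeasurable (fun x => g x * (lin l1 x * swave (k r) a x)) μ := fun r =>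
    hg.1.mul ((measurable_lin l1).mul (measurable_swave _ _)).aestronglyMeasurable
  have hder : ∀ r, HasDerivAt φ (φ' r) r := by
    intro r
    have h := (hasDerivAt_integral_of_dominated_loc_of_deriv_le (μ := μ) (s := Set.univ) (x₀ := r)
      (F := fun r x => g x * wave (k r) a x) (bound := fun x => |g x * lin l1 x|)
      (F' := fun r x => -(g x * (lin l1 x * swave (k r) a x)))
      Filter.univ_mem (Filter.Eventually.of_forall fun t =>
        hg.1.mul (measurable_wave _ _).aestronglyMeasurable)
      (integrable_mul_of_memLp_two hg (hμ.memLp_wave _ _ 2)) (hm2 r).neg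
      (Filter.Eventually.of_forall fun x t _ => ?_) hgl.abs
      (Filter.Eventually.of_forall fun x t _ => ?_)).2
    · rw [integral_neg] at h
      exact h
    · rw [norm_neg, ← mul_assoc, norm_mul]
      exact mul_le_of_le_one_right (norm_nonneg _) (abs_swave_le _ _ _)
    · have h1 : HasDerivAt (fun t => lin (k t) x + a) (lin l1 x) t := by
        simp only [hk, lin_add_left, lin_smul_left]
        simpa using (((hasDerivAt_id' t).mul_const (lin l1 x)).const_add (lin l0 x)).add_const a
      exact ((((Real.hasDerivAt_cos _).comp t h1)).const_mul (g x)).congr_deriv (by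
        simp only [swave]; ring)
  have hode : ∀ r, φ r + r * φ' r + r ^ 2 * q * φ r = 0 := by
    intro r
    have h := horth (k r) a
    -- only the finitely many directions in the support of `l` contribute
    set s : Finset J := l.support.subtype (fun e => e ∈ J) with hs
    have hkJ : ∀ e ∈ J, k r e = r * l e := by
      intro e he
      simp [hk, hl0, hl1, he]
    have hterm : ∀ e : J, ∫ x, d e x * (k r e * swave (k r) a x) ∂μ
        = r * (l e * ∫ x, g x * (x e * swave (k r) a x) ∂μ) - r ^ 2 * (l e * l e) * φ r := by
      intro e
      have h1 := (hd e e.2).integral_mul_swave (k r) a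
      have i1 : Integrable (fun x => g x * (x e * swave (k r) a x)) μ := by
        refine integrable_mul_of_memLp_two hg ?_
        refine (hμ.memLp_eval e (p := 2) (by simp)).of_le
          (((measurable_pi_apply _).mul (measurable_swave _ a)).aestronglyMeasurable)
          (Filter.Eventually.of_forall fun x => ?_)
        rw [norm_mul]
        exact mul_le_of_le_one_right (norm_nonneg _) (abs_swave_le _ a x)
      have i2 : Integrable (fun x => g x * wave (k r) a x) μ :=
        integrable_mul_of_memLp_two hg (hμ.memLp_wave _ _ 2)
      have h2 : ∫ x, g x * (x e * swave (k r) a x - k r e * wave (k r) a x) ∂μ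
          = ∫ x, g x * (x e * swave (k r) a x) ∂μ - k r e * φ r := by
        rw [hφ]
        simp only
        rw [← integral_const_mul, ← integral_sub i1 (i2.const_mul _)]
        congr 1 with x; ring
      calc _ = k r e * ∫ x, d e x * swave (k r) a x ∂μ := by
            rw [← integral_const_mul]; congr 1 with x; ring
        _ = _ := by rw [h1, h2, hkJ e e.2]; ring
    rw [tsum_eq_sum (s := s)] at h
    · simp only [hterm] at h
      rw [Finset.sum_sub_distrib, ← Finset.mul_sum, ← Finset.sum_mul, ← Finset.mul_sum] at h
      have hsup : l1.support = s.map (Function.Embedding.subtype _) := by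
        rw [hl1, Finsupp.support_filter, hs, Finset.subtype_map]
      have e1 : ∀ x : ι → ℝ, lin l1 x = ∑ e ∈ s, l e * x e := by
        intro x
        rw [lin, Finsupp.sum, hsup, Finset.sum_map]
        refine Finset.sum_congr rfl fun e _ => ?_
        simp [hl1]
      have e2 : q = ∑ e ∈ s, l e * l e := by
        rw [hq, normSq, e1]
        refine Finset.sum_congr rfl fun e _ => ?_
        simp [hl1]
      have e3 : φ' r = -∑ e ∈ s, l e * ∫ x, g x * (x e * swave (k r) a x) ∂μ := by
        rw [hφ']
        simp only [e1]
        congr 1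
        simp_rw [← integral_const_mul]
        rw [← integral_finsetSum]
        · congr 1 with x
          rw [Finset.sum_mul, Finset.mul_sum]
          exact Finset.sum_congr rfl fun e _ => by ring
        · intro e _
          refine Integrable.const_mul (integrable_mul_of_memLp_two hg ?_) _
          refine (hμ.memLp_eval e (p := 2) (by simp)).of_le
            (((measurable_pi_apply _).mul (measurable_swave _ a)).aestronglyMeasurable)
            (Filter.Eventually.of_forall fun x => ?_)
          rw [norm_mul]
          exact mul_le_of_le_one_right (norm_nonneg _) (abs_swave_le _ a x)
      rw [e3, e2]
      linear_combination h
    · intro e he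
      have : l e = 0 := by
        simpa [hs] using he
      rw [hterm e, this]; ring
  -- the equation `(r φ)' + r² q φ = 0` has the integrating factor `exp (r² q / 2)`
  have hΨ : ∀ r, HasDerivAt (fun r => r * Real.exp (r ^ 2 * q / 2) * φ r) 0 r := by
    intro r
    have h1 : HasDerivAt (fun r : ℝ => Real.exp (r ^ 2 * q / 2))
        (Real.exp (r ^ 2 * q / 2) * (r * q)) r := by
      have h2 : HasDerivAt (fun r : ℝ => r ^ 2 * q / 2) (r * q) r := by
        refine ((((hasDerivAt_id' r).fun_pow 2).mul_const q).div_const 2).congr_deriv ?_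
        simp; ring
      exact h2.exp
    refine ((((hasDerivAt_id' r).mul h1)).mul (hder r)).congr_deriv ?_
    simp only [Pi.mul_apply]
    linear_combination Real.exp (r ^ 2 * q / 2) * hode r
  have hconst := is_const_of_deriv_eq_zero (fun r => (hΨ r).differentiableAt)
    (fun r => (hΨ r).deriv) 1 0
  have hk1 : k 1 = l := by
    rw [hk]
    simp only [one_smul, hl0, hl1]
    rw [add_comm]
    exact Finsupp.filter_add_filter_not l _
  simp only [zero_mul, one_mul, mul_eq_zero, Real.exp_ne_zero, false_or] at hconst
  rw [hφ] at hconst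
  simpa [hk1] using hconst

theorem inner_toLp_eq (f : Lp ℝ 2 μ) {g : (ι → ℝ) → ℝ} (hg : MemLp g 2 μ) :
    inner ℝ f (hg.toLp g) = ∫ x, f x * g x ∂μ := by
  rw [L2.inner_def]
  refine integral_congr_ae ?_
  filter_upwards [hg.coeFn_toLp] with x hx
  simp [hx, mul_comm]

theorem norm_sq_eq_integral (f : Lp ℝ 2 μ) : ‖f‖ ^ 2 = ∫ x, f x ^ 2 ∂μ := by
  rw [← real_inner_self_eq_norm_sq, L2.inner_def]
  congr 1 with x
  simp [pow_two]

theorem norm_toLp_sq {g : (ι → ℝ) → ℝ} (hg : MemLp g 2 μ) :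
    ‖hg.toLp g‖ ^ 2 = ∫ x, g x ^ 2 ∂μ := by
  rw [norm_sq_eq_integral]
  refine integral_congr_ae ?_
  filter_upwards [hg.coeFn_toLp] with x hx
  rw [hx]

/-- Trigonometric polynomials are dense in the Sobolev space of functions with weak derivatives in
the directions `J`, for the norm `(‖G‖² + ∑ e ∈ J, ‖∂_e G‖²)^(1/2)`: the Sobolev space is a closed
subspace of `L² × ℓ²(J; L²)`, so the part `b` of `(G, D)` orthogonal to trigonometric polynomials is
again a Sobolev function with its gradient, and `integral_mul_wave_eq_zero` shows that it
vanishes. -/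
theorem exists_trig_approx (hμ : StdGaussian μ) {J : Set ι} {G : (ι → ℝ) → ℝ}
    {D : ι → (ι → ℝ) → ℝ} (hG : MemLp G 2 μ) (hD : ∀ e ∈ J, HasWeakDeriv μ e G (D e))
    (hS : Summable fun e : J => ∫ x, D e x ^ 2 ∂μ) {ε : ℝ} (hε : 0 < ε) :
    ∃ p ∈ trig ι, ∫ x, (G x - p.1 x) ^ 2 ∂μ < ε ∧
      (Summable fun e : J => ∫ x, (D e x - p.2 e x) ^ 2 ∂μ) ∧
      ∑' e : J, ∫ x, (D e x - p.2 e x) ^ 2 ∂μ < ε := by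
  classical
  have := hμ.isProbabilityMeasure
  let H2 := lp (fun _ : J => Lp ℝ 2 μ) 2
  let H := WithLp 2 (Lp ℝ 2 μ × H2)
  have hDm : ∀ e : J, MemLp (D e) 2 μ := fun e => (hD e e.2).memLp_deriv
  have mkmem : ∀ {A : J → (ι → ℝ) → ℝ} (hA : ∀ e, MemLp (A e) 2 μ),
      (Summable fun e : J => ∫ x, A e x ^ 2 ∂μ) → Memℓp (fun e => (hA e).toLp (A e)) 2 := by
    intro A hA hs
    refine memℓp_gen (hs.congr fun e => ?_)
    rw [ENNReal.toReal_ofNat, Real.rpow_two, norm_toLp_sq]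
  -- The subspace of trigonometric polynomials.
  let K : Submodule ℝ H :=
    { carrier := {v | ∃ p ∈ trig ι, v.fst =ᵐ[μ] p.1 ∧ ∀ e : J, v.snd e =ᵐ[μ] p.2 e}
      zero_mem' := ⟨0, (trig ι).zero_mem, Lp.coeFn_zero _ _ _, fun e => Lp.coeFn_zero _ _ _⟩
      add_mem' := by
        rintro u v ⟨p, hp, hp1, hp2⟩ ⟨q, hq, hq1, hq2⟩
        exact ⟨p + q, (trig ι).add_mem hp hq, (Lp.coeFn_add _ _).trans (hp1.add hq1),
          fun e => (Lp.coeFn_add _ _).trans ((hp2 e).add (hq2 e))⟩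
      smul_mem' := by
        rintro r v ⟨p, hp, hp1, hp2⟩
        exact ⟨r • p, (trig ι).smul_mem r hp,
          (Lp.coeFn_smul _ _).trans (hp1.const_smul r),
          fun e => (Lp.coeFn_smul _ _).trans ((hp2 e).const_smul r)⟩ }
  let v : H := WithLp.toLp 2 (hG.toLp G, ⟨fun e => (hDm e).toLp (D e), mkmem hDm hS⟩)
  -- The weak derivative relation is a family of orthogonality relations.
  let n : J → (ι →₀ ℝ) → ℝ → H := fun e l a => WithLp.toLp 2
    ((hμ.memLp_test e l a (p := 2) (by simp)).toLp _,
      -lp.single 2 e ((hμ.memLp_wave l a 2).toLp _))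
  have hn : ∀ (u : H) e l a, inner ℝ u (n e l a)
      = ∫ x, u.fst x * (x e * wave l a x + l e * swave l a x) ∂μ
        - ∫ x, u.snd e x * wave l a x ∂μ := by
    intro u e l a
    rw [WithLp.prod_inner_apply]
    simp only [n, inner_neg_right]
    rw [lp.inner_single_right, inner_toLp_eq, inner_toLp_eq]
    rfl
  have hnv : ∀ e l a, inner ℝ v (n e l a) = 0 := by
    intro e l a
    rw [hn, sub_eq_zero, integral_congr_ae (g := fun x => G x * _), integral_congr_ae
      (f := fun x => v.snd e x * wave l a x) (g := fun x => D e x * wave l a x)]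
    · exact ((hD e e.2).integral_mul_wave l a).symm
    · filter_upwards [(hDm e).coeFn_toLp] with x hx
      exact congrArg (· * _) hx
    · filter_upwards [hG.coeFn_toLp] with x hx
      exact congrArg (· * _) hx
  have hnK : ∀ u ∈ K.topologicalClosure, ∀ e l a, inner ℝ u (n e l a) = 0 := by
    intro u hu e l a
    have hcl : IsClosed {u : H | inner ℝ u (n e l a) = 0} :=
      isClosed_eq (by fun_prop) continuous_const
    refine closure_minimal (s := (K : Set H)) (fun w hw => ?_) hcl hu
    obtain ⟨p, hp, hp1, hp2⟩ := hw
    change inner ℝ w (n e l a) = 0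
    rw [hn, sub_eq_zero, integral_congr_ae (g := fun x => p.1 x * _), integral_congr_ae
      (f := fun x => w.snd e x * wave l a x) (g := fun x => p.2 e x * wave l a x)]
    · exact ((hμ.hasWeakDeriv_trig hp e).integral_mul_wave l a).symm
    · filter_upwards [hp2 e] with x hx
      exact congrArg (· * _) hx
    · filter_upwards [hp1] with x hx
      exact congrArg (· * _) hx
  obtain ⟨u, hu, b, hb, huv⟩ := K.topologicalClosure.exists_add_mem_mem_orthogonal v
  have hnb : ∀ e l a, inner ℝ b (n e l a) = 0 := by
    intro e l a
    have h := hnv e l a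
    rwa [huv, inner_add_left, hnK u hu, zero_add] at h
  have hbd : ∀ e : J, HasWeakDeriv μ e b.fst (b.snd e) := by
    intro e
    refine ⟨Lp.memLp _, Lp.memLp _, fun l a => ?_⟩
    have h := hnb e l a
    rw [hn, sub_eq_zero] at h
    exact h.symm
  have hbw : ∀ l a, ∫ x, b.fst x * wave l a x ∂μ
      = ∑' e : J, ∫ x, b.snd e x * (l e * swave l a x) ∂μ := by
    intro l a
    have hp := wave_mem_trig l a
    set p : ((ι → ℝ) → ℝ) × (ι → (ι → ℝ) → ℝ) := (wave l a, fun e x => -(l e * swave l a x))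
      with hpdef
    have hpm : ∀ e : J, MemLp (p.2 e) 2 μ := fun e => hμ.memLp_trig_deriv hp e 2
    have hps : Summable fun e : J => ∫ x, p.2 e x ^ 2 ∂μ := by
      refine summable_of_ne_finset_zero (s := l.support.subtype (fun e => e ∈ J))
        fun e he => ?_
      have : l e = 0 := by simpa using he
      simp [hpdef, this]
    let w : H := WithLp.toLp 2 ((hμ.memLp_wave l a 2).toLp _,
      ⟨fun e => (hpm e).toLp (p.2 e), mkmem hpm hps⟩)
    have hwK : w ∈ K.topologicalClosure := K.le_topologicalClosure
      ⟨p, hp, (hμ.memLp_wave l a 2).coeFn_toLp, fun e => (hpm e).coeFn_toLp⟩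
    have h := (Submodule.mem_orthogonal' _ b).1 hb w hwK
    rw [WithLp.prod_inner_apply] at h
    have e1 : inner ℝ b.snd w.snd = -∑' e : J, ∫ x, b.snd e x * (l e * swave l a x) ∂μ := by
      rw [lp.inner_eq_tsum, ← tsum_neg]
      congr 1 with e
      refine (inner_toLp_eq (b.snd e) (hpm e)).trans ?_
      rw [← integral_neg]
      congr 1 with x
      simp [hpdef]
    have e2 : inner ℝ b.fst w.fst = ∫ x, b.fst x * wave l a x ∂μ :=
      inner_toLp_eq b.fst (hμ.memLp_wave l a 2)
    change inner ℝ b.fst w.fst + inner ℝ b.snd w.snd = 0 at h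
    rw [e1, e2] at h
    linarith
  have hb0 : b = 0 := by
    have h1 : b.fst =ᵐ[μ] 0 := ae_eq_zero_of_integral_wave
      ((Lp.memLp b.fst).integrable one_le_two)
      (hμ.integral_mul_wave_eq_zero (J := J) (d := fun e => if h : e ∈ J then b.snd ⟨e, h⟩ else 0)
        (Lp.memLp b.fst) (fun e he => by simpa [he] using hbd ⟨e, he⟩)
        (fun l a => by simpa using hbw l a))
    have h2 : ∀ e : J, b.snd e =ᵐ[μ] 0 := fun e => ae_eq_zero_of_integral_wave
      ((Lp.memLp (b.snd e)).integrable one_le_two) fun l a => by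
        rw [(hbd e).integral_mul_wave]
        refine integral_eq_zero_of_ae ?_
        filter_upwards [h1] with x hx
        simp [hx]
    have h3 : b.fst = 0 := (Lp.eq_zero_iff_ae_eq_zero).2 h1
    have h4 : b.snd = 0 := by
      ext1
      funext e
      exact (Lp.eq_zero_iff_ae_eq_zero).2 (h2 e)
    calc b = WithLp.toLp 2 (b.fst, b.snd) := rfl
      _ = 0 := by rw [h3, h4]; rfl
  rw [hb0, add_zero] at huv
  rw [← huv] at hu
  obtain ⟨w, ⟨p, hp, hp1, hp2⟩, hw⟩ := Metric.mem_closure_iff.1 hu (√ε) (Real.sqrt_pos.2 hε)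
  rw [dist_eq_norm] at hw
  have hw2 : ‖v - w‖ ^ 2 < ε := by
    rw [← Real.sq_sqrt hε.le]
    exact pow_lt_pow_left₀ hw (norm_nonneg _) two_ne_zero
  rw [WithLp.prod_norm_sq_eq_of_L2] at hw2
  have e1 : ‖(v - w).fst‖ ^ 2 = ∫ x, (G x - p.1 x) ^ 2 ∂μ := by
    rw [norm_sq_eq_integral]
    refine integral_congr_ae ?_
    filter_upwards [hp1, hG.coeFn_toLp, Lp.coeFn_sub v.fst w.fst] with x h1 h2 h3
    have : (v - w).fst x = v.fst x - w.fst x := h3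
    rw [this, h1]
    exact congrArg (fun z => (z - p.1 x) ^ 2) h2
  have e2 : HasSum (fun e : J => ∫ x, (D e x - p.2 e x) ^ 2 ∂μ) (‖(v - w).snd‖ ^ 2) := by
    have h := lp.hasSum_inner (𝕜 := ℝ) (v - w).snd (v - w).snd
    rw [real_inner_self_eq_norm_sq] at h
    suffices hfun : (fun e : J => inner ℝ ((v - w).snd e) ((v - w).snd e))
        = fun e : J => ∫ x, (D e x - p.2 e x) ^ 2 ∂μ by
      rw [hfun] at h
      exact h
    funext e
    rw [real_inner_self_eq_norm_sq, norm_sq_eq_integral]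
    refine integral_congr_ae ?_
    filter_upwards [hp2 e, (hDm e).coeFn_toLp, Lp.coeFn_sub (v.snd e) (w.snd e)] with x h1 h2 h3
    have : (v - w).snd e x = v.snd e x - w.snd e x := h3
    rw [this, h1]
    exact congrArg (fun z => (z - p.2 e x) ^ 2) h2
  refine ⟨p, hp, ?_, e2.summable, ?_⟩
  · rw [← e1]; nlinarith [sq_nonneg ‖(v - w).snd‖]
  · rw [e2.tsum_eq]; nlinarith [sq_nonneg ‖(v - w).fst‖]

end StdGaussian

/-! ### The covariance formula and the Poincaré inequality -/

/-- `G` belongs to the Gaussian Sobolev space `W^{1,2}(μ)`, with weak gradient `D`. -/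
structure IsSobolev (μ : Measure (ι → ℝ)) (G : (ι → ℝ) → ℝ) (D : ι → (ι → ℝ) → ℝ) : Prop where
  memLp : MemLp G 2 μ
  hasWeakDeriv : ∀ e, HasWeakDeriv μ e G (D e)
  summable : Summable fun e => ∫ x, D e x ^ 2 ∂μ

/-- `∑ e, ⟨A e, mehler c (B e)⟩` for two square integrable vector fields. -/
noncomputable def gradCorr (μ : Measure (ι → ℝ)) (A B : ι → (ι → ℝ) → ℝ) (c : ℝ) : ℝ :=
  ∑' e, corr μ c (A e) (B e)

namespace StdGaussian

theorem corr_add_right (hμ : StdGaussian μ) {c : ℝ} (hc : c ∈ Set.Icc (0 : ℝ) 1)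
    {W U V : (ι → ℝ) → ℝ} (hW : MemLp W 2 μ) (hU : MemLp U 2 μ) (hV : MemLp V 2 μ) :
    corr μ c W (fun x => U x + V x) = corr μ c W U + corr μ c W V := by
  rw [corr, corr, corr, ← integral_add (hμ.integrable_corr hc hW hU) (hμ.integrable_corr hc hW hV)]
  congr 1 with p
  ring

theorem corr_sub_right (hμ : StdGaussian μ) {c : ℝ} (hc : c ∈ Set.Icc (0 : ℝ) 1)
    {W U V : (ι → ℝ) → ℝ} (hW : MemLp W 2 μ) (hU : MemLp U 2 μ) (hV : MemLp V 2 μ) :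
    corr μ c W (fun x => U x - V x) = corr μ c W U - corr μ c W V := by
  rw [corr, corr, corr, ← integral_sub (hμ.integrable_corr hc hW hU) (hμ.integrable_corr hc hW hV)]
  congr 1 with p
  ring

theorem corr_smul_right (c r : ℝ) (W U : (ι → ℝ) → ℝ) :
    corr μ c W (fun x => r * U x) = r * corr μ c W U := by
  rw [corr, corr, ← integral_const_mul]
  congr 1 with p
  ring

theorem summable_mul_of_sq {κ : Type*} {a b : κ → ℝ} (ha0 : ∀ e, 0 ≤ a e) (hb0 : ∀ e, 0 ≤ b e)
    (ha : Summable a) (hb : Summable b) : (Summable fun e => √(a e) * √(b e)) ∧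
      ∑' e, √(a e) * √(b e) ≤ √(∑' e, a e) * √(∑' e, b e) := by
  have h := Real.summable_and_inner_le_Lp_mul_Lq_tsum_of_nonneg (f := fun e => √(a e))
    (g := fun e => √(b e)) Real.HolderConjugate.two_two (fun e => Real.sqrt_nonneg _)
    (fun e => Real.sqrt_nonneg _) (ha.congr fun e => by rw [Real.rpow_two, Real.sq_sqrt (ha0 e)])
    (hb.congr fun e => by rw [Real.rpow_two, Real.sq_sqrt (hb0 e)])
  simp only [Real.rpow_two, Real.sq_sqrt (ha0 _), Real.sq_sqrt (hb0 _), ← Real.sqrt_eq_rpow] at h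
  exact h

/-- The Cauchy–Schwarz inequality for `gradCorr`. -/
theorem abs_gradCorr_le (hμ : StdGaussian μ) {c : ℝ} (hc : c ∈ Set.Icc (0 : ℝ) 1)
    {A B : ι → (ι → ℝ) → ℝ} (hA : ∀ e, MemLp (A e) 2 μ) (hB : ∀ e, MemLp (B e) 2 μ)
    (sA : Summable fun e => ∫ x, A e x ^ 2 ∂μ) (sB : Summable fun e => ∫ x, B e x ^ 2 ∂μ) :
    (Summable fun e => corr μ c (A e) (B e)) ∧ |gradCorr μ A B c|
      ≤ √(∑' e, ∫ x, A e x ^ 2 ∂μ) * √(∑' e, ∫ x, B e x ^ 2 ∂μ) := by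
  obtain ⟨h1, h2⟩ := summable_mul_of_sq (fun e => integral_nonneg fun x => sq_nonneg (A e x))
    (fun e => integral_nonneg fun x => sq_nonneg (B e x)) sA sB
  have h3 : ∀ e, ‖corr μ c (A e) (B e)‖ ≤ _ := fun e => hμ.abs_corr_le hc (hA e) (hB e)
  exact ⟨h1.of_norm_bounded h3, (tsum_of_norm_bounded h1.hasSum h3).trans h2⟩

/-- The covariance formula for a single wave, by the fundamental theorem of calculus. -/
theorem covariance_wave (hμ : StdGaussian μ) {H : (ι → ℝ) → ℝ} {DH : ι → (ι → ℝ) → ℝ}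
    (hHm : MemLp H 2 μ) (hH : ∀ e, HasWeakDeriv μ e H (DH e)) (l : ι →₀ ℝ) (a : ℝ) :
    ContinuousOn (gradCorr μ DH fun e x => -(l e * swave l a x)) (Set.Icc 0 1) ∧
      ∫ c in (0 : ℝ)..1, gradCorr μ DH (fun e x => -(l e * swave l a x)) c
        = ∫ x, H x * wave l a x ∂μ - (∫ x, H x ∂μ) * ∫ x, wave l a x ∂μ := by
  have := hμ.isProbabilityMeasure
  set φ : ℝ → ℝ := fun c => ∫ x, H x * wave (c • l) a x ∂μ with hφ
  set φ' : ℝ → ℝ := fun c => -∫ x, H x * (lin l x * swave (c • l) a x) ∂μ with hφ'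
  set E : ℝ → ℝ := fun c => Real.exp (-((1 - c ^ 2) * normSq l) / 2) with hE
  have hHl : Integrable (fun x => H x * lin l x) μ :=
    integrable_mul_of_memLp_two hHm (hμ.memLp_lin l (by simp))
  have hm2 : ∀ c : ℝ, AEStronglyMeasurable (fun x => H x * (lin l x * swave (c • l) a x)) μ :=
    fun r => hHm.1.mul ((measurable_lin l).mul (measurable_swave _ _)).aestronglyMeasurable
  have hb : ∀ (c : ℝ) x, ‖H x * (lin l x * swave (c • l) a x)‖ ≤ |H x * lin l x| := by
    intro c x
    rw [← mul_assoc, norm_mul]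
    exact mul_le_of_le_one_right (norm_nonneg _) (abs_swave_le _ _ _)
  have hder : ∀ c, HasDerivAt φ (φ' c) c := by
    intro r
    have h := (hasDerivAt_integral_of_dominated_loc_of_deriv_le (μ := μ) (s := Set.univ) (x₀ := r)
      (F := fun r x => H x * wave (r • l) a x) (bound := fun x => |H x * lin l x|)
      (F' := fun r x => -(H x * (lin l x * swave (r • l) a x)))
      Filter.univ_mem (Filter.Eventually.of_forall fun t =>
        hHm.1.mul (measurable_wave _ _).aestronglyMeasurable)
      (integrable_mul_of_memLp_two hHm (hμ.memLp_wave _ _ 2)) (hm2 r).neg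
      (Filter.Eventually.of_forall fun x t _ => ?_) hHl.abs
      (Filter.Eventually.of_forall fun x t _ => ?_)).2
    · rw [integral_neg] at h
      exact h
    · rw [norm_neg]
      exact hb t x
    · have h1 : HasDerivAt (fun t : ℝ => lin (t • l) x + a) (lin l x) t := by
        simp only [lin_smul_left]
        simpa using ((hasDerivAt_id' t).mul_const (lin l x)).add_const a
      exact ((((Real.hasDerivAt_cos _).comp t h1)).const_mul (H x)).congr_deriv (by
        simp only [swave]; ring)
  have hcφ : Continuous φ := continuous_iff_continuousAt.2 fun x => (hder x).continuousAt
  have hcφ' : Continuous φ' := by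
    refine (continuous_of_dominated (bound := fun x => |H x * lin l x|) hm2
      (fun c => Filter.Eventually.of_forall (hb c)) hHl.abs
      (Filter.Eventually.of_forall fun x => ?_)).neg
    simp only [swave, lin_smul_left]
    fun_prop
  have hEd : ∀ c, HasDerivAt E (E c * (c * normSq l)) c := by
    intro c
    have h2 : HasDerivAt (fun c : ℝ => -((1 - c ^ 2) * normSq l) / 2) (c * normSq l) c := by
      refine (((((hasDerivAt_id' c).fun_pow 2).const_sub 1).mul_const
        (normSq l)).fun_neg.div_const 2).congr_deriv ?_
      simp; ring
    exact h2.exp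
  have hval : ∀ c ∈ Set.Icc (0 : ℝ) 1, gradCorr μ DH (fun e x => -(l e * swave l a x)) c
      = E c * (c * normSq l) * φ c + E c * φ' c := by
    intro c hc
    have hx : ∀ e, Integrable (fun x : ι → ℝ => H x * (x e * swave (c • l) a x)) μ := by
      intro e
      refine integrable_mul_of_memLp_two hHm ?_
      refine (hμ.memLp_eval e (p := 2) (by simp)).of_le
        (((measurable_pi_apply _).mul (measurable_swave _ a)).aestronglyMeasurable)
        (Filter.Eventually.of_forall fun x => ?_)
      rw [norm_mul]
      exact mul_le_of_le_one_right (norm_nonneg _) (abs_swave_le _ a x)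
    have i2 : Integrable (fun x => H x * wave (c • l) a x) μ :=
      integrable_mul_of_memLp_two hHm (hμ.memLp_wave _ _ 2)
    have hterm : ∀ e, corr μ c (DH e) (fun x => -(l e * swave l a x))
        = E c * (c * (l e * l e) * φ c - l e * ∫ x, H x * (x e * swave (c • l) a x) ∂μ) := by
      intro e
      have e1 : (fun x => -(l e * swave l a x)) = fun x => l e * wave l (a + Real.pi / 2) x := by
        ext x; rw [wave_add_pi_div_two]; ring
      have e2 : ∫ x, DH e x * mehler μ c (wave l (a + Real.pi / 2)) x ∂μ
          = -(E c * ∫ x, DH e x * swave (c • l) a x ∂μ) := by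
        rw [← integral_const_mul, ← integral_neg]
        congr 1 with x
        rw [hμ.mehler_wave hc, wave_add_pi_div_two]
        ring
      have e3 : ∫ x, H x * (x e * swave (c • l) a x - (c • l) e * wave (c • l) a x) ∂μ
          = ∫ x, H x * (x e * swave (c • l) a x) ∂μ - c * l e * φ c := by
        rw [hφ]
        simp only
        rw [← integral_const_mul, ← integral_sub (hx e) (i2.const_mul _)]
        congr 1 with x
        simp only [Finsupp.smul_apply, smul_eq_mul]
        ring
      rw [e1, corr_smul_right, ← hμ.integral_mul_mehler hc (hH e).memLp_deriv
        (hμ.memLp_wave _ _ 2), e2, (hH e).integral_mul_swave, e3]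
      ring
    rw [gradCorr, tsum_eq_sum (s := l.support)]
    · simp only [hterm]
      rw [← Finset.mul_sum, Finset.sum_sub_distrib, ← Finset.sum_mul, ← Finset.mul_sum]
      have e3 : φ' c = -∑ e ∈ l.support, l e * ∫ x, H x * (x e * swave (c • l) a x) ∂μ := by
        rw [hφ']
        simp only [lin_eq_sum (Finset.Subset.refl l.support)]
        congr 1
        simp_rw [← integral_const_mul]
        rw [← integral_finsetSum _ fun e _ => (hx e).const_mul _]
        congr 1 with x
        rw [Finset.sum_mul, Finset.mul_sum]
        exact Finset.sum_congr rfl fun e _ => by ring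
      rw [e3, normSq, lin_eq_sum (Finset.Subset.refl l.support)]
      ring
    · intro e he
      rw [hterm e, Finsupp.notMem_support_iff.1 he]
      ring
  have hcont : Continuous fun c => E c * (c * normSq l) * φ c + E c * φ' c := by
    have : Continuous E := by fun_prop
    fun_prop
  refine ⟨hcont.continuousOn.congr hval, ?_⟩
  rw [intervalIntegral.integral_congr (g := fun c => E c * (c * normSq l) * φ c + E c * φ' c)
    (by rw [Set.uIcc_of_le zero_le_one]; exact hval)]
  rw [intervalIntegral.integral_eq_sub_of_hasDerivAt (f := fun c => E c * φ c)
    (fun c _ => (hEd c).mul (hder c)) (hcont.intervalIntegrable _ _)]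
  rw [hμ.integral_wave]
  have e0 : φ 0 = Real.cos a * ∫ x, H x ∂μ := by
    rw [hφ]
    simp only [zero_smul, wave, lin_zero_left, zero_add]
    rw [integral_mul_const, mul_comm]
  have e1 : φ 1 = ∫ x, H x * wave l a x ∂μ := by simp [hφ]
  rw [e0, e1]
  simp only [hE]
  norm_num
  ring

/-- The covariance formula when one of the functions is a trigonometric polynomial. -/
theorem covariance_trig (hμ : StdGaussian μ) {H : (ι → ℝ) → ℝ} {DH : ι → (ι → ℝ) → ℝ}
    (hHm : MemLp H 2 μ) (hH : ∀ e, HasWeakDeriv μ e H (DH e)) {p} (hp : p ∈ trig ι) :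
    ContinuousOn (gradCorr μ DH p.2) (Set.Icc 0 1) ∧
      ∫ c in (0 : ℝ)..1, gradCorr μ DH p.2 c
        = ∫ x, H x * p.1 x ∂μ - (∫ x, H x ∂μ) * ∫ x, p.1 x ∂μ := by
  have := hμ.isProbabilityMeasure
  have hfs : ∀ {q}, q ∈ trig ι → ∀ c, Summable fun e => corr μ c (DH e) (q.2 e) := by
    intro q hq c
    obtain ⟨s, hs⟩ := trig_finite_support hq
    refine summable_of_ne_finset_zero (s := s) fun e he => ?_
    simp [hs e he, corr]
  refine trig_induction (C := fun p => ContinuousOn (gradCorr μ DH p.2) (Set.Icc 0 1) ∧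
      ∫ c in (0 : ℝ)..1, gradCorr μ DH p.2 c
        = ∫ x, H x * p.1 x ∂μ - (∫ x, H x ∂μ) * ∫ x, p.1 x ∂μ) ?_ ?_ ?_ ?_ hp
  · exact hμ.covariance_wave hHm hH
  · have h0 : gradCorr μ DH (0 : ((ι → ℝ) → ℝ) × (ι → (ι → ℝ) → ℝ)).2 = fun _ => 0 := by
      ext c; simp [gradCorr, corr]
    rw [h0]
    simp [continuousOn_const]
  · rintro p q hp hq ⟨hp1, hp2⟩ ⟨hq1, hq2⟩
    have hadd : ∀ c ∈ Set.Icc (0 : ℝ) 1, gradCorr μ DH (p + q).2 c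
        = gradCorr μ DH p.2 c + gradCorr μ DH q.2 c := by
      intro c hc
      rw [gradCorr, gradCorr, gradCorr, ← (hfs hp c).tsum_add (hfs hq c)]
      congr 1 with e
      exact hμ.corr_add_right hc (hH e).memLp_deriv (hμ.memLp_trig_deriv hp e 2)
        (hμ.memLp_trig_deriv hq e 2)
    refine ⟨(hp1.add hq1).congr hadd, ?_⟩
    rw [intervalIntegral.integral_congr (g := fun c => gradCorr μ DH p.2 c + gradCorr μ DH q.2 c)
      (by rw [Set.uIcc_of_le zero_le_one]; exact hadd), intervalIntegral.integral_add
      (hp1.intervalIntegrable_of_Icc zero_le_one) (hq1.intervalIntegrable_of_Icc zero_le_one),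
      hp2, hq2]
    simp only [Prod.fst_add, Pi.add_apply, mul_add]
    rw [integral_add (integrable_mul_of_memLp_two hHm (hμ.memLp_trig hp 2))
      (integrable_mul_of_memLp_two hHm (hμ.memLp_trig hq 2)),
      integral_add ((hμ.memLp_trig hp 1).integrable le_rfl)
        ((hμ.memLp_trig hq 1).integrable le_rfl)]
    ring
  · rintro r p hp ⟨hp1, hp2⟩
    have hsm : ∀ c, gradCorr μ DH (r • p).2 c = r * gradCorr μ DH p.2 c := by
      intro c
      rw [gradCorr, gradCorr, ← tsum_mul_left]
      congr 1 with e
      exact corr_smul_right c r (DH e) (p.2 e)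
    refine ⟨(hp1.const_mul r).congr fun c _ => hsm c, ?_⟩
    simp only [hsm, Prod.smul_fst, Pi.smul_apply, smul_eq_mul]
    rw [intervalIntegral.integral_const_mul, hp2, integral_const_mul, mul_sub,
      ← integral_const_mul]
    congr 1
    · congr 1 with x; ring
    · ring

theorem isSobolev_approx (hμ : StdGaussian μ) {G : (ι → ℝ) → ℝ} {D : ι → (ι → ℝ) → ℝ}
    (hG : IsSobolev μ G D) {ε : ℝ} (hε : 0 < ε) :
    ∃ p ∈ trig ι, ∫ x, (G x - p.1 x) ^ 2 ∂μ < ε ∧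
      (Summable fun e => ∫ x, (D e x - p.2 e x) ^ 2 ∂μ) ∧
      ∑' e, ∫ x, (D e x - p.2 e x) ^ 2 ∂μ < ε := by
  obtain ⟨p, hp, h1, h2, h3⟩ := hμ.exists_trig_approx (J := Set.univ) hG.memLp
    (fun e _ => hG.hasWeakDeriv e) ((Equiv.Set.univ ι).summable_iff.2 hG.summable) hε
  refine ⟨p, hp, h1, (Equiv.Set.univ ι).summable_iff.1 h2, ?_⟩
  rwa [tsum_univ (f := fun e => ∫ x, (D e x - p.2 e x) ^ 2 ∂μ)] at h3

/-- The covariance formula: the covariance of two Sobolev functions is the average over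
`c ∈ [0, 1]` of the correlations of their gradients along the Mehler semigroup. -/
theorem covariance (hμ : StdGaussian μ) {H G : (ι → ℝ) → ℝ} {DH DG : ι → (ι → ℝ) → ℝ}
    (hH : IsSobolev μ H DH) (hG : IsSobolev μ G DG) :
    ContinuousOn (gradCorr μ DH DG) (Set.Icc 0 1) ∧
      ∫ c in (0 : ℝ)..1, gradCorr μ DH DG c
        = ∫ x, H x * G x ∂μ - (∫ x, H x ∂μ) * ∫ x, G x ∂μ := by
  have := hμ.isProbabilityMeasure
  have hHD : ∀ e, MemLp (DH e) 2 μ := fun e => (hH.hasWeakDeriv e).memLp_deriv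
  have hGD : ∀ e, MemLp (DG e) 2 μ := fun e => (hG.hasWeakDeriv e).memLp_deriv
  set A := √(∑' e, ∫ x, DH e x ^ 2 ∂μ) with hA
  have hA0 : 0 ≤ A := Real.sqrt_nonneg _
  -- approximation of `G` by trigonometric polynomials, uniformly in `c`
  have key : ∀ ε > 0, ∃ p ∈ trig ι, √(∫ x, (G x - p.1 x) ^ 2 ∂μ) ≤ ε ∧
      ∀ c ∈ Set.Icc (0 : ℝ) 1, |gradCorr μ DH DG c - gradCorr μ DH p.2 c| ≤ A * ε := by
    intro ε hε
    obtain ⟨p, hp, h1, h2, h3⟩ := hμ.isSobolev_approx hG (sq_pos_of_pos hε)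
    refine ⟨p, hp, Real.sqrt_le_iff.2 ⟨hε.le, h1.le⟩, fun c hc => ?_⟩
    have hpD := fun e => hμ.memLp_trig_deriv hp e 2
    have h4 := hμ.abs_gradCorr_le hc hHD (fun e => (hGD e).sub (hpD e)) hH.summable
      (by simpa using h2)
    have h5 : gradCorr μ DH DG c - gradCorr μ DH p.2 c
        = gradCorr μ DH (fun e => DG e - p.2 e) c := by
      obtain ⟨s, hs⟩ := trig_finite_support hp
      rw [gradCorr, gradCorr, gradCorr,
        ← (hμ.abs_gradCorr_le hc hHD hGD hH.summable hG.summable).1.tsum_sub]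
      · congr 1 with e
        exact (hμ.corr_sub_right hc (hHD e) (hGD e) (hpD e)).symm
      · refine summable_of_ne_finset_zero (s := s) fun e he => ?_
        simp [hs e he, corr]
    rw [h5]
    refine h4.2.trans ?_
    simp only [Pi.sub_apply]
    exact mul_le_mul_of_nonneg_left (Real.sqrt_le_iff.2 ⟨hε.le, h3.le⟩) hA0
  have hcont : ContinuousOn (gradCorr μ DH DG) (Set.Icc 0 1) := by
    refine continuousOn_of_uniform_approx_of_continuousOn fun u hu => ?_
    obtain ⟨δ, hδ, hu⟩ := Metric.mem_uniformity_dist.1 hu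
    obtain ⟨p, hp, -, h2⟩ := key (δ / (A + 1)) (by positivity)
    refine ⟨gradCorr μ DH p.2, (hμ.covariance_trig hH.memLp hH.hasWeakDeriv hp).1,
      fun c hc => hu ?_⟩
    rw [Real.dist_eq]
    refine (h2 c hc).trans_lt ?_
    rw [mul_div_assoc', div_lt_iff₀ (by positivity)]
    nlinarith
  refine ⟨hcont, ?_⟩
  set B := √(∫ x, H x ^ 2 ∂μ) with hB
  set B' := √(∫ x, (1 : ℝ) ^ 2 ∂μ) with hB'
  rw [← sub_eq_zero, ← abs_nonpos_iff]
  refine le_of_forall_pos_le_add fun δ hδ => ?_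
  have hB0 : 0 ≤ B := Real.sqrt_nonneg _
  have hB'0 : 0 ≤ B' := Real.sqrt_nonneg _
  set C := A + B + |∫ x, H x ∂μ| * B' with hC
  have hC0 : 0 ≤ C := by positivity
  obtain ⟨p, hp, h1, h2⟩ := key (δ / (C + 1)) (by positivity)
  obtain ⟨h3, h4⟩ := hμ.covariance_trig hH.memLp hH.hasWeakDeriv hp
  set ε := δ / (C + 1) with hε
  have hpm := hμ.memLp_trig hp 2
  have e1 : |(∫ c in (0 : ℝ)..1, gradCorr μ DH DG c) - ∫ c in (0 : ℝ)..1, gradCorr μ DH p.2 c|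
      ≤ A * ε := by
    rw [← intervalIntegral.integral_sub (hcont.intervalIntegrable_of_Icc zero_le_one)
      (h3.intervalIntegrable_of_Icc zero_le_one)]
    have := intervalIntegral.norm_integral_le_of_norm_le_const (a := (0 : ℝ)) (b := 1)
      (C := A * ε) (f := fun c => gradCorr μ DH DG c - gradCorr μ DH p.2 c) (fun c hc => by
        rw [Set.uIoc_of_le zero_le_one] at hc
        exact h2 c ⟨hc.1.le, hc.2⟩)
    simpa using this
  have e2 : |∫ x, H x * G x ∂μ - ∫ x, H x * p.1 x ∂μ| ≤ B * ε := by
    rw [← integral_sub (integrable_mul_of_memLp_two hH.memLp hG.memLp)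
      (integrable_mul_of_memLp_two hH.memLp hpm)]
    have h := abs_integral_mul_le hH.memLp (hG.memLp.sub hpm)
    simp only [Pi.sub_apply, mul_sub] at h
    exact h.trans (mul_le_mul_of_nonneg_left h1 hB0)
  have e3 : |∫ x, G x ∂μ - ∫ x, p.1 x ∂μ| ≤ B' * ε := by
    rw [← integral_sub (hG.memLp.integrable one_le_two) (hpm.integrable one_le_two)]
    have h := abs_integral_mul_le (memLp_const (1 : ℝ) (μ := μ) (p := 2)) (hG.memLp.sub hpm)
    simp only [Pi.sub_apply, one_mul] at h
    exact h.trans (mul_le_mul_of_nonneg_left h1 hB'0)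
  have e4 : |(∫ x, H x ∂μ) * (∫ x, G x ∂μ - ∫ x, p.1 x ∂μ)| ≤ |∫ x, H x ∂μ| * (B' * ε) := by
    rw [abs_mul]; exact mul_le_mul_of_nonneg_left e3 (abs_nonneg _)
  have e5 : C * ε ≤ δ := by
    rw [hε, mul_div_assoc', div_le_iff₀ (by positivity)]
    nlinarith
  have e6 : (∫ c in (0 : ℝ)..1, gradCorr μ DH DG c)
      - (∫ x, H x * G x ∂μ - (∫ x, H x ∂μ) * ∫ x, G x ∂μ)
      = ((∫ c in (0 : ℝ)..1, gradCorr μ DH DG c) - ∫ c in (0 : ℝ)..1, gradCorr μ DH p.2 c)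
        - (∫ x, H x * G x ∂μ - ∫ x, H x * p.1 x ∂μ)
        + (∫ x, H x ∂μ) * (∫ x, G x ∂μ - ∫ x, p.1 x ∂μ) := by
    rw [h4]; ring
  rw [e6, zero_add]
  refine (abs_add_le _ _).trans ((add_le_add (abs_sub _ _) le_rfl).trans ?_)
  calc _ ≤ A * ε + B * ε + |∫ x, H x ∂μ| * (B' * ε) := by gcongr
    _ = C * ε := by rw [hC]; ring
    _ ≤ δ := e5

/-- The Gaussian Poincaré inequality. -/
theorem poincare (hμ : StdGaussian μ) {G : (ι → ℝ) → ℝ} {D : ι → (ι → ℝ) → ℝ}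
    (hG : IsSobolev μ G D) :
    ∫ x, G x ^ 2 ∂μ - (∫ x, G x ∂μ) ^ 2 ≤ ∑' e, ∫ x, D e x ^ 2 ∂μ := by
  obtain ⟨h1, h2⟩ := hμ.covariance hG hG
  have hD : ∀ e, MemLp (D e) 2 μ := fun e => (hG.hasWeakDeriv e).memLp_deriv
  have h3 : ∫ c in (0 : ℝ)..1, gradCorr μ D D c
      ≤ ∫ c in (0 : ℝ)..1, ∑' e, ∫ x, D e x ^ 2 ∂μ := by
    refine intervalIntegral.integral_mono_on zero_le_one
      (h1.intervalIntegrable_of_Icc zero_le_one) (by simp) fun c hc => ?_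
    have h4 := (le_abs_self _).trans (hμ.abs_gradCorr_le hc hD hD hG.summable hG.summable).2
    rwa [Real.mul_self_sqrt (tsum_nonneg fun e => integral_nonneg fun x => sq_nonneg _)] at h4
  rw [h2] at h3
  simp only [intervalIntegral.integral_const, sub_zero, smul_eq_mul, one_mul] at h3
  simpa only [pow_two] using h3

end StdGaussian

/-! ### Product and chain rules for weak derivatives -/

theorem holderTriple_four_four_two : ENNReal.HolderTriple 4 4 2 := ⟨by
  rw [← two_mul, show (4 : ℝ≥0∞) = 2 * 2 by norm_num, ENNReal.mul_inv (by simp) (by simp),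
    ← mul_assoc, ENNReal.mul_inv_cancel (by simp) (by simp), one_mul]⟩

theorem memLp_two_mul {α : Type*} [MeasurableSpace α] {ν : Measure α} {f g : α → ℝ}
    (hf : MemLp f 4 ν) (hg : MemLp g 4 ν) : MemLp (fun x => f x * g x) 2 ν := by
  have := holderTriple_four_four_two
  exact hg.mul' hf

theorem ofReal_sqrt_integral_sq {α : Type*} [MeasurableSpace α] {ν : Measure α} {f : α → ℝ}
    (hf : MemLp f 2 ν) : ENNReal.ofReal (√(∫ x, f x ^ 2 ∂ν)) = eLpNorm f 2 ν := by
  rw [hf.eLpNorm_eq_integral_rpow_norm (by simp) (by simp)]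
  simp [Real.sqrt_eq_rpow]

theorem memLp_mul_bdd {α : Type*} [MeasurableSpace α] {ν : Measure α} {f g : α → ℝ} {q : ℝ≥0∞}
    {M : ℝ} (hf : MemLp f q ν) (hg : AEStronglyMeasurable g ν) (hM : ∀ x, |g x| ≤ M) :
    MemLp (fun x => f x * g x) q ν := by
  refine (hf.norm.const_mul M).of_le (hf.1.mul hg) (Filter.Eventually.of_forall fun x => ?_)
  rw [norm_mul, norm_mul, norm_norm, mul_comm]
  gcongr
  exact (hM x).trans (le_abs_self M)

theorem memLp_comp_of_hasDerivAt {α : Type*} [MeasurableSpace α] {ν : Measure α}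
    [IsFiniteMeasure ν] {G : α → ℝ} {q : ℝ≥0∞} (hG : MemLp G q ν) {f f' : ℝ → ℝ} {M : ℝ}
    (hf : ∀ x, HasDerivAt f (f' x) x) (hM : ∀ x, |f' x| ≤ M) :
    MemLp (fun x => f (G x)) q ν := by
  have hc : Continuous f := continuous_iff_continuousAt.2 fun x => (hf x).continuousAt
  refine ((memLp_const |f 0|).add (hG.norm.const_mul M)).of_le
    (hc.comp_aestronglyMeasurable hG.1) (Filter.Eventually.of_forall fun x => ?_)
  exact (abs_le_of_hasDerivAt hf hM (G x)).trans (le_abs_self _)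

namespace StdGaussian

/-- The product rule when one of the factors is a trigonometric polynomial. -/
theorem hasWeakDeriv_trig_mul (hμ : StdGaussian μ) {e : ι} {V V' : (ι → ℝ) → ℝ}
    (hV : HasWeakDeriv μ e V V') {p} (hp : p ∈ trig ι) :
    HasWeakDeriv μ e (fun x => V x * p.1 x) (fun x => V' x * p.1 x + V x * p.2 e x) := by
  have bdd : ∀ {q : ((ι → ℝ) → ℝ) × (ι → (ι → ℝ) → ℝ)}, q ∈ trig ι → ∀ {W : (ι → ℝ) → ℝ},
      MemLp W 2 μ → MemLp (fun x => W x * q.1 x) 2 μ ∧ MemLp (fun x => W x * q.2 e x) 2 μ := by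
    intro q hq W hW
    obtain ⟨⟨M, hM⟩, hN⟩ := trig_bounded hq
    obtain ⟨N, hN⟩ := hN e
    exact ⟨memLp_mul_bdd hW (trig_measurable hq).1.aestronglyMeasurable hM,
      memLp_mul_bdd hW ((trig_measurable hq).2 e).aestronglyMeasurable hN⟩
  refine ⟨(bdd hp hV.memLp).1, (bdd hp hV.memLp_deriv).1.add (bdd hp hV.memLp).2, fun l a => ?_⟩
  have iL : ∀ {q : ((ι → ℝ) → ℝ) × (ι → (ι → ℝ) → ℝ)}, q ∈ trig ι →
      Integrable (fun x => (V' x * q.1 x + V x * q.2 e x) * wave l a x) μ := fun hq =>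
    integrable_mul_of_memLp_two ((bdd hq hV.memLp_deriv).1.add (bdd hq hV.memLp).2)
      (hμ.memLp_wave l a 2)
  have iR : ∀ {q : ((ι → ℝ) → ℝ) × (ι → (ι → ℝ) → ℝ)}, q ∈ trig ι →
      Integrable (fun x => V x * q.1 x * (x e * wave l a x + l e * swave l a x)) μ := fun hq =>
    integrable_mul_of_memLp_two (bdd hq hV.memLp).1 (hμ.memLp_test e l a (by simp))
  refine trig_induction (C := fun p => ∫ x, (V' x * p.1 x + V x * p.2 e x) * wave l a x ∂μ
    = ∫ x, V x * p.1 x * (x e * wave l a x + l e * swave l a x) ∂μ) ?_ ?_ ?_ ?_ hp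
  · intro k b
    -- a product of waves is a combination of waves with frequencies `l + k` and `l - k`
    have h1 := hV.integral_mul_wave (l + k) (a + b)
    have h2 := hV.integral_mul_wave (l - k) (a - b)
    have hcc : ∀ x, wave (l + k) (a + b) x + wave (l - k) (a - b) x
        = 2 * (wave l a x * wave k b x) := by
      intro x
      simp only [wave, lin_add_left, lin_sub_left]
      rw [show lin l x + lin k x + (a + b) = (lin l x + a) + (lin k x + b) by ring,
        show lin l x - lin k x + (a - b) = (lin l x + a) - (lin k x + b) by ring, Real.cos_add,
        Real.cos_sub]
      ring
    have hss : ∀ x, (l + k) e * swave (l + k) (a + b) x + (l - k) e * swave (l - k) (a - b) x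
        = 2 * (l e * swave l a x * wave k b x + k e * swave k b x * wave l a x) := by
      intro x
      simp only [wave, swave, lin_add_left, lin_sub_left, Finsupp.add_apply, Finsupp.sub_apply]
      rw [show lin l x + lin k x + (a + b) = (lin l x + a) + (lin k x + b) by ring,
        show lin l x - lin k x + (a - b) = (lin l x + a) - (lin k x + b) by ring, Real.sin_add,
        Real.sin_sub]
      ring
    have iw : ∀ k b, Integrable (fun x => V' x * wave k b x) μ := fun k b =>
      integrable_mul_of_memLp_two hV.memLp_deriv (hμ.memLp_wave k b 2)
    have it : ∀ k b, Integrable (fun x => V x * (x e * wave k b x + k e * swave k b x)) μ :=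
      fun k b => integrable_mul_of_memLp_two hV.memLp (hμ.memLp_test e k b (by simp))
    have h3 : ∫ x, V' x * (wave l a x * wave k b x) ∂μ = ∫ x, V x *
        (x e * (wave l a x * wave k b x) + l e * swave l a x * wave k b x
          + k e * swave k b x * wave l a x) ∂μ := by
      have h4 := congrArg₂ (· + ·) h1 h2
      rw [← integral_add (iw _ _) (iw _ _), ← integral_add (it _ _) (it _ _)] at h4
      have e1 : ∀ x, V' x * wave (l + k) (a + b) x + V' x * wave (l - k) (a - b) x
          = 2 * (V' x * (wave l a x * wave k b x)) := fun x => by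
        linear_combination V' x * hcc x
      have e2 : ∀ x : ι → ℝ, V x * (x e * wave (l + k) (a + b) x
            + (l + k) e * swave (l + k) (a + b) x)
          + V x * (x e * wave (l - k) (a - b) x + (l - k) e * swave (l - k) (a - b) x)
          = 2 * (V x * (x e * (wave l a x * wave k b x) + l e * swave l a x * wave k b x
            + k e * swave k b x * wave l a x)) := fun x => by
        linear_combination V x * x e * hcc x + V x * hss x
      simp only [e1, e2] at h4
      rw [integral_const_mul, integral_const_mul] at h4
      linarith
    have hk := wave_mem_trig k b
    have i1 : Integrable (fun x => V' x * (wave l a x * wave k b x)) μ :=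
      (integrable_mul_of_memLp_two (bdd hk hV.memLp_deriv).1 (hμ.memLp_wave l a 2)).congr
        (Filter.Eventually.of_forall fun x => by simp only; ring)
    have i2 : Integrable (fun x => V x * (k e * swave k b x * wave l a x)) μ :=
      (integrable_mul_of_memLp_two (bdd hk hV.memLp).2 (hμ.memLp_wave l a 2)).neg.congr
        (Filter.Eventually.of_forall fun x => by simp only [Pi.neg_apply]; ring)
    have i3 : Integrable (fun x : ι → ℝ => V x * (x e * (wave l a x * wave k b x)
        + l e * swave l a x * wave k b x + k e * swave k b x * wave l a x)) μ :=
      ((iR hk).add i2).congr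
        (Filter.Eventually.of_forall fun x => by simp only [Pi.add_apply]; ring)
    calc ∫ x, (V' x * wave k b x + V x * -(k e * swave k b x)) * wave l a x ∂μ
        = ∫ x, V' x * (wave l a x * wave k b x) ∂μ
          - ∫ x, V x * (k e * swave k b x * wave l a x) ∂μ := by
          rw [← integral_sub i1 i2]; congr 1 with x; ring
      _ = _ := by
          rw [h3, ← integral_sub i3 i2]; congr 1 with x; ring
  · simp
  · intro q r hq hr h1 h2
    have h3 := congrArg₂ (· + ·) h1 h2
    rw [← integral_add (iL hq) (iL hr), ← integral_add (iR hq) (iR hr)] at h3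
    refine (integral_congr_ae (Filter.Eventually.of_forall fun x => ?_)).trans
      (h3.trans (integral_congr_ae (Filter.Eventually.of_forall fun x => ?_)))
    · simp only [Prod.fst_add, Prod.snd_add, Pi.add_apply]; ring
    · simp only [Prod.fst_add, Pi.add_apply]; ring
  · intro r q hq h
    have h3 := congrArg (r * ·) h
    rw [← integral_const_mul, ← integral_const_mul] at h3
    refine (integral_congr_ae (Filter.Eventually.of_forall fun x => ?_)).trans
      (h3.trans (integral_congr_ae (Filter.Eventually.of_forall fun x => ?_)))
    · simp only [Prod.smul_fst, Prod.smul_snd, Pi.smul_apply, smul_eq_mul]; ring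
    · simp only [Prod.smul_fst, Pi.smul_apply, smul_eq_mul]; ring

/-- Approximation by trigonometric polynomials in the Sobolev norm of a single direction. -/
theorem hasWeakDeriv_approx (hμ : StdGaussian μ) {e : ι} {G U : (ι → ℝ) → ℝ}
    (h : HasWeakDeriv μ e G U) {ε : ℝ} (hε : 0 < ε) :
    ∃ p ∈ trig ι, √(∫ x, (G x - p.1 x) ^ 2 ∂μ) ≤ ε ∧ √(∫ x, (U x - p.2 e x) ^ 2 ∂μ) ≤ ε := by
  obtain ⟨p, hp, h1, h2, h3⟩ := hμ.exists_trig_approx (J := {e}) (D := fun _ => U) h.memLp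
    (fun i hi => by rw [Set.mem_singleton_iff.1 hi]; exact h) (hasSum_fintype _).summable
    (sq_pos_of_pos hε)
  refine ⟨p, hp, Real.sqrt_le_iff.2 ⟨hε.le, h1.le⟩, Real.sqrt_le_iff.2 ⟨hε.le, ?_⟩⟩
  rw [tsum_singleton e (fun i => ∫ x, (U x - p.2 i x) ^ 2 ∂μ)] at h3
  exact h3.le

/-- The product rule for functions in `L⁴` with weak derivatives in `L⁴`. The factor `U` is replaced
by trigonometric polynomials; the error is controlled because `V` times a test function lies in
`L²`. -/
theorem hasWeakDeriv_mul (hμ : StdGaussian μ) {e : ι} {U U' V V' : (ι → ℝ) → ℝ}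
    (hU : HasWeakDeriv μ e U U') (hV : HasWeakDeriv μ e V V') (hU4 : MemLp U 4 μ)
    (hU4' : MemLp U' 4 μ) (hV4 : MemLp V 4 μ) (hV4' : MemLp V' 4 μ) :
    HasWeakDeriv μ e (fun x => U x * V x) (fun x => U' x * V x + U x * V' x) := by
  refine ⟨memLp_two_mul hU4 hV4, (memLp_two_mul hU4' hV4).add (memLp_two_mul hU4 hV4'),
    fun l a => ?_⟩
  set T : (ι → ℝ) → ℝ := fun x => x e * wave l a x + l e * swave l a x with hT
  have hw2 : ∀ {W : (ι → ℝ) → ℝ}, MemLp W 2 μ → MemLp (fun x => W x * wave l a x) 2 μ :=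
    fun hW => memLp_mul_bdd hW (measurable_wave l a).aestronglyMeasurable (abs_wave_le l a)
  have hVT : MemLp (fun x => V x * T x) 2 μ :=
    memLp_two_mul hV4 (hμ.memLp_test e l a (by simp))
  set C := √(∫ x, (V x * wave l a x) ^ 2 ∂μ) + √(∫ x, (V' x * wave l a x) ^ 2 ∂μ)
    + √(∫ x, (V x * T x) ^ 2 ∂μ) with hC
  have hC0 : 0 ≤ C := by positivity
  rw [← sub_eq_zero, ← abs_nonpos_iff]
  refine le_of_forall_pos_le_add fun δ hδ => ?_
  obtain ⟨p, hp, h1, h2⟩ := hμ.hasWeakDeriv_approx hU (show 0 < δ / (C + 1) by positivity)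
  set ε := δ / (C + 1) with hε
  have hp1 := hμ.memLp_trig hp 2
  have hp2 := hμ.memLp_trig_deriv hp e 2
  have h3 := (hμ.hasWeakDeriv_trig_mul hV hp).integral_mul_wave l a
  have a1 := abs_integral_mul_le (hU.memLp_deriv.sub hp2) (hw2 hV.memLp)
  have a2 := abs_integral_mul_le (hU.memLp.sub hp1) (hw2 hV.memLp_deriv)
  have a3 := abs_integral_mul_le (hU.memLp.sub hp1) hVT
  simp only [Pi.sub_apply] at a1 a2 a3
  have i1 := integrable_mul_of_memLp_two (hU.memLp_deriv.sub hp2) (hw2 hV.memLp)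
  have i2 := integrable_mul_of_memLp_two (hU.memLp.sub hp1) (hw2 hV.memLp_deriv)
  have i3 := integrable_mul_of_memLp_two (hU.memLp.sub hp1) hVT
  simp only [Pi.sub_apply] at i1 i2 i3
  have j1 : Integrable (fun x => (U' x * V x + U x * V' x) * wave l a x) μ :=
    integrable_mul_of_memLp_two ((memLp_two_mul hU4' hV4).add (memLp_two_mul hU4 hV4'))
      (hμ.memLp_wave l a 2)
  have j2 : Integrable (fun x => U x * V x * T x) μ :=
    integrable_mul_of_memLp_two (memLp_two_mul hU4 hV4) (hμ.memLp_test e l a (by simp))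
  have hpw := hμ.hasWeakDeriv_trig_mul hV hp
  have j3 := integrable_mul_of_memLp_two hpw.memLp_deriv (hμ.memLp_wave l a 2)
  have j4 : Integrable (fun x => V x * p.1 x * T x) μ :=
    integrable_mul_of_memLp_two hpw.memLp (hμ.memLp_test e l a (by simp))
  have b1 : ∫ x, (U' x * V x + U x * V' x) * wave l a x ∂μ
      - ∫ x, (V' x * p.1 x + V x * p.2 e x) * wave l a x ∂μ
      = ∫ x, (U' x - p.2 e x) * (V x * wave l a x) ∂μ
        + ∫ x, (U x - p.1 x) * (V' x * wave l a x) ∂μ := by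
    rw [← integral_sub j1 j3, ← integral_add i1 i2]
    congr 1 with x; ring
  have b2 : ∫ x, U x * V x * T x ∂μ - ∫ x, V x * p.1 x * T x ∂μ
      = ∫ x, (U x - p.1 x) * (V x * T x) ∂μ := by
    rw [← integral_sub j2 j4]
    congr 1 with x; ring
  have b3 : ∫ x, (U' x * V x + U x * V' x) * wave l a x ∂μ - ∫ x, U x * V x * T x ∂μ
      = ∫ x, (U' x - p.2 e x) * (V x * wave l a x) ∂μ
        + ∫ x, (U x - p.1 x) * (V' x * wave l a x) ∂μ
        - ∫ x, (U x - p.1 x) * (V x * T x) ∂μ := by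
    rw [← b1, ← b2, h3]; ring
  rw [b3, zero_add]
  refine (abs_sub _ _).trans ((add_le_add (abs_add_le _ _) le_rfl).trans ?_)
  calc _ ≤ ε * √(∫ x, (V x * wave l a x) ^ 2 ∂μ) + ε * √(∫ x, (V' x * wave l a x) ^ 2 ∂μ)
        + ε * √(∫ x, (V x * T x) ^ 2 ∂μ) :=
        add_le_add (add_le_add (a1.trans (by gcongr)) (a2.trans (by gcongr)))
          (a3.trans (by gcongr))
    _ = C * ε := by rw [hC]; ring
    _ ≤ δ := by
        rw [hε, mul_div_assoc', div_le_iff₀ (by positivity)]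
        nlinarith

/-- The chain rule for a `C¹` function with bounded derivative, by approximating `G` with
trigonometric polynomials. -/
theorem hasWeakDeriv_comp (hμ : StdGaussian μ) {e : ι} {G U : (ι → ℝ) → ℝ}
    (h : HasWeakDeriv μ e G U) {f f' : ℝ → ℝ} {M : ℝ} (hf : ∀ x, HasDerivAt f (f' x) x)
    (hf' : Continuous f') (hM : ∀ x, |f' x| ≤ M) :
    HasWeakDeriv μ e (fun x => f (G x)) (fun x => f' (G x) * U x) := by
  have := hμ.isProbabilityMeasure
  have hM0 : 0 ≤ M := (abs_nonneg _).trans (hM 0)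
  have hfG : MemLp (fun x => f (G x)) 2 μ := memLp_comp_of_hasDerivAt h.memLp hf hM
  have hbU : ∀ {W : (ι → ℝ) → ℝ} {Z : (ι → ℝ) → ℝ}, AEStronglyMeasurable Z μ → MemLp W 2 μ →
      MemLp (fun x => f' (Z x) * W x) 2 μ := by
    intro W Z hZ hW
    refine (memLp_mul_bdd hW (hf'.comp_aestronglyMeasurable hZ) fun x => hM (Z x)).ae_eq
      (Filter.Eventually.of_forall fun x => mul_comm _ _)
  have hfU := hbU h.memLp.1 h.memLp_deriv
  refine ⟨hfG, hfU, fun l a => ?_⟩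
  set T : (ι → ℝ) → ℝ := fun x => x e * wave l a x + l e * swave l a x with hT
  have hTm : MemLp T 2 μ := hμ.memLp_test e l a (by simp)
  have hwm := hμ.memLp_wave l a 2
  have hapx := fun n : ℕ => hμ.hasWeakDeriv_approx h
    (show (0 : ℝ) < 1 / ((n : ℝ) + 1) by positivity)
  choose p hp h1 h2 using hapx
  have ht0 := tendsto_one_div_add_atTop_nhds_zero_nat (𝕜 := ℝ)
  have hp1 : ∀ n, MemLp (p n).1 2 μ := fun n => hμ.memLp_trig (hp n) 2
  have hp2 : ∀ n, MemLp ((p n).2 e) 2 μ := fun n => hμ.memLp_trig_deriv (hp n) e 2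
  -- convergence in measure gives almost sure convergence along a subsequence
  have hL2 : Filter.Tendsto (fun n => eLpNorm ((p n).1 - G) 2 μ) Filter.atTop (nhds 0) := by
    have h3 : ∀ n, eLpNorm ((p n).1 - G) 2 μ ≤ ENNReal.ofReal (1 / ((n : ℝ) + 1)) := by
      intro n
      have h4 : MemLp ((p n).1 - G) 2 μ := (hp1 n).sub h.memLp
      rw [← ofReal_sqrt_integral_sq h4]
      refine ENNReal.ofReal_le_ofReal (le_trans (le_of_eq ?_) (h1 n))
      congr 2 with x
      simp only [Pi.sub_apply]; ring
    refine tendsto_of_tendsto_of_tendsto_of_le_of_le tendsto_const_nhds ?_ (fun _ => zero_le) h3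
    simpa using ENNReal.tendsto_ofReal ht0
  obtain ⟨ns, hns, hae⟩ := (tendstoInMeasure_of_tendsto_eLpNorm (by simp)
    (fun n => (hp1 n).1) h.memLp.1 hL2).exists_seq_tendsto_ae
  have hsub := ht0.comp hns.tendsto_atTop
  have hlim1 : Filter.Tendsto (fun n => ∫ x, f ((p (ns n)).1 x) * T x ∂μ) Filter.atTop
      (nhds (∫ x, f (G x) * T x ∂μ)) := by
    rw [tendsto_iff_dist_tendsto_zero]
    have hz : Filter.Tendsto (fun n => M * (1 / ((ns n : ℝ) + 1)) * √(∫ x, T x ^ 2 ∂μ))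
        Filter.atTop (nhds 0) := by
      simpa using (hsub.const_mul M).mul_const (√(∫ x, T x ^ 2 ∂μ))
    refine squeeze_zero (fun _ => dist_nonneg) (fun n => ?_) hz
    set q := p (ns n)
    have hfp : MemLp (fun x => f (q.1 x)) 2 μ :=
      (hμ.hasWeakDeriv_comp_trig (hp (ns n)) e hf hf' hM).memLp
    rw [Real.dist_eq, ← integral_sub (integrable_mul_of_memLp_two hfp hTm)
      (integrable_mul_of_memLp_two hfG hTm)]
    have h3 := abs_integral_mul_le (hfp.sub hfG) hTm
    simp only [Pi.sub_apply, sub_mul] at h3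
    refine h3.trans (mul_le_mul_of_nonneg_right ?_ (Real.sqrt_nonneg _))
    refine le_trans ?_ (mul_le_mul_of_nonneg_left (h1 (ns n)) hM0)
    rw [← Real.sqrt_sq hM0, ← Real.sqrt_mul (sq_nonneg M), ← integral_const_mul]
    refine Real.sqrt_le_sqrt (integral_mono (hfp.sub hfG).integrable_sq
      ((h.memLp.sub (hp1 _)).integrable_sq.const_mul _) fun x => ?_)
    have h4 := Convex.norm_image_sub_le_of_norm_hasDerivWithin_le (s := Set.univ)
      (fun y _ => (hf y).hasDerivWithinAt) (fun y _ => hM y) convex_univ (Set.mem_univ (G x))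
      (Set.mem_univ (q.1 x))
    simp only
    rw [← sq_abs (f (q.1 x) - f (G x)), ← mul_pow, ← sq_abs (M * _), abs_mul, abs_of_nonneg hM0,
      abs_sub_comm (G x)]
    exact pow_le_pow_left₀ (abs_nonneg _) h4 2
  have hlim2 : Filter.Tendsto (fun n => ∫ x, f' ((p (ns n)).1 x) * (p (ns n)).2 e x * wave l a x ∂μ)
      Filter.atTop (nhds (∫ x, f' (G x) * U x * wave l a x ∂μ)) := by
    have hA : Filter.Tendsto (fun n => ∫ x, f' ((p (ns n)).1 x) * U x * wave l a x ∂μ)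
        Filter.atTop (nhds (∫ x, f' (G x) * U x * wave l a x ∂μ)) := by
      refine tendsto_integral_of_dominated_convergence (fun x => M * |U x|)
        (fun n => (integrable_mul_of_memLp_two (hbU (hp1 _).1 h.memLp_deriv) hwm).1)
        ((h.memLp_deriv.integrable one_le_two).abs.const_mul M)
        (fun n => Filter.Eventually.of_forall fun x => ?_) ?_
      · rw [norm_mul, norm_mul]
        refine (mul_le_of_le_one_right (by positivity) (abs_wave_le l a x)).trans ?_
        exact mul_le_mul_of_nonneg_right (hM _) (norm_nonneg _)
      · filter_upwards [hae] with x hx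
        exact (((hf'.tendsto _).comp hx).mul_const _).mul_const _
    have hB : Filter.Tendsto (fun n => ∫ x, f' ((p (ns n)).1 x) * (p (ns n)).2 e x * wave l a x ∂μ
        - ∫ x, f' ((p (ns n)).1 x) * U x * wave l a x ∂μ) Filter.atTop (nhds 0) := by
      rw [tendsto_zero_iff_abs_tendsto_zero]
      have hz : Filter.Tendsto (fun n => (1 / ((ns n : ℝ) + 1)) * √(∫ x, (M : ℝ) ^ 2 ∂μ))
          Filter.atTop (nhds 0) := by
        have h5 := hsub.mul_const (√(∫ x, (M : ℝ) ^ 2 ∂μ))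
        rwa [zero_mul] at h5
      refine squeeze_zero (fun _ => abs_nonneg _) (fun n => ?_) hz
      set q := p (ns n)
      have hfw : MemLp (fun x => f' (q.1 x) * wave l a x) 2 μ := hbU (hp1 _).1 hwm
      rw [Function.comp_apply, ← integral_sub
        (integrable_mul_of_memLp_two (hbU (hp1 _).1 (hp2 _)) hwm)
        (integrable_mul_of_memLp_two (hbU (hp1 _).1 h.memLp_deriv) hwm)]
      have h3 := abs_integral_mul_le (h.memLp_deriv.sub (hp2 (ns n))) hfw
      rw [← abs_neg, ← integral_neg] at h3
      refine le_trans (le_of_eq ?_) (h3.trans (mul_le_mul (h2 (ns n)) (Real.sqrt_le_sqrt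
        (integral_mono hfw.integrable_sq (integrable_const _) fun x => ?_))
        (Real.sqrt_nonneg _) (by positivity)))
      · congr 2 with x
        simp only [Pi.sub_apply]; ring
      · simp only
        rw [← sq_abs]
        refine pow_le_pow_left₀ (abs_nonneg _) ?_ 2
        rw [abs_mul]
        exact (mul_le_of_le_one_right (abs_nonneg _) (abs_wave_le l a x)).trans (hM _)
    simpa using hB.add hA
  refine tendsto_nhds_unique hlim2 (hlim1.congr fun n => ?_)
  exact ((hμ.hasWeakDeriv_comp_trig (hp (ns n)) e hf hf' hM).integral_mul_wave l a).symm

end StdGaussian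

/-! ### The second order Poincaré inequality -/

theorem integral_sq_le_of_eLpNorm_le {α : Type*} [MeasurableSpace α] {ν : Measure α} {f : α → ℝ}
    (hf : MemLp f 2 ν) {a : ℝ≥0∞} (ha : a ≠ ∞) (h : eLpNorm f 2 ν ≤ a) :
    ∫ x, f x ^ 2 ∂ν ≤ a.toReal ^ 2 := by
  rw [← ofReal_sqrt_integral_sq hf] at h
  exact (Real.sqrt_le_left ENNReal.toReal_nonneg).1 ((ENNReal.ofReal_le_iff_le_toReal ha).1 h)

theorem eLpNorm_two_mul_le {α : Type*} [MeasurableSpace α] {ν : Measure α} {f g : α → ℝ}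
    (hf : AEStronglyMeasurable f ν) (hg : AEStronglyMeasurable g ν) :
    eLpNorm (fun x => f x * g x) 2 ν ≤ eLpNorm f 4 ν * eLpNorm g 4 ν := by
  have := holderTriple_four_four_two
  have h := eLpNorm_smul_le_mul_eLpNorm (p := 4) (q := 4) (r := 2) hg hf
  rwa [smul_eq_mul] at h

theorem HasWeakDeriv.add {e : ι} {G U H V : (ι → ℝ) → ℝ} (hμ : StdGaussian μ)
    (hG : HasWeakDeriv μ e G U) (hH : HasWeakDeriv μ e H V) :
    HasWeakDeriv μ e (fun x => G x + H x) (fun x => U x + V x) := by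
  refine ⟨hG.memLp.add hH.memLp, hG.memLp_deriv.add hH.memLp_deriv, fun l a => ?_⟩
  have hw := hμ.memLp_wave l a 2
  have ht := hμ.memLp_test e l a (p := 2) (by simp)
  simp only [add_mul]
  rw [integral_add (integrable_mul_of_memLp_two hG.memLp_deriv hw)
    (integrable_mul_of_memLp_two hH.memLp_deriv hw),
    integral_add (integrable_mul_of_memLp_two hG.memLp ht)
    (integrable_mul_of_memLp_two hH.memLp ht), hG.integral_mul_wave, hH.integral_mul_wave]

theorem HasWeakDeriv.sum {e : ι} {κ : Type*} {G U : κ → (ι → ℝ) → ℝ} (hμ : StdGaussian μ)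
    (h : ∀ i, HasWeakDeriv μ e (G i) (U i)) (N : Finset κ) :
    HasWeakDeriv μ e (fun x => ∑ i ∈ N, G i x) (fun x => ∑ i ∈ N, U i x) := by
  classical
  induction N using Finset.induction_on with
  | empty => exact ⟨by simp, by simp, by simp⟩
  | insert i N hi ih =>
    simp only [Finset.sum_insert hi]
    exact (h i).add hμ ih

namespace StdGaussian

/-- The smoothed squared gradient `∑ e ∈ N, D e * mehler c (D e)` concentrates around its mean:
by the product rule and Hölder's inequality its partial derivative in direction `e'` is bounded in
`L²` by `(1 + c) ∑ e, ‖D e‖₄ ‖DD e' e‖₄`, and the Poincaré inequality controls the variance. -/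
theorem integral_sq_sub_mean_le (hμ : StdGaussian μ) {c : ℝ} (hc : c ∈ Set.Icc (0 : ℝ) 1)
    {D : ι → (ι → ℝ) → ℝ} {DD : ι → ι → (ι → ℝ) → ℝ} (hD : ∀ e, MemLp (D e) 4 μ)
    (hDD : ∀ e' e, MemLp (DD e' e) 4 μ) (hw : ∀ e' e, HasWeakDeriv μ e' (D e) (DD e' e))
    (hS : ∑' e', (∑' e, eLpNorm (D e) 4 μ * eLpNorm (DD e' e) 4 μ) ^ 2 ≠ ∞) (N : Finset ι) :
    MemLp (fun x => ∑ e ∈ N, D e x * mehler μ c (D e) x) 2 μ ∧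
    ∫ x, (∑ e ∈ N, D e x * mehler μ c (D e) x
        - ∫ y, ∑ e ∈ N, D e y * mehler μ c (D e) y ∂μ) ^ 2 ∂μ
      ≤ (1 + c) ^ 2 *
        (∑' e', (∑' e, eLpNorm (D e) 4 μ * eLpNorm (DD e' e) 4 μ) ^ 2).toReal := by
  have := hμ.isProbabilityMeasure
  have hc1 : 0 ≤ 1 + c := by linarith [hc.1]
  set s : ι → ℝ≥0∞ := fun e' => ∑' e, eLpNorm (D e) 4 μ * eLpNorm (DD e' e) 4 μ with hs
  have hsf : ∀ e', s e' ^ 2 ≠ ∞ := fun e' => ENNReal.ne_top_of_tsum_ne_top hS e'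
  have hsf' : ∀ e', s e' ≠ ∞ := fun e' h => hsf e' (by rw [h]; simp)
  have hm : ∀ {U : (ι → ℝ) → ℝ}, MemLp U 4 μ → MemLp (mehler μ c U) 4 μ := fun hU =>
    hμ.memLp_mehler hc (by norm_num) (by simp) hU
  have hml : ∀ {U : (ι → ℝ) → ℝ}, MemLp U 4 μ → eLpNorm (mehler μ c U) 4 μ ≤ eLpNorm U 4 μ :=
    fun hU => hμ.eLpNorm_mehler_le hc (by norm_num) (by simp) hU.1
  set T' : ι → (ι → ℝ) → ℝ := fun e' x => ∑ e ∈ N,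
    (DD e' e x * mehler μ c (D e) x + D e x * (c * mehler μ c (DD e' e) x)) with hT'
  have hT : ∀ e', HasWeakDeriv μ e' (fun x => ∑ e ∈ N, D e x * mehler μ c (D e) x) (T' e') :=
    fun e' => HasWeakDeriv.sum hμ (fun e => hμ.hasWeakDeriv_mul (hw e' e)
      (hμ.hasWeakDeriv_mehler hc (hw e' e)) (hD e) (hDD e' e) (hm (hD e))
      ((hm (hDD e' e)).const_mul c)) N
  have hb : ∀ e', eLpNorm (T' e') 2 μ ≤ ENNReal.ofReal (1 + c) * s e' := by
    intro e'
    have h1 : ∀ e, eLpNorm (fun x => DD e' e x * mehler μ c (D e) x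
        + D e x * (c * mehler μ c (DD e' e) x)) 2 μ
        ≤ ENNReal.ofReal (1 + c) * (eLpNorm (D e) 4 μ * eLpNorm (DD e' e) 4 μ) := by
      intro e
      have m1 := (hm (hD e)).1
      have m2 := (hm (hDD e' e)).1
      have h2 : eLpNorm (fun x => D e x * (c * mehler μ c (DD e' e) x)) 2 μ
          ≤ ENNReal.ofReal c * (eLpNorm (D e) 4 μ * eLpNorm (DD e' e) 4 μ) := by
        have h3 : (fun x => D e x * (c * mehler μ c (DD e' e) x))
            = c • fun x => D e x * mehler μ c (DD e' e) x := by
          ext x; simp only [Pi.smul_apply, smul_eq_mul]; ring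
        rw [h3, eLpNorm_const_smul, Real.enorm_eq_ofReal hc.1]
        gcongr
        exact (eLpNorm_two_mul_le (hD e).1 m2).trans (mul_le_mul_right (hml (hDD e' e)) _)
      refine (eLpNorm_add_le ((hDD e' e).1.mul m1) ((hD e).1.mul (m2.const_mul c))
        one_le_two).trans ?_
      rw [ENNReal.ofReal_add zero_le_one hc.1, ENNReal.ofReal_one, add_mul, one_mul]
      refine add_le_add ?_ h2
      refine (eLpNorm_two_mul_le (hDD e' e).1 m1).trans ?_
      rw [mul_comm]
      exact mul_le_mul_left (hml (hD e)) _
    have h4 : T' e' = ∑ e ∈ N, fun x => DD e' e x * mehler μ c (D e) x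
        + D e x * (c * mehler μ c (DD e' e) x) := by
      ext x; simp only [hT', Finset.sum_apply]
    rw [h4]
    refine (eLpNorm_sum_le (fun e _ => ((hDD e' e).1.mul (hm (hD e)).1).add
      ((hD e).1.mul ((hm (hDD e' e)).1.const_mul c))) one_le_two).trans ?_
    refine (Finset.sum_le_sum fun e _ => h1 e).trans ?_
    rw [← Finset.mul_sum]
    gcongr
    exact ENNReal.sum_le_tsum N
  have hsq : ∀ e', ∫ x, T' e' x ^ 2 ∂μ ≤ (1 + c) ^ 2 * (s e' ^ 2).toReal := by
    intro e'
    refine (integral_sq_le_of_eLpNorm_le (hT e').memLp_deriv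
      (ENNReal.mul_ne_top ENNReal.ofReal_ne_top (hsf' e')) (hb e')).trans (le_of_eq ?_)
    rw [ENNReal.toReal_mul, ENNReal.toReal_ofReal hc1, ENNReal.toReal_pow, mul_pow]
  have hsum : Summable fun e' => (1 + c) ^ 2 * (s e' ^ 2).toReal :=
    (ENNReal.summable_toReal hS).mul_left _
  have hsumT : Summable fun e' => ∫ x, T' e' x ^ 2 ∂μ :=
    hsum.of_nonneg_of_le (fun e' => integral_nonneg fun x => sq_nonneg _) hsq
  rcases isEmpty_or_nonempty ι with hι | ⟨⟨i⟩⟩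
  · simp [Finset.eq_empty_of_isEmpty N]
  have hTm := (hT i).memLp
  refine ⟨hTm, ?_⟩
  have hp := hμ.poincare ⟨hTm, hT, hsumT⟩
  have hv := variance_eq_sub hTm
  rw [variance_eq_integral hTm.1.aemeasurable] at hv
  simp only [Pi.pow_apply] at hv
  rw [hv]
  refine hp.trans ((hsumT.tsum_le_tsum hsq hsum).trans (le_of_eq ?_))
  rw [tsum_mul_left, ENNReal.tsum_toReal_eq hsf]

/-- The correlation of a bounded function `g` with the smoothed squared gradient, restricted to
finitely many directions, is controlled by the standard deviation of the latter. -/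
theorem abs_sum_corr_sub_le (hμ : StdGaussian μ) {c : ℝ} (hc : c ∈ Set.Icc (0 : ℝ) 1)
    {D : ι → (ι → ℝ) → ℝ} {DD : ι → ι → (ι → ℝ) → ℝ} (hD : ∀ e, MemLp (D e) 4 μ)
    (hDD : ∀ e' e, MemLp (DD e' e) 4 μ) (hw : ∀ e' e, HasWeakDeriv μ e' (D e) (DD e' e))
    (hS : ∑' e', (∑' e, eLpNorm (D e) 4 μ * eLpNorm (DD e' e) 4 μ) ^ 2 ≠ ∞)
    {g : (ι → ℝ) → ℝ} {M : ℝ} (hg : AEStronglyMeasurable g μ) (hM : ∀ x, |g x| ≤ M)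
    (N : Finset ι) :
    |∑ e ∈ N, corr μ c (fun x => g x * D e x) (D e)
        - (∫ x, g x ∂μ) * ∑ e ∈ N, corr μ c (D e) (D e)|
      ≤ M * ((1 + c) *
        √(∑' e', (∑' e, eLpNorm (D e) 4 μ * eLpNorm (DD e' e) 4 μ) ^ 2).toReal) := by
  have := hμ.isProbabilityMeasure
  have hc1 : 0 ≤ 1 + c := by linarith [hc.1]
  obtain ⟨hT, hv⟩ := hμ.integral_sq_sub_mean_le hc hD hDD hw hS N
  set S := (∑' e', (∑' e, eLpNorm (D e) 4 μ * eLpNorm (DD e' e) 4 μ) ^ 2).toReal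
  have hM0 : 0 ≤ M := by
    obtain ⟨x⟩ := μ.nonempty_of_neZero
    exact (abs_nonneg _).trans (hM x)
  have hD2 : ∀ e, MemLp (D e) 2 μ := fun e => (hD e).mono_exponent (by norm_num)
  have hgm : MemLp g 2 μ := MemLp.of_bound hg M (Filter.Eventually.of_forall hM)
  have hgD : ∀ e, MemLp (fun x => g x * D e x) 2 μ := fun e =>
    (memLp_mul_bdd (hD2 e) hg hM).ae_eq (Filter.Eventually.of_forall fun x => mul_comm _ _)
  have hm : ∀ e, MemLp (mehler μ c (D e)) 2 μ := fun e =>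
    hμ.memLp_mehler hc one_le_two (by simp) (hD2 e)
  set T : (ι → ℝ) → ℝ := fun x => ∑ e ∈ N, D e x * mehler μ c (D e) x with hTd
  have h1 : ∑ e ∈ N, corr μ c (fun x => g x * D e x) (D e) = ∫ x, g x * T x ∂μ := by
    simp only [hTd, Finset.mul_sum]
    rw [integral_finsetSum]
    · refine Finset.sum_congr rfl fun e _ => ?_
      rw [← hμ.integral_mul_mehler hc (hgD e) (hD2 e)]
      simp only [mul_assoc]
    · intro e _
      simpa only [mul_assoc] using integrable_mul_of_memLp_two (hgD e) (hm e)
  have h2 : ∑ e ∈ N, corr μ c (D e) (D e) = ∫ x, T x ∂μ := by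
    rw [hTd, integral_finsetSum]
    · exact Finset.sum_congr rfl fun e _ => (hμ.integral_mul_mehler hc (hD2 e) (hD2 e)).symm
    · exact fun e _ => integrable_mul_of_memLp_two (hD2 e) (hm e)
  have h3 : ∫ x, g x * T x ∂μ - (∫ x, g x ∂μ) * ∫ x, T x ∂μ
      = ∫ x, g x * (T x - ∫ y, T y ∂μ) ∂μ := by
    simp only [mul_sub]
    rw [integral_sub (integrable_mul_of_memLp_two hgm hT)
      ((hgm.integrable one_le_two).mul_const _), integral_mul_const]
  rw [h1, h2, h3]
  refine (abs_integral_mul_le hgm (hT.sub (memLp_const _))).trans ?_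
  refine mul_le_mul ?_ ?_ (Real.sqrt_nonneg _) hM0
  · refine Real.sqrt_le_iff.2 ⟨hM0, ?_⟩
    calc ∫ x, g x ^ 2 ∂μ ≤ ∫ x, M ^ 2 ∂μ :=
          integral_mono hgm.integrable_sq (integrable_const _) fun x => by
            simp only; rw [← sq_abs]; exact pow_le_pow_left₀ (abs_nonneg _) (hM x) 2
      _ = M ^ 2 := by simp
  · rw [← Real.sqrt_sq hc1, ← Real.sqrt_mul (sq_nonneg _)]
    exact Real.sqrt_le_sqrt hv

/-- The Stein discrepancy of a Gaussian functional. Both terms are integrals over `c ∈ [0, 1]` of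
expressions in the gradient of `F`, and the integrands differ only by the correlation of `f' (F)`
with the smoothed squared gradient. -/
theorem abs_stein_le (hμ : StdGaussian μ) {F : (ι → ℝ) → ℝ} {D : ι → (ι → ℝ) → ℝ}
    {DD : ι → ι → (ι → ℝ) → ℝ} (hF : IsSobolev μ F D) (hF1 : ∫ x, F x ∂μ = 0)
    (hF2 : ∫ x, F x ^ 2 ∂μ = 1) (hD : ∀ e, MemLp (D e) 4 μ)
    (hDD : ∀ e' e, MemLp (DD e' e) 4 μ) (hw : ∀ e' e, HasWeakDeriv μ e' (D e) (DD e' e))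
    (hS : ∑' e', (∑' e, eLpNorm (D e) 4 μ * eLpNorm (DD e' e) 4 μ) ^ 2 ≠ ∞)
    {f f' : ℝ → ℝ} {M : ℝ} (hf : ∀ x, HasDerivAt f (f' x) x) (hf' : Continuous f')
    (hM : ∀ x, |f' x| ≤ M) :
    |∫ x, F x * f (F x) ∂μ - ∫ x, f' (F x) ∂μ| ≤ 3 / 2 * (M *
      √(∑' e', (∑' e, eLpNorm (D e) 4 μ * eLpNorm (DD e' e) 4 μ) ^ 2).toReal) := by
  have := hμ.isProbabilityMeasure
  have hM0 : 0 ≤ M := (abs_nonneg _).trans (hM 0)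
  set S := (∑' e', (∑' e, eLpNorm (D e) 4 μ * eLpNorm (DD e' e) 4 μ) ^ 2).toReal with hSd
  have hD2 : ∀ e, MemLp (D e) 2 μ := fun e => (hF.hasWeakDeriv e).memLp_deriv
  have hg : AEStronglyMeasurable (fun x => f' (F x)) μ := hf'.comp_aestronglyMeasurable hF.memLp.1
  have hgD : ∀ e, MemLp (fun x => f' (F x) * D e x) 2 μ := fun e =>
    (memLp_mul_bdd (hD2 e) hg fun x => hM (F x)).ae_eq
      (Filter.Eventually.of_forall fun x => mul_comm _ _)
  have hsob : IsSobolev μ (fun x => f (F x)) (fun e x => f' (F x) * D e x) := by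
    refine ⟨memLp_comp_of_hasDerivAt hF.memLp hf hM, fun e =>
      hμ.hasWeakDeriv_comp (hF.hasWeakDeriv e) hf hf' hM, ?_⟩
    refine (hF.summable.mul_left (M ^ 2)).of_nonneg_of_le
      (fun e => integral_nonneg fun x => sq_nonneg _) fun e => ?_
    rw [← integral_const_mul]
    refine integral_mono (hgD e).integrable_sq ((hD2 e).integrable_sq.const_mul _) fun x => ?_
    simp only
    rw [mul_pow, ← sq_abs (f' _)]
    exact mul_le_mul_of_nonneg_right (pow_le_pow_left₀ (abs_nonneg _) (hM _) 2) (sq_nonneg _)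
  obtain ⟨c1, i1⟩ := hμ.covariance hsob hF
  obtain ⟨c2, i2⟩ := hμ.covariance hF hF
  rw [hF1, mul_zero, sub_zero] at i1 i2
  simp only [← pow_two, hF2] at i2
  set m := ∫ x, f' (F x) ∂μ with hm
  have hint1 := c1.intervalIntegrable_of_Icc (μ := volume) zero_le_one
  have hint2 := c2.intervalIntegrable_of_Icc (μ := volume) zero_le_one
  have h1 : ∀ c ∈ Set.Icc (0 : ℝ) 1,
      ‖gradCorr μ (fun e x => f' (F x) * D e x) D c - m * gradCorr μ D D c‖
        ≤ M * ((1 + c) * √S) := by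
    intro c hc
    have s1 := (hμ.abs_gradCorr_le hc hgD hD2 hsob.summable hF.summable).1.hasSum
    have s2 := (hμ.abs_gradCorr_le hc hD2 hD2 hF.summable hF.summable).1.hasSum
    refine le_of_tendsto' (Filter.Tendsto.norm (s1.sub (s2.mul_left m))) fun N => ?_
    have := hμ.abs_sum_corr_sub_le hc hD hDD hw hS hg (fun x => hM (F x)) N
    simpa [Finset.sum_sub_distrib, Finset.mul_sum] using this
  have h2 : ∫ x, F x * f (F x) ∂μ - m
      = ∫ c in (0 : ℝ)..1,
        (gradCorr μ (fun e x => f' (F x) * D e x) D c - m * gradCorr μ D D c) := by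
    rw [intervalIntegral.integral_sub hint1 (hint2.const_mul m),
      intervalIntegral.integral_const_mul, i1, i2, mul_one]
    simp only [mul_comm]
  have h3 : ∫ c in (0 : ℝ)..1, M * ((1 + c) * √S) = 3 / 2 * (M * √S) := by
    rw [intervalIntegral.integral_const_mul, intervalIntegral.integral_mul_const,
      intervalIntegral.integral_add (by simp) (by simp), integral_id]
    simp; ring
  rw [h2, ← h3, ← Real.norm_eq_abs]
  refine intervalIntegral.norm_integral_le_of_norm_le zero_le_one
    (Filter.Eventually.of_forall fun c hc => h1 c ⟨hc.1.le, hc.2⟩) ?_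
  exact (Continuous.intervalIntegrable (by fun_prop) _ _)

end StdGaussian

/-- The Gaussian approximation bound for functions on `ι → ℝ`. The constant comes from
`3 / 2 * √(2 / π) ≤ √(5 / π)`. -/
theorem StdGaussian.integral_lipschitz_sub_le (hμ : StdGaussian μ) {F : (ι → ℝ) → ℝ}
    {D : ι → (ι → ℝ) → ℝ} {DD : ι → ι → (ι → ℝ) → ℝ} (hF : IsSobolev μ F D)
    (hF1 : ∫ x, F x ∂μ = 0) (hF2 : ∫ x, F x ^ 2 ∂μ = 1) (hD : ∀ e, MemLp (D e) 4 μ)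
    (hDD : ∀ e' e, MemLp (DD e' e) 4 μ) (hw : ∀ e' e, HasWeakDeriv μ e' (D e) (DD e' e))
    (hS : ∑' e', (∑' e, eLpNorm (D e) 4 μ * eLpNorm (DD e' e) 4 μ) ^ 2 ≠ ∞)
    {h : ℝ → ℝ} (hh : LipschitzWith 1 h) :
    ∫ x, h (F x) ∂μ - ∫ y, h y ∂gaussianReal 0 1 ≤ √(5 / Real.pi) *
      √(∑' e', (∑' e, eLpNorm (D e) 4 μ * eLpNorm (DD e' e) 4 μ) ^ 2).toReal := by
  have := hμ.isProbabilityMeasure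
  set S := (∑' e', (∑' e, eLpNorm (D e) 4 μ * eLpNorm (DD e' e) 4 μ) ^ 2).toReal with hSd
  refine le_of_forall_pos_le_add fun ε hε => ?_
  obtain ⟨g, g', hg, hgc, hg1, hgh⟩ := exists_smooth_approx hh (half_pos hε)
  obtain ⟨f, f', hf, hfc, hf1, hst⟩ := exists_stein_solution hg hgc hg1
  have hgcont : Continuous g := continuous_iff_continuousAt.2 fun x => (hg x).continuousAt
  have hint : ∀ {k : ℝ → ℝ} {A : ℝ}, Continuous k → (∀ x, |k x| ≤ A + |x|) →
      Integrable (fun x => k (F x)) μ ∧ Integrable k (gaussianReal 0 1) := by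
    intro k A hk hb
    have iF : Integrable F μ := hF.memLp.integrable one_le_two
    have iY : Integrable (fun x : ℝ => x) (gaussianReal 0 1) :=
      (memLp_id_gaussianReal (μ := 0) (v := 1) 1).integrable le_rfl
    exact ⟨((integrable_const A).add iF.abs).mono' (hk.comp_aestronglyMeasurable iF.1)
      (Filter.Eventually.of_forall fun x => hb _),
      ((integrable_const A).add iY.abs).mono' hk.aestronglyMeasurable
      (Filter.Eventually.of_forall fun x => hb _)⟩
  have hgb : ∀ x, |g x| ≤ |g 0| + |x| := fun x => by
    simpa using abs_le_of_hasDerivAt hg hg1 x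
  have hhb : ∀ x, |h x| ≤ |h 0| + |x| := fun x => by
    have h1 := hh.dist_le_mul x 0
    rw [Real.dist_eq, Real.dist_eq, sub_zero, NNReal.coe_one, one_mul] at h1
    linarith [abs_sub_abs_le_abs_sub (h x) (h 0)]
  obtain ⟨ig1, ig2⟩ := hint hgcont hgb
  obtain ⟨ih1, ih2⟩ := hint hh.continuous hhb
  have e1 : ∫ x, h (F x) ∂μ ≤ ∫ x, g (F x) ∂μ + ε / 2 := by
    have h1 : ∫ x, (h (F x) - g (F x)) ∂μ ≤ ∫ _, ε / 2 ∂μ :=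
      integral_mono (ih1.sub ig1) (integrable_const _) fun x => by
        have := (abs_le.1 (hgh (F x))).1
        simp only; linarith
    rw [integral_sub ih1 ig1] at h1
    simp only [integral_const, probReal_univ, one_smul] at h1
    linarith
  have e2 : ∫ y, g y ∂gaussianReal 0 1 ≤ ∫ y, h y ∂gaussianReal 0 1 + ε / 2 := by
    have h1 : ∫ y, (g y - h y) ∂gaussianReal 0 1 ≤ ∫ _, ε / 2 ∂gaussianReal 0 1 :=
      integral_mono (ig2.sub ih2) (integrable_const _) fun y => (abs_le.1 (hgh y)).2
    rw [integral_sub ig2 ih2] at h1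
    simp only [integral_const, probReal_univ, one_smul] at h1
    linarith
  have hfF : MemLp (fun x => f (F x)) 2 μ := memLp_comp_of_hasDerivAt hF.memLp hf hf1
  have if' : Integrable (fun x => f' (F x)) μ :=
    (integrable_const √(2 / Real.pi)).mono' (hfc.comp_aestronglyMeasurable hF.memLp.1)
      (Filter.Eventually.of_forall fun x => hf1 _)
  have e3 : ∫ x, g (F x) ∂μ - ∫ y, g y ∂gaussianReal 0 1
      = ∫ x, f' (F x) ∂μ - ∫ x, F x * f (F x) ∂μ := by
    rw [← integral_sub if' (integrable_mul_of_memLp_two hF.memLp hfF)]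
    simp only [hst]
    rw [integral_sub ig1 (integrable_const _)]
    simp
  have e4 := hμ.abs_stein_le hF hF1 hF2 hD hDD hw hS hf hfc hf1
  have e5 : 3 / 2 * √(2 / Real.pi) ≤ √(5 / Real.pi) := by
    refine Real.le_sqrt_of_sq_le ?_
    rw [mul_pow, Real.sq_sqrt (by positivity), mul_div_assoc']
    exact div_le_div_of_nonneg_right (by norm_num) Real.pi_pos.le
  have e6 := mul_le_mul_of_nonneg_right e5 (Real.sqrt_nonneg S)
  linarith [(abs_le.1 e4).1]

/-! ### Transfer to the canonical space -/

theorem sigma_eq_comap {Ω : Type*} (ζ : ι → Ω → ℝ) :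
    sigma ζ = MeasurableSpace.comap (fun ω e => ζ e ω) MeasurableSpace.pi := by
  rw [MeasurableSpace.pi, MeasurableSpace.comap_iSup]
  simp only [MeasurableSpace.comap_comp]
  rfl

/-- A functional of `ζ` is a function of the vector `(ζ e)`. -/
theorem IsL2Functional.exists_comp {Ω : Type*} [MeasurableSpace Ω] {P : Measure Ω}
    {ζ : ι → Ω → ℝ} {G : Ω → ℝ} (hG : IsL2Functional P ζ G) :
    ∃ g : (ι → ℝ) → ℝ, Measurable g ∧ G =ᵐ[P] fun ω => g fun e => ζ e ω := by
  obtain ⟨G', hG', hGG⟩ := hG.1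
  have h1 := hG'.measurable
  rw [sigma_eq_comap] at h1
  obtain ⟨g, hg, rfl⟩ := h1.exists_eq_measurable_comp
  exact ⟨g, hg, hGG⟩

/-- Integration by parts against `cos (L + a)`, which is bounded but not compactly supported: the
test functions are `χ (x / n) * cos (L x + a)` with a smooth cutoff `χ`. The
vector `v` is the direction of `partialDeriv Λ · e`: the `e`-th unit vector, or `0` if `e ∉ Λ`. -/
theorem IsWeakDeriv.integral_mul_cos {Ω : Type*} [MeasurableSpace Ω] {P : Measure Ω}
    [IsProbabilityMeasure P] {ζ : ι → Ω → ℝ} (hζm : ∀ e, Measurable (ζ e)) {e : ι} {G U : Ω → ℝ}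
    (hG : MemLp G 2 P) (hζ : MemLp (ζ e) 2 P) (h : IsWeakDeriv P ζ e G U) (Λ : Finset ι)
    (L : (Λ → ℝ) →L[ℝ] ℝ) (a : ℝ) {v : Λ → ℝ}
    (hv : ∀ (η : (Λ → ℝ) → ℝ) (x : Λ → ℝ), partialDeriv Λ η e x = fderiv ℝ η x v) :
    ∫ ω, U ω * Real.cos (L (coords ζ Λ ω) + a) ∂P
      = ∫ ω, G ω * ζ e ω * Real.cos (L (coords ζ Λ ω) + a) ∂P
        + ∫ ω, G ω * (L v * Real.sin (L (coords ζ Λ ω) + a)) ∂P := by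
  have hX : Measurable (coords ζ Λ) := measurable_pi_lambda _ fun i => hζm i
  have hU := h.1.2
  have hGζ : Integrable (fun ω => G ω * ζ e ω) P := integrable_mul_of_memLp_two hG hζ
  let χ : ContDiffBump (0 : Λ → ℝ) := ⟨1, 2, one_pos, one_lt_two⟩
  have hχs : ContDiff ℝ (⊤ : ℕ∞) χ := χ.contDiff
  have hχ1 : ∀ y, |χ y| ≤ 1 := fun y => by rw [abs_of_nonneg χ.nonneg]; exact χ.le_one
  have hχd : Continuous fun y => fderiv ℝ χ y v :=
    (hχs.continuous_fderiv (by simp)).clm_apply continuous_const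
  obtain ⟨C, hC⟩ : ∃ C, ∀ y, |fderiv ℝ χ y v| ≤ C := by
    have hs : HasCompactSupport fun y => fderiv ℝ χ y v :=
      χ.hasCompactSupport.fderiv_apply (𝕜 := ℝ) v
    obtain ⟨C, hC⟩ := hs.exists_bound_of_continuous hχd
    exact ⟨C, hC⟩
  have hC0 : 0 ≤ C := (abs_nonneg _).trans (hC 0)
  set r : ℕ → ℝ := fun n => 1 / ((n : ℝ) + 1) with hr
  have hr0 : ∀ n, r n ≠ 0 := fun n => by positivity
  have hr1 : ∀ n, |r n| ≤ 1 := fun n => by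
    have : (0 : ℝ) < (n : ℝ) + 1 := by positivity
    rw [hr, abs_of_pos (by positivity), div_le_one this]
    linarith [Nat.cast_nonneg (α := ℝ) n]
  have hrt : Filter.Tendsto r Filter.atTop (nhds 0) := tendsto_one_div_add_atTop_nhds_zero_nat
  set η : ℕ → (Λ → ℝ) → ℝ := fun n y => χ (r n • y) * Real.cos (L y + a) with hη
  have hηs : ∀ n, ContDiff ℝ (⊤ : ℕ∞) (η n) := fun n =>
    (hχs.comp (contDiff_const_smul (r n))).mul
      (Real.contDiff_cos.comp (L.contDiff.add contDiff_const))
  have hηc : ∀ n, HasCompactSupport (η n) := fun n =>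
    (χ.hasCompactSupport.comp_homeomorph (Homeomorph.smulOfNeZero (r n) (hr0 n))).mul_right
  have hηd : ∀ n y, partialDeriv Λ (η n) e y
      = r n * fderiv ℝ χ (r n • y) v * Real.cos (L y + a)
        - χ (r n • y) * (L v * Real.sin (L y + a)) := by
    intro n y
    have h1 : HasFDerivAt (fun y => χ (r n • y))
        ((fderiv ℝ χ (r n • y)).comp (r n • ContinuousLinearMap.id ℝ (Λ → ℝ))) y :=
      ((hχs.differentiable (by simp)) _).hasFDerivAt.comp y
        ((hasFDerivAt_id y).const_smul (r n))
    have h2 := (L.hasFDerivAt (x := y).add_const a).cos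
    have h3 : HasFDerivAt (η n) _ y := h1.mul h2
    rw [hv, h3.fderiv]
    simp
    ring
  have key := fun n => h.2 Λ (η n) (hηs n) (hηc n)
  have hcos : Measurable fun ω => Real.cos (L (coords ζ Λ ω) + a) :=
    (Real.continuous_cos.comp (L.continuous.add continuous_const)).measurable.comp hX
  have hsin : Measurable fun ω => Real.sin (L (coords ζ Λ ω) + a) :=
    (Real.continuous_sin.comp (L.continuous.add continuous_const)).measurable.comp hX
  have hsm : ∀ n, Continuous fun y : Λ → ℝ => r n • y := fun n => continuous_const_smul (r n)
  have hχm : ∀ n, Measurable fun ω => χ (r n • coords ζ Λ ω) := fun n =>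
    (χ.continuous.comp (hsm n)).measurable.comp hX
  have hχt : ∀ y : Λ → ℝ, Filter.Tendsto (fun n => χ (r n • y)) Filter.atTop (nhds 1) := by
    intro y
    have h1 : Filter.Tendsto (fun n => r n • y) Filter.atTop (nhds 0) := by
      simpa using hrt.smul_const y
    have h2 := (χ.continuous.tendsto 0).comp h1
    rwa [χ.one_of_mem_closedBall (Metric.mem_closedBall_self χ.rIn_pos.le)] at h2
  have hηm : ∀ n, Measurable fun ω => η n (coords ζ Λ ω) := fun n =>
    (hηs n).continuous.measurable.comp hX
  have hηb : ∀ n y, |η n y| ≤ 1 := fun n y => by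
    rw [hη, abs_mul]
    exact mul_le_one₀ (hχ1 _) (abs_nonneg _) (Real.abs_cos_le_one _)
  have hηt : ∀ y, Filter.Tendsto (fun n => η n y) Filter.atTop (nhds (Real.cos (L y + a))) := by
    intro y
    simpa using (hχt y).mul_const (Real.cos (L y + a))
  have hlim : ∀ {W : Ω → ℝ}, Integrable W P →
      Filter.Tendsto (fun n => ∫ ω, W ω * η n (coords ζ Λ ω) ∂P) Filter.atTop
        (nhds (∫ ω, W ω * Real.cos (L (coords ζ Λ ω) + a) ∂P)) := by
    intro W hW
    refine tendsto_integral_of_dominated_convergence (fun ω => |W ω|)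
      (fun n => hW.1.mul (hηm n).aestronglyMeasurable) hW.abs
      (fun n => Filter.Eventually.of_forall fun ω => ?_)
      (Filter.Eventually.of_forall fun ω => (hηt _).const_mul _)
    rw [norm_mul]
    exact mul_le_of_le_one_right (abs_nonneg _) (hηb n _)
  have hlimd : Filter.Tendsto (fun n => ∫ ω, G ω * partialDeriv Λ (η n) e (coords ζ Λ ω) ∂P)
      Filter.atTop (nhds (∫ ω, G ω * -(L v * Real.sin (L (coords ζ Λ ω) + a)) ∂P)) := by
    simp only [hηd]
    refine tendsto_integral_of_dominated_convergence (fun ω => |G ω| * (C + |L v|))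
      (fun n => hG.1.mul ?_) ((hG.integrable one_le_two).abs.mul_const _)
      (fun n => Filter.Eventually.of_forall fun ω => ?_)
      (Filter.Eventually.of_forall fun ω => Filter.Tendsto.const_mul _ ?_)
    · exact ((((hχd.comp (hsm n)).measurable.comp hX).const_mul (r n)).mul hcos).sub
        ((hχm n).mul (hsin.const_mul (L v))) |>.aestronglyMeasurable
    · rw [norm_mul]
      refine mul_le_mul_of_nonneg_left ((norm_sub_le _ _).trans (add_le_add ?_ ?_)) (abs_nonneg _)
      · rw [norm_mul, norm_mul]
        refine (mul_le_of_le_one_right (by positivity) (Real.abs_cos_le_one _)).trans ?_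
        exact (mul_le_of_le_one_left (norm_nonneg _) (hr1 n)).trans (hC _)
      · rw [norm_mul, norm_mul]
        refine (mul_le_of_le_one_left (by positivity) (hχ1 _)).trans ?_
        exact mul_le_of_le_one_right (norm_nonneg _) (Real.abs_sin_le_one _)
    · have h1 : Filter.Tendsto (fun n => r n * fderiv ℝ χ (r n • coords ζ Λ ω) v) Filter.atTop
          (nhds 0) := by
        refine squeeze_zero_norm (a := fun n => |r n| * C) (fun n => ?_)
          (by simpa using hrt.abs.mul_const C)
        rw [norm_mul]
        exact mul_le_mul_of_nonneg_left (hC _) (abs_nonneg _)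
      simpa using (h1.mul_const (Real.cos (L (coords ζ Λ ω) + a))).sub
        ((hχt (coords ζ Λ ω)).mul_const (L v * Real.sin (L (coords ζ Λ ω) + a)))
  have h1 := tendsto_nhds_unique (hlim (hU.integrable one_le_two))
    (((hlim hGζ).sub hlimd).congr fun n => (key n).symm)
  rw [h1]
  simp only [mul_neg, integral_neg, sub_neg_eq_add]

/-- Weak derivatives on `Ω` are weak derivatives on `ι → ℝ`. -/
theorem IsWeakDeriv.hasWeakDeriv {Ω : Type*} [MeasurableSpace Ω] {P : Measure Ω}
    [IsProbabilityMeasure P] {ζ : ι → Ω → ℝ} (hζm : ∀ e, Measurable (ζ e))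
    (hμ : StdGaussian (P.map fun ω e => ζ e ω)) {e : ι} {G U : Ω → ℝ} {g u : (ι → ℝ) → ℝ}
    (h : IsWeakDeriv P ζ e G U) (hG : MemLp G 2 P) (hg : Measurable g) (hu : Measurable u)
    (hGg : G =ᵐ[P] fun ω => g fun e => ζ e ω) (hUu : U =ᵐ[P] fun ω => u fun e => ζ e ω) :
    HasWeakDeriv (P.map fun ω e => ζ e ω) e g u := by
  classical
  have hZ : Measurable fun ω e => ζ e ω := measurable_pi_lambda _ hζm
  refine ⟨(memLp_map_measure_iff hg.aestronglyMeasurable hZ.aemeasurable).2 (hG.ae_eq hGg),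
    (memLp_map_measure_iff hu.aestronglyMeasurable hZ.aemeasurable).2 (h.1.2.ae_eq hUu),
    fun l a => ?_⟩
  have hζ : MemLp (ζ e) 2 P := (memLp_map_measure_iff (f := fun ω e => ζ e ω)
    (g := fun x : ι → ℝ => x e) (measurable_pi_apply e).aestronglyMeasurable hZ.aemeasurable).1
    (hμ.memLp_eval e (by simp))
  obtain ⟨Λ, hΛ⟩ : ∃ Λ : Finset ι, insert e l.support ⊆ Λ := ⟨_, le_rfl⟩
  have hlΛ : l.support ⊆ Λ := (Finset.subset_insert e _).trans hΛ
  have heΛ : e ∈ Λ := hΛ (Finset.mem_insert_self e _)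
  set L : (Λ → ℝ) →L[ℝ] ℝ := ∑ i : Λ, l i • ContinuousLinearMap.proj i with hL
  have hLl : ∀ x : ι → ℝ, L (fun i : Λ => x i) = lin l x := by
    intro x
    rw [lin_eq_sum hlΛ, ← Finset.sum_coe_sort]
    simp [hL]
  have hLv : L (fun i : Λ => if (i : ι) = e then 1 else 0) = l e := by
    have := hLl fun i => if i = e then 1 else 0
    rw [this, lin_eq_sum hlΛ]
    simp [heΛ]
  have key := h.integral_mul_cos hζm hG hζ Λ L a
    (v := fun i : Λ => if (i : ι) = e then 1 else 0) fun η x => by rw [partialDeriv]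
  rw [hLv] at key
  have hc : ∀ ω, L (coords ζ Λ ω) = lin l fun e => ζ e ω := fun ω => hLl fun e => ζ e ω
  simp only [hc] at key
  have hcm : AEStronglyMeasurable (fun ω => Real.cos (lin l (fun e => ζ e ω) + a)) P :=
    ((measurable_wave l a).comp hZ).aestronglyMeasurable
  have hsm : AEStronglyMeasurable (fun ω => Real.sin (lin l (fun e => ζ e ω) + a)) P :=
    ((measurable_swave l a).comp hZ).aestronglyMeasurable
  have i1 : Integrable (fun ω => G ω * ζ e ω * Real.cos (lin l (fun e => ζ e ω) + a)) P :=
    (integrable_mul_of_memLp_two hG hζ).mul_bdd (c := 1) hcm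
      (Filter.Eventually.of_forall fun ω => Real.abs_cos_le_one _)
  have i2 : Integrable (fun ω => G ω * (l e * Real.sin (lin l (fun e => ζ e ω) + a))) P := by
    have := (((hG.integrable one_le_two).mul_const (l e))).mul_bdd (c := 1) hsm
      (Filter.Eventually.of_forall fun ω => Real.abs_sin_le_one _)
    simpa only [mul_assoc] using this
  rw [← integral_add i1 i2] at key
  have m1 : Measurable fun x => u x * wave l a x := hu.mul (measurable_wave l a)
  have m2 : Measurable fun x => g x * (x e * wave l a x + l e * swave l a x) :=
    hg.mul (((measurable_pi_apply e).mul (measurable_wave l a)).add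
      ((measurable_swave l a).const_mul (l e)))
  rw [integral_map hZ.aemeasurable m1.aestronglyMeasurable,
    integral_map hZ.aemeasurable m2.aestronglyMeasurable]
  calc _ = ∫ ω, U ω * Real.cos (lin l (fun e => ζ e ω) + a) ∂P := by
        refine integral_congr_ae ?_
        filter_upwards [hUu] with ω hω
        rw [hω, wave]
    _ = _ := by
        rw [key]
        refine integral_congr_ae ?_
        filter_upwards [hGg] with ω hω
        rw [hω, wave, swave]
        ring

end GaussFunctional

theorem mainTheorem4 {ι Ω Ω' : Type*} [Countable ι] [MeasurableSpace Ω] [MeasurableSpace Ω']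
    (P : Measure Ω) [IsProbabilityMeasure P] (Q : Measure Ω') [IsProbabilityMeasure Q]
    (ζ : ι → Ω → ℝ) (hζm : ∀ e, Measurable (ζ e)) (hζi : iIndepFun ζ P)
    (hζ : ∀ e, P.map (ζ e) = gaussianReal 0 1)
    (F : Ω → ℝ) (hF : GaussFunctional.IsL2Functional P ζ F)
    (hF1 : ∫ ω, F ω ∂P = 0) (hF2 : ∫ ω, F ω ^ 2 ∂P = 1)
    (DF : ι → Ω → ℝ) (hDF : ∀ e, GaussFunctional.IsWeakDeriv P ζ e F (DF e))
    (DDF : ι → ι → Ω → ℝ)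
    (hDDF : ∀ e' e, GaussFunctional.IsWeakDeriv P ζ e' (DF e) (DDF e' e))
    (hDF4 : ∑' e, eLpNorm (DF e) 4 P ^ 2 < ∞)
    (hDDF4 : ∀ e' e, eLpNorm (DDF e' e) 4 P < ∞)
    (Y : Ω' → ℝ) (hY : HasLaw Y (gaussianReal 0 1) Q) :
    GaussFunctional.kantorovich P F Q Y ≤
      ((ENNReal.ofReal (Real.sqrt (5 / Real.pi)) *
        (∑' e', (∑' e, eLpNorm (DF e) 4 P * eLpNorm (DDF e' e) 4 P) ^ 2) ^ (1 / 2 : ℝ) :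
          ℝ≥0∞) : EReal) := by
  have hμ := GaussFunctional.stdGaussian_map hζm hζi hζ
  have hZ : Measurable fun ω e => ζ e ω := measurable_pi_lambda _ hζm
  set Z : Ω → ι → ℝ := fun ω e => ζ e ω with hZd
  have := hμ.isProbabilityMeasure
  obtain ⟨f, hfm, hFf⟩ := hF.exists_comp
  choose d hdm hDd using fun e => (hDF e).1.exists_comp
  choose dd hddm hDDd using fun e' e => (hDDF e' e).1.exists_comp
  have hnorm : ∀ {G : Ω → ℝ} {g : (ι → ℝ) → ℝ} (q : ℝ≥0∞), Measurable g →
      G =ᵐ[P] (fun ω => g (Z ω)) → eLpNorm G q P = eLpNorm g q (P.map Z) := by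
    intro G g q hg hGg
    rw [eLpNorm_map_measure hg.aestronglyMeasurable hZ.aemeasurable, eLpNorm_congr_ae hGg]
    rfl
  simp only [hnorm 4 (hdm _) (hDd _), hnorm 4 (hddm _ _) (hDDd _ _)] at hDF4 hDDF4 ⊢
  set S := ∑' e', (∑' e, eLpNorm (d e) 4 (P.map Z) * eLpNorm (dd e' e) 4 (P.map Z)) ^ 2 with hSd
  refine iSup_le fun h => ?_
  have h5 : 0 < √(5 / Real.pi) := by positivity
  by_cases hS : S = ∞
  · rw [hS, ENNReal.top_rpow_of_pos (by norm_num), ENNReal.mul_top (by simpa using h5)]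
    exact le_top
  have hd4 : ∀ e, MemLp (d e) 4 (P.map Z) := fun e => by
    refine ⟨(hdm e).aestronglyMeasurable, lt_top_iff_ne_top.2 fun ht => ?_⟩
    exact ENNReal.ne_top_of_tsum_ne_top hDF4.ne e (by rw [ht]; simp)
  have hw : ∀ e, GaussFunctional.HasWeakDeriv (P.map Z) e f (d e) := fun e =>
    (hDF e).hasWeakDeriv hζm hμ hF.2 hfm (hdm e) hFf (hDd e)
  have hsob : GaussFunctional.IsSobolev (P.map Z) f d := by
    refine ⟨(memLp_map_measure_iff hfm.aestronglyMeasurable hZ.aemeasurable).2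
      (hF.2.ae_eq hFf), hw, ?_⟩
    refine (ENNReal.summable_toReal hDF4.ne).of_nonneg_of_le
      (fun e => integral_nonneg fun x => sq_nonneg _) fun e => ?_
    rw [ENNReal.toReal_pow]
    exact GaussFunctional.integral_sq_le_of_eLpNorm_le (hw e).memLp_deriv (hd4 e).2.ne
      (eLpNorm_le_eLpNorm_of_exponent_le (by norm_num) (hdm e).aestronglyMeasurable)
  have hint : ∀ {k : ℝ → ℝ}, Continuous k →
      ∫ ω, k (F ω) ∂P = ∫ x, k (f x) ∂P.map Z := by
    intro k hk
    have hm : Measurable fun x => k (f x) := hk.measurable.comp hfm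
    rw [integral_map hZ.aemeasurable hm.aestronglyMeasurable]
    exact integral_congr_ae (hFf.mono fun ω hω => congrArg k hω)
  have main := hμ.integral_lipschitz_sub_le hsob ((hint continuous_id).symm.trans hF1)
    ((hint (continuous_pow 2)).symm.trans hF2) hd4
    (fun e' e => ⟨(hddm e' e).aestronglyMeasurable, hDDF4 e' e⟩)
    (fun e' e => (hDDF e' e).hasWeakDeriv hζm hμ (hDF e).1.2 (hdm e) (hddm e' e) (hDd e)
      (hDDd e' e)) hS h.2
  rw [← hint h.2.continuous, ← hY.map_eq,
    integral_map hY.aemeasurable h.2.continuous.aestronglyMeasurable] at main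
  have hfin : ENNReal.ofReal √(5 / Real.pi) * S ^ (1 / 2 : ℝ) ≠ ∞ :=
    ENNReal.mul_ne_top ENNReal.ofReal_ne_top (ENNReal.rpow_ne_top_of_nonneg (by norm_num) hS)
  rw [← EReal.coe_ennreal_toReal hfin, EReal.coe_le_coe_iff, ENNReal.toReal_mul,
    ENNReal.toReal_ofReal h5.le, ← ENNReal.toReal_rpow, ← Real.sqrt_eq_rpow]
  exact main
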